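/- Let $k=\mathbb{Q}$ (number field case, NF) or $k=\mathbb{F}_r(t)$ (function field case, FF), and let $\mathcal{K}$ be an infinite global field, i.e. an infinite separable algebraic extension of $k$, with $\mathcal{K}\cap\overline{\mathbb{F}_r}=\mathbb{F}_r$ in case FF. The global fields in $\mathcal{K}$ are the finite extensions $K$ of $k$ contained in $\mathcal{K}$; put $n_K=[K:k]$, and let $g_K$ be $\frac12\log|D_K|$ (NF), resp. the genus of $K/\mathbb{F}_r$ (FF). A tower with union $\mathcal{K}$ is a strictly increasing sequence $(K_i)_{i\in\mathbb{N}}$ of global fields in $\mathcal{K}$ with $\bigcup_i K_i=\mathcal{K}$. In case NF, $\mathcal{K}$ is called asymptotically good if there is $q\in\{\mathbb{R},\mathbb{C}\}\cup\{\text{prime powers}\}$ for which $\phi_q(\mathcal{K})=\lim_i \Phi_q(K_i)/g_{K_i}$ (the same limit for every tower with union $\mathcal{K}$) exists and is positive, where $\Phi_q(K)$ is the number of real places, of complex places, resp. of non-archimedean places of norm $q$ of $K$. In case FF, $\phi_\infty(\mathcal{K})=\lim_i n_{K_i}/g_{K_i}\in[0,\infty]$ (the same limit for every tower with union $\mathcal{K}$),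 with $n/0=\infty$ for $n>0$. For an extension $M/K$ of a global field $K$ let $\mathrm{Ram}(M/K)$, resp. $\mathrm{Rams}(M/K)$, be the set of non-archimedean places of $K$ that are ramified, resp. wildly ramified, in some finite subextension of $M/K$. Suppose that $$\inf_{K'}\#\mathrm{Rams}(\mathcal{K}/K')=0,$$ where $K'$ runs over the global fields in $\mathcal{K}$. Then: 1. If $\mathrm{Ram}(\mathcal{K}/k)$ is finite, then $\mathcal{K}$ is asymptotically good (NF), resp. $\phi_\infty(\mathcal{K})$ exists and is positive (FF). 2. If $\mathcal{K}/K$ is Galois for some global field $K$ in $\mathcal{K}$, then conversely, if $\mathcal{K}$ is asymptotically good (NF), resp. $\phi_\infty(\mathcal{K})>0$ (FF), then $\mathrm{Ram}(\mathcal{K}/k)$ is finite. 3. If $(K_i)_{i\in\mathbb{N}}$ is a tower with union $\mathcal{K}$ such that $K_{i+1}/K_i$ is Galois for every $i$, then $\mathcal{K}$ is asymptotically good (NF), resp. $\phi_\infty(\mathcal{K})$ exists and is positive (FF), if and only if $$\sum_{i=0}^\infty\frac1{n_{K_i}}\sum_{\mathfrak{p}\in\mathrm{Ram}(K_{i+1}/K_i)}\log\mathrm{N}\mathfrak{p}<\infty,$$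 where $\log$ is the logarithm to base $e$ (NF), resp. base $r$ (FF), and $\mathrm{N}\mathfrak{p}$ is the number of elements of the residue field of $\mathfrak{p}$. -/

import Mathlib

open Filter Topology
open scoped ENNReal

noncomputable section

namespace InfGlobal

/-! ### Non-archimedean places, norms, ramification -/

/-- The non-archimedean places of a field, given by their discrete valuation rings. (In a global
field every valuation ring other than the field itself is discrete.) -/
def Place (K : Type*) [Field K] : Type _ :=
  {V : ValuationSubring K // IsDiscreteValuationRing V}

namespace Place

variable {K L : Type*} [Field K] [Field L]

instance (P : Place K) : IsDiscreteValuationRing P.1 := P.2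

/-- The residue field of a place. -/
abbrev ResidueField (P : Place K) : Type _ := IsLocalRing.ResidueField P.1

/-- The norm `N P`: the number of elements of the residue field. -/
def norm (P : Place K) : ℕ := Nat.card P.ResidueField

/-- The normalized (multiplicatively written) valuation of `K` attached to `P`:
`P.val x = exp (-ord_P x)` for `x ≠ 0`. -/
def val (P : Place K) : Valuation K (WithZero (Multiplicative ℤ)) :=
  (IsDiscreteValuationRing.maximalIdeal P.1).valuation K

/-- The place `P` of `L` lies above the place `p` of `K`. -/
def LiesAbove [Algebra K L] (P : Place L) (p : Place K) : Prop :=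
  P.1.comap (algebraMap K L) = p.1

/-- The ramification index over `K` of a place `P` of `L`, that is the index of the value group of
the restriction of `P` to `K` in the value group `Lˣ / 𝒪_Pˣ` of `P`. -/
def ramIdx (K : Type*) {L : Type*} [Field K] [Field L] [Algebra K L] (P : Place L) : ℕ :=
  ((Units.map (algebraMap K L : K →* L)).range ⊔ P.1.unitGroup).index

end Place

/-- The ramification locus `Ram(M/K)` of a (possibly infinite) extension: the places of `K` that are
ramified in some finite subextension. -/
def Ram (K M : Type*) [Field K] [Field M] [Algebra K M] : Set (Place K) :=
  {p | ∃ L : IntermediateField K M, FiniteDimensional K L ∧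
    ∃ P : Place L, P.LiesAbove p ∧ 1 < P.ramIdx K}

/-- The wild ramification locus `Rams(M/K)`: the places of `K` that are wildly ramified in some
finite subextension. -/
def WildRam (K M : Type*) [Field K] [Field M] [Algebra K M] : Set (Place K) :=
  {p | ∃ L : IntermediateField K M, FiniteDimensional K L ∧
    ∃ P : Place L, P.LiesAbove p ∧ ringChar p.ResidueField ∣ P.ramIdx K}

/-! ### Global fields inside an infinite global field, towers

Here `k` is the ground field (`ℚ` or `𝔽_r(t)`) and `M` the infinite global field. -/

/-- The global fields contained in `M`: the finite extensions of `k` in `M`. -/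
def Sub (k M : Type*) [Field k] [Field M] [Algebra k M] : Type _ :=
  {K : IntermediateField k M // FiniteDimensional k K}

section Tower

variable {k M : Type*} [Field k] [Field M] [Algebra k M]

instance (K : Sub k M) : FiniteDimensional k K.1 := K.2

/-- The degree `n_K` over the ground field. -/
def Sub.degree (K : Sub k M) : ℕ := Module.finrank k K.1

/-- A tower of global fields with union `M`. -/
structure IsTower (K : ℕ → Sub k M) : Prop where
  lt_succ : ∀ i, (K i).1 < (K (i + 1)).1
  union : ∀ x : M, ∃ i, x ∈ (K i).1

/-- `K (i + 1)` as an extension of `K i`. -/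
def IsTower.step {K : ℕ → Sub k M} (hK : IsTower K) (i : ℕ) : IntermediateField (K i).1 M :=
  IntermediateField.extendScalars (hK.lt_succ i).le

/-- Every `K (i + 1) / K i` is Galois. -/
def IsTower.IsGaloisTower {K : ℕ → Sub k M} (hK : IsTower K) : Prop :=
  ∀ i, IsGalois (K i).1 (hK.step i)

/-- The series `∑_i (1 / n_{K_i}) ∑_{p ∈ Ram(K_{i+1}/K_i)} lg (N p)`, with value in `[0, ∞]`. -/
def IsTower.ramSeries {K : ℕ → Sub k M} (hK : IsTower K) (lg : ℝ → ℝ) : ℝ≥0∞ :=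
  ∑' i, ((K i).degree : ℝ≥0∞)⁻¹ *
    ∑' p : Ram (K i).1 (hK.step i), ENNReal.ofReal (lg (p.1.norm : ℝ))

variable (k M) in
/-- `inf_{K'} #Rams(M/K') = 0`, the infimum being taken over the global fields `K'` in `M`. -/
def EventuallyTame : Prop :=
  (⨅ K' : Sub k M, (WildRam K'.1 M).encard) = 0

/-- The limit of `a(K_i) / g(K_i)` along every tower with union `M` is `φ`. (Infinite global fields
are countable, hence do have such towers.) The quotients are taken in `[0, ∞]`, so that `a / 0 = ∞`
for `a ≠ 0`; this matters only if all the `K_i` are of genus `0`. -/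
def HasInvariant (a : Sub k M → ℕ) (g : Sub k M → ℝ) (φ : ℝ≥0∞) : Prop :=
  ∀ K : ℕ → Sub k M, IsTower K →
    Tendsto (fun i => (a (K i) : ℝ≥0∞) / ENNReal.ofReal (g (K i))) atTop (𝓝 φ)

end Tower

/-! ### Number fields -/

section NumberField

variable {M : Type*} [Field M] [CharZero M]

instance (K : Sub ℚ M) : NumberField K.1 where
  to_charZero := inferInstance
  to_finiteDimensional := K.2

/-- The genus `½ log |D_K|` of a number field. -/
def nfGenus (K : Sub ℚ M) : ℝ := Real.log |(NumberField.discr K.1 : ℝ)| / 2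

/-- The parameters `ℝ`, `ℂ` and prime powers `q`. -/
inductive Param : Type
  | real : Param
  | complex : Param
  | primePow (q : ℕ) (hq : IsPrimePow q) : Param

/-- `Φ_q(K)`, `Φ_ℝ(K)`, `Φ_ℂ(K)`: the numbers of places of norm `q`, of real and of complex
places. -/
def nfPhi : Param → Sub ℚ M → ℕ
  | .real, K => NumberField.InfinitePlace.nrRealPlaces K.1
  | .complex, K => NumberField.InfinitePlace.nrComplexPlaces K.1
  | .primePow q _, K => Nat.card {P : Place K.1 // P.norm = q}

variable (M) in
/-- Some invariant `φ_q(M)` is positive. -/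
def AsymptoticallyGood : Prop :=
  ∃ (q : Param) (φ : ℝ≥0∞), HasInvariant (nfPhi (M := M) q) nfGenus φ ∧ 0 < φ

end NumberField

/-! ### Function fields over a finite field -/

section FunctionField

variable {F K : Type*} [Field F] [Finite F] [Field K] [Algebra F K]

theorem Place.algebraMap_mem (P : Place K) (c : F) : algebraMap F K c ∈ P.1 := by
  have h : IsIntegral P.1 (algebraMap F K c) := by
    have : Fintype F := Fintype.ofFinite F
    refine ⟨Polynomial.X ^ Fintype.card F - Polynomial.X,
      Polynomial.monic_X_pow_sub (by simpa using Fintype.one_lt_card), ?_⟩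
    simp [← map_pow, FiniteField.pow_card]
  obtain ⟨y, hy⟩ := IsIntegrallyClosed.isIntegral_iff.1 h
  rw [← hy]
  exact y.2

/-- The constant field is contained in the valuation ring of every place. -/
abbrev Place.constAlgebra (F : Type*) {K : Type*} [Field F] [Finite F] [Field K] [Algebra F K]
    (P : Place K) : Algebra F P.1 :=
  ((algebraMap F K).codRestrict P.1.toSubring P.algebraMap_mem).toAlgebra

/-- The degree of a place: the degree of its residue field over the constant field `F`. -/
def Place.deg (F : Type*) {K : Type*} [Field F] [Finite F] [Field K] [Algebra F K]
    (P : Place K) : ℕ :=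
  letI := P.constAlgebra F
  Module.finrank F P.ResidueField

/-- The degree of a divisor. -/
def divDeg (F : Type*) {K : Type*} [Field F] [Finite F] [Field K] [Algebra F K]
    (D : Place K →₀ ℤ) : ℤ :=
  D.sum fun P m => m * (P.deg F : ℤ)

/-- The Riemann-Roch space `L(D) = {x | x = 0 or ord_P x ≥ - D P for all P}`. -/
def rrSpace (F : Type*) {K : Type*} [Field F] [Finite F] [Field K] [Algebra F K]
    (D : Place K →₀ ℤ) : Submodule F K where
  carrier := {x | ∀ P : Place K, P.val x ≤ WithZero.exp (D P)}
  zero_mem' P := by simp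
  add_mem' hx hy P := (P.val.map_add _ _).trans (max_le (hx P) (hy P))
  smul_mem' c x hx P := by
    have h : P.val (algebraMap F K c) ≤ 1 :=
      (IsDiscreteValuationRing.maximalIdeal P.1).valuation_le_one (K := K)
        ⟨algebraMap F K c, P.algebraMap_mem c⟩
    rw [Algebra.smul_def, map_mul]
    exact (mul_le_mul' h (hx P)).trans (one_mul _).le

/-- The genus of a function field `K` with field of constants `F`: the maximum of
`deg D - dim L(D) + 1` over all divisors `D`. -/
def ffGenus (F K : Type*) [Field F] [Finite F] [Field K] [Algebra F K] : ℤ :=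
  ⨆ D : Place K →₀ ℤ, (divDeg F D - (Module.finrank F (rrSpace F D) : ℤ) + 1)

/-- The invariant `φ_∞(M) = lim n_{K_i} / g_{K_i}` (in `[0, ∞]`) is positive. -/
def PhiInftyPos (F M : Type*) [Field F] [Finite F] [Field M] [Algebra (RatFunc F) M]
    [Algebra F M] [IsScalarTower F (RatFunc F) M] : Prop :=
  ∃ φ : ℝ≥0∞, HasInvariant (k := RatFunc F) (M := M) Sub.degree
    (fun K => (ffGenus F K.1 : ℝ)) φ ∧ 0 < φ

end FunctionField

end InfGlobal

end

noncomputable section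

set_option linter.unusedSectionVars false

namespace InfGlobal

open IsDedekindDomain

/-! ### Valuations with values in `ℤᵐ⁰` -/

/-! For a global field `K` in `M` let `H K` be the degree of the different of `K / k`. It equals
`log |D_K| = 2 g_K` for number fields and `2 g_K - 2 + 2 n_K` for function fields. Differents
multiply in towers, so `H L = [L : K] * H K + d` with `d ≥ 0` the degree of the different of `L /
K`. Hence `H K / n_K` increases with `K`.

Both notions of goodness mean that `H K / n_K` is bounded (`asymptoticallyGood_iff`,
`phiInftyPos_iff`). The counted quantities are at most `n_K`, so a positive limit bounds `g_K / n_K`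
along a tower, and by monotonicity everywhere. Conversely, if `H K / n_K` is bounded, then `g_K /
n_K` has the same limit along every tower. It remains to find a numerator whose quotient by `n_K`
has a positive limit. For function fields this is `n_K` itself. For number fields `r₁ / n_K`
decreases and `r₁ + 2 r₂ = n_K`, so the real or the complex places will do.

The quantity `d` is governed by ramification. At a place of ramification index `e` the different has
exponent at least `e - 1`, with equality if `e` is prime to the residue characteristic. Together
with `∑ e f = [L : K]`, this gives `d ≤ [L : K] * ∑ log N p` over the ramified `p` if `L / K` is
tame. If `L / K` is Galois, all places above a ramified `p` have `e ≥ 2`, so `e - 1 ≥ e / 2` and `d`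
is at least half of that bound. These facts are collected in `IsDiffDegree`, from which the three
claims follow: `IsDiffDegree.bounded_of_ram_finite`, `IsDiffDegree.ram_finite_of_isGalois` and
`IsDiffDegree.bounded_iff_of_isGaloisTower`.

Places are handled through integral closures of Dedekind domains: of `ℤ` over `ℚ`, and of both
`F[X]` and the local ring at infinity over `F(X)`. In the function field case the genus is a
supremum over divisors, and its relation to the different (`two_mul_ffGenus`) is proved by means of
a basis of `K / F(X)` adapted to both rings (`exists_reduced_basis`). Such a basis and its trace
dual make the relevant Riemann-Roch spaces explicit. -/

open scoped WithZero in
/-- Two equivalent valuations, the second of which is normalized, differ by a positive exponent. -/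
theorem exists_eq_pow_of_isEquiv {K : Type*} [Field K] {v w : Valuation K ℤᵐ⁰}
    (hw : Function.Surjective w) (h : v.IsEquiv w) : ∃ e : ℕ, 0 < e ∧ ∀ x, v x = w x ^ e := by
  obtain ⟨π, hπ⟩ := hw (WithZero.exp (-1))
  have hπ0 : π ≠ 0 := by
    rintro rfl
    exact WithZero.exp_ne_zero (hπ.symm.trans (map_zero w))
  have hvπ : v π < 1 := by
    rw [h.lt_one_iff_lt_one, hπ]
    exact WithZero.exp_lt_exp.2 (by norm_num)
  have hv0 : v π ≠ 0 := by simpa using hπ0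
  obtain ⟨m, hm⟩ : ∃ m : ℤ, v π = WithZero.exp m := ⟨_, (WithZero.exp_log hv0).symm⟩
  have hm0 : m < 0 := by
    rw [hm, ← WithZero.exp_zero, WithZero.exp_lt_exp] at hvπ
    exact hvπ
  -- `π` is a uniformizer for `w`, so the exponent must be the order of `π` under `v`.
  refine ⟨(-m).toNat, by omega, fun x => ?_⟩
  by_cases hx : x = 0
  · subst hx
    have : (-m).toNat ≠ 0 := by omega
    simp [this]
  have hwx : w x ≠ 0 := by simpa using hx
  obtain ⟨n, hn⟩ : ∃ n : ℤ, w x = WithZero.exp n := ⟨_, (WithZero.exp_log hwx).symm⟩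
  have h1 : w (x * π ^ n) = 1 := by
    rw [map_mul, map_zpow₀, hn, hπ, ← WithZero.exp_zsmul, ← WithZero.exp_add]
    simp
  rw [← h.eq_one_iff_eq_one, map_mul, map_zpow₀, hm, ← WithZero.exp_zsmul] at h1
  rw [eq_inv_of_mul_eq_one_left h1, hn, ← WithZero.exp_neg, ← WithZero.exp_nsmul]
  congr 1
  simp only [smul_eq_mul, nsmul_eq_mul]
  rw [Int.toNat_of_nonneg (by omega)]
  ring

/-! ### Places, normalized valuations and ramification indices -/

namespace Place

variable {K L N : Type*} [Field K] [Field L] [Field N] [Algebra K L] [Algebra L N] [Algebra K N]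

theorem val_le_one_iff (P : Place K) {x : K} : P.val x ≤ 1 ↔ x ∈ P.1 := by
  constructor
  · intro h
    obtain ⟨a, rfl⟩ := IsDiscreteValuationRing.exists_lift_of_le_one (A := P.1) h
    exact a.2
  · intro h
    exact (IsDiscreteValuationRing.maximalIdeal P.1).valuation_le_one (K := K) ⟨x, h⟩

theorem val_surjective (P : Place K) : Function.Surjective P.val :=
  HeightOneSpectrum.valuation_surjective K _

theorem val_valuationSubring (P : Place K) : P.val.valuationSubring = P.1 := by
  ext x
  rw [Valuation.mem_valuationSubring_iff, val_le_one_iff]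

/-- Equivalence gives `v = P.val ^ e`, and surjectivity of `v` forces `e = 1`. This is how `val` is
identified with valuations constructed by other means. -/
theorem eq_val_of_surjective (P : Place K) {v : Valuation K (WithZero (Multiplicative ℤ))}
    (hv : Function.Surjective v) (h : v.valuationSubring = P.1) : v = P.val := by
  have he : v.IsEquiv P.val := by
    rw [Valuation.isEquiv_iff_valuationSubring, h, val_valuationSubring]
  obtain ⟨e, he0, he⟩ := exists_eq_pow_of_isEquiv P.val_surjective he
  obtain ⟨x, hx⟩ := hv (WithZero.exp 1)
  have hx0 : P.val x ≠ 0 := by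
    intro h0
    rw [he, h0, zero_pow he0.ne'] at hx
    exact WithZero.exp_ne_zero hx.symm
  have := he x
  rw [hx, ← WithZero.exp_log hx0, ← WithZero.exp_nsmul, WithZero.exp_inj] at this
  have he1 : e = 1 := by
    have : (e : ℤ) ∣ 1 := ⟨_, by simpa using this⟩
    exact_mod_cast Int.eq_one_of_dvd_one (by positivity) this
  ext y
  simp [he y, he1]

theorem mem_unitGroup_iff_val (P : Place K) {x : Kˣ} : x ∈ P.1.unitGroup ↔ P.val x = 1 := by
  rw [ValuationSubring.mem_unitGroup_iff]
  have : P.1.valuation.IsEquiv P.val := by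
    rw [Valuation.isEquiv_iff_valuationSubring, val_valuationSubring,
      ValuationSubring.valuationSubring_valuation]
  exact this.eq_one_iff_eq_one

theorem ne_top (P : Place K) : P.1 ≠ ⊤ := by
  intro h
  obtain ⟨x, hx⟩ := P.val_surjective (WithZero.exp 1)
  have hx1 : P.val x ≤ 1 := P.val_le_one_iff.2 (h ▸ ValuationSubring.mem_top x)
  rw [hx, ← WithZero.exp_zero, WithZero.exp_le_exp] at hx1
  omega

theorem LiesAbove.exists_pow {P : Place L} {p : Place K} (h : P.LiesAbove p) :
    ∃ e : ℕ, 0 < e ∧ ∀ x, P.val (algebraMap K L x) = p.val x ^ e := by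
  have : (P.val.comap (algebraMap K L)).IsEquiv p.val := by
    rw [Valuation.isEquiv_iff_valuationSubring, val_valuationSubring, ← h]
    ext x
    rw [Valuation.mem_valuationSubring_iff, ValuationSubring.mem_comap, Valuation.comap_apply,
      val_le_one_iff]
  exact exists_eq_pow_of_isEquiv p.val_surjective this

/-- The order map `φ : Lˣ → ℤ` is onto with kernel the unit group of `P`, and it sends `Kˣ` onto `e
ℤ` because `p.val` is onto. The index in the definition is therefore that of `e ℤ` in `ℤ`. -/
theorem ramIdx_eq_of_val {P : Place L} {p : Place K} {e : ℕ}
    (h : ∀ x, P.val (algebraMap K L x) = p.val x ^ e) : P.ramIdx K = e := by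
  let φ : Lˣ →* Multiplicative ℤ :=
    (WithZero.unitsWithZeroEquiv (α := Multiplicative ℤ)).toMonoidHom.comp
      (Units.map (P.val : L →* WithZero (Multiplicative ℤ)))
  have hφ (x : Lˣ) : ((φ x : Multiplicative ℤ) : WithZero (Multiplicative ℤ)) = P.val x := by
    simp [φ]
  have hsurj : Function.Surjective φ := by
    intro m
    obtain ⟨x, hx⟩ := P.val_surjective (m : WithZero (Multiplicative ℤ))
    have hx0 : x ≠ 0 := by
      rintro rfl
      simp at hx
    refine ⟨Units.mk0 x hx0, ?_⟩
    apply WithZero.coe_injective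
    rw [hφ]
    exact hx
  have hker : φ.ker = P.1.unitGroup := by
    ext x
    rw [mem_unitGroup_iff_val, ← hφ, MonoidHom.mem_ker, ← WithZero.coe_one, WithZero.coe_inj]
  have hmap : ((Units.map (algebraMap K L : K →* L)).range).map φ
      = Subgroup.zpowers (Multiplicative.ofAdd (e : ℤ)) := by
    ext m
    simp only [Subgroup.mem_map, MonoidHom.mem_range, exists_exists_eq_and, Subgroup.mem_zpowers_iff]
    constructor
    · rintro ⟨x, rfl⟩
      refine ⟨WithZero.log (p.val x), ?_⟩
      apply WithZero.coe_injective
      rw [hφ]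
      have hx0 : p.val x ≠ 0 := by simp
      change _ = P.val (algebraMap K L x)
      rw [h]
      conv_rhs => rw [← WithZero.exp_log hx0, ← WithZero.exp_nsmul]
      rw [← ofAdd_zsmul]
      simp [WithZero.exp, mul_comm]
    · rintro ⟨n, rfl⟩
      obtain ⟨x, hx⟩ := p.val_surjective (WithZero.exp n)
      have hx0 : x ≠ 0 := by
        rintro rfl
        exact WithZero.exp_ne_zero (hx.symm.trans (map_zero _))
      refine ⟨Units.mk0 x hx0, ?_⟩
      apply WithZero.coe_injective
      rw [hφ]
      change P.val (algebraMap K L x) = _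
      rw [h, hx, ← WithZero.exp_nsmul, ← ofAdd_zsmul]
      simp [WithZero.exp, mul_comm]
  have hi := Subgroup.index_map (Units.map (algebraMap K L : K →* L)).range φ
  rw [hker, hmap, MonoidHom.range_eq_top.2 hsurj, Subgroup.index_top, mul_one] at hi
  rw [ramIdx, ← hi]
  have := Int.index_zmultiples (e : ℤ)
  rw [Int.natAbs_natCast] at this
  exact this

/-- The ramification index is the exponent that relates the two normalized valuations. -/
theorem LiesAbove.val_algebraMap {P : Place L} {p : Place K} (h : P.LiesAbove p) (x : K) :
    P.val (algebraMap K L x) = p.val x ^ P.ramIdx K := by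
  obtain ⟨e, -, he⟩ := h.exists_pow
  rw [ramIdx_eq_of_val he, he]

theorem LiesAbove.ramIdx_pos {P : Place L} {p : Place K} (h : P.LiesAbove p) :
    0 < P.ramIdx K := by
  obtain ⟨e, h0, he⟩ := h.exists_pow
  rwa [ramIdx_eq_of_val he]

theorem LiesAbove.eq {P : Place L} {p q : Place K} (h : P.LiesAbove p) (h' : P.LiesAbove q) :
    p = q := Subtype.ext (h.symm.trans h')

theorem LiesAbove.mem_iff {P : Place L} {p : Place K} (h : P.LiesAbove p) {x : K} :
    algebraMap K L x ∈ P.1 ↔ x ∈ p.1 := by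
  rw [← h, ValuationSubring.mem_comap]

theorem LiesAbove.trans [IsScalarTower K L N] {Q : Place N} {P : Place L} {p : Place K}
    (h : Q.LiesAbove P) (h' : P.LiesAbove p) : Q.LiesAbove p := by
  rw [LiesAbove, ← h', ← h, ValuationSubring.comap_comap, ← IsScalarTower.algebraMap_eq]

theorem LiesAbove.of_trans [IsScalarTower K L N] {Q : Place N} {P : Place L} {p : Place K}
    (h : Q.LiesAbove P) (h' : Q.LiesAbove p) : P.LiesAbove p := by
  rw [LiesAbove, ← h', ← h, ValuationSubring.comap_comap, ← IsScalarTower.algebraMap_eq]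

theorem LiesAbove.ramIdx_mul [IsScalarTower K L N] {Q : Place N} {P : Place L} {p : Place K}
    (h : Q.LiesAbove P) (h' : P.LiesAbove p) :
    Q.ramIdx K = P.ramIdx K * Q.ramIdx L := by
  apply ramIdx_eq_of_val (p := p)
  intro x
  rw [IsScalarTower.algebraMap_apply K L N, h.val_algebraMap, h'.val_algebraMap, pow_mul]

end Place

/-! ### Places as maximal ideals of Dedekind domains -/

namespace Place

/-- A valuation with values in `ℤᵐ⁰` that is not trivial gives a place. -/
theorem isDiscreteValuationRing_of_ne_top {K : Type*} [Field K]
    (v : Valuation K (WithZero (Multiplicative ℤ))) (h : v.valuationSubring ≠ ⊤) :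
    IsDiscreteValuationRing v.valuationSubring := by
  have : v.IsNontrivial := by
    rw [ne_eq, Valuation.valuationSubring_eq_top_iff, not_not] at h
    exact h
  have : IsCyclic (WithZero (Multiplicative ℤ))ˣ :=
    isCyclic_of_surjective (WithZero.unitsWithZeroEquiv (α := Multiplicative ℤ)).symm
      (MulEquiv.surjective _)
  infer_instance

section HeightOne

variable {B : Type*} [CommRing B] [IsDedekindDomain B] (K : Type*) [Field K] [Algebra B K]
  [IsFractionRing B K]

theorem valuationSubring_heightOne_ne_top (v : HeightOneSpectrum B) :
    (v.valuation K).valuationSubring ≠ ⊤ := by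
  intro h
  obtain ⟨x, hx⟩ := v.valuation_surjective K (WithZero.exp 1)
  have hx1 : x ∈ (v.valuation K).valuationSubring := h ▸ ValuationSubring.mem_top x
  rw [Valuation.mem_valuationSubring_iff, hx, ← WithZero.exp_zero, WithZero.exp_le_exp] at hx1
  omega

/-- The place attached to a maximal ideal of a Dedekind domain. -/
def ofHeightOne (v : HeightOneSpectrum B) : Place K :=
  ⟨(v.valuation K).valuationSubring,
    isDiscreteValuationRing_of_ne_top _ (valuationSubring_heightOne_ne_top K v)⟩

theorem val_ofHeightOne (v : HeightOneSpectrum B) : (ofHeightOne K v).val = v.valuation K :=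
  ((ofHeightOne K v).eq_val_of_surjective (v.valuation_surjective K) rfl).symm

theorem algebraMap_mem_ofHeightOne (v : HeightOneSpectrum B) (b : B) :
    algebraMap B K b ∈ (ofHeightOne K v).1 := by
  rw [← val_le_one_iff, val_ofHeightOne]
  exact v.valuation_le_one b

theorem ofHeightOne_injective :
    Function.Injective (ofHeightOne K : HeightOneSpectrum B → Place K) := by
  intro v w h
  have h' : v.valuation K = w.valuation K := by rw [← val_ofHeightOne, h, val_ofHeightOne]
  ext b
  rw [← v.valuation_lt_one_iff_mem (K := K), h', w.valuation_lt_one_iff_mem]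

/-- Every place whose valuation ring contains the Dedekind domain `B` comes from a maximal ideal
of `B`. -/
theorem exists_ofHeightOne_eq {P : Place K} (h : ∀ b : B, algebraMap B K b ∈ P.1) :
    ∃ v : HeightOneSpectrum B, ofHeightOne K v = P := by
  let f : B →+* P.1 := (algebraMap B K).codRestrict P.1.toSubring h
  let I : Ideal B := (IsLocalRing.maximalIdeal P.1).comap f
  have hI (b : B) (hb : b ∉ I) : ∃ c : K, c ∈ P.1 ∧ algebraMap B K b * c = 1 := by
    have hu : IsUnit (f b) := by
      by_contra hu
      exact hb ((IsLocalRing.mem_maximalIdeal _).2 hu)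
    obtain ⟨c, hc⟩ := hu.exists_right_inv
    exact ⟨c, c.2, congrArg Subtype.val hc⟩
  -- If the center on `B` were zero, every nonzero element of `B` would be a unit at `P`, and the
  -- valuation ring would be the whole field.
  have hI0 : I ≠ ⊥ := by
    intro h0
    apply P.ne_top
    rw [eq_top_iff]
    intro x _
    obtain ⟨a, b, hb, rfl⟩ := IsFractionRing.div_surjective (A := B) x
    have hb0 : b ∉ I := by
      rw [h0, Ideal.mem_bot]
      exact nonZeroDivisors.ne_zero hb
    obtain ⟨c, hc, hbc⟩ := hI b hb0
    rw [div_eq_mul_inv, ← eq_inv_of_mul_eq_one_right hbc]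
    exact mul_mem (h a) hc
  let v : HeightOneSpectrum B := ⟨I, Ideal.IsPrime.comap f, hI0⟩
  refine ⟨v, Subtype.ext ?_⟩
  have : IsDiscreteValuationRing (ofHeightOne K v).1 := (ofHeightOne K v).2
  -- The only valuation ring strictly containing a discrete one is the field, so one inclusion
  -- suffices.
  refine ValuationSubring.eq_of_le_of_ne_top _ ?_ P.ne_top
  intro x hx
  obtain ⟨n, d, hnd⟩ := v.exists_primeCompl_mul_eq_of_integer x hx
  obtain ⟨c, hc, hbc⟩ := hI d d.2
  have : x = algebraMap B K n * c := by
    rw [← hnd, mul_assoc, hbc, mul_one]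
  rw [this]
  exact mul_mem (h n) hc

/-- The residue field of a maximal ideal is the residue field of its place. -/
theorem nonempty_residueField_ringEquiv (v : HeightOneSpectrum B) :
    Nonempty ((B ⧸ v.asIdeal) ≃+* (ofHeightOne K v).ResidueField) := by
  let P := ofHeightOne K v
  let f : B →+* P.1 :=
    (algebraMap B K).codRestrict P.1.toSubring (algebraMap_mem_ofHeightOne K v)
  let g : B →+* P.ResidueField := (IsLocalRing.residue P.1).comp f
  have hmax (y : P.1) : y ∈ IsLocalRing.maximalIdeal P.1 ↔ v.valuation K y < 1 := by
    rw [IsLocalRing.mem_maximalIdeal, mem_nonunits_iff, ← not_le, not_iff_not]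
    constructor
    · rintro hy
      obtain ⟨c, hc⟩ := hy.exists_right_inv
      have hc' : (y : K) * c = 1 := congrArg Subtype.val hc
      have h1 : v.valuation K (y : K) * v.valuation K (c : K) = 1 := by
        rw [← map_mul, hc', map_one]
      have h2 : v.valuation K (c : K) ≤ 1 := c.2
      by_contra hlt
      rw [not_le] at hlt
      exact absurd h1 (ne_of_lt ((mul_le_mul_right h2 _).trans_lt (by rwa [mul_one])))
    · intro hy
      have hy0 : (y : K) ≠ 0 := by
        intro h0
        rw [h0, map_zero] at hy
        exact absurd hy (by simp)
      have hinv : (y : K)⁻¹ ∈ P.1 := by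
        change v.valuation K (y : K)⁻¹ ≤ 1
        rw [map_inv₀]
        exact inv_le_one_of_one_le₀ hy
      exact IsUnit.of_mul_eq_one ⟨_, hinv⟩ (Subtype.ext (mul_inv_cancel₀ hy0))
  have hker : RingHom.ker g = v.asIdeal := by
    ext b
    rw [RingHom.mem_ker, RingHom.comp_apply, IsLocalRing.residue_eq_zero_iff, hmax]
    exact v.valuation_lt_one_iff_mem b
  have hsurj : Function.Surjective g := by
    intro y
    obtain ⟨y, rfl⟩ := IsLocalRing.residue_surjective y
    obtain ⟨b, hb⟩ := v.exists_valuation_sub_lt_of_integer (K := K) (x := y) y.2 1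
    refine ⟨b, ?_⟩
    rw [RingHom.comp_apply, ← sub_eq_zero, ← map_sub, IsLocalRing.residue_eq_zero_iff, hmax]
    exact hb
  exact ⟨(Ideal.quotEquivOfEq hker.symm).trans (RingHom.quotientKerEquivOfSurjective hsurj)⟩

theorem norm_ofHeightOne (v : HeightOneSpectrum B) :
    (ofHeightOne K v).norm = Nat.card (B ⧸ v.asIdeal) :=
  (Nat.card_congr (nonempty_residueField_ringEquiv K v).some.toEquiv).symm

end HeightOne

theorem exists_liesOver_heightOne {B C : Type*} [CommRing B] [CommRing C] [Algebra B C] [IsDomain B]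
    [IsDomain C] [Algebra.IsIntegral B C] [FaithfulSMul B C]
    (v : HeightOneSpectrum B) : ∃ w : HeightOneSpectrum C, w.asIdeal.LiesOver v.asIdeal := by
  obtain ⟨⟨Q, hQ, hQv⟩⟩ := v.asIdeal.nonempty_primesOver (S := C)
  exact ⟨⟨Q, hQ, Ideal.ne_bot_of_liesOver_of_ne_bot v.ne_bot Q⟩, hQv⟩

section Extension

variable {B C : Type*} [CommRing B] [IsDedekindDomain B] [CommRing C] [IsDedekindDomain C]
  [Algebra B C] (K L : Type*) [Field K] [Field L] [Algebra B K] [IsFractionRing B K]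
  [Algebra C L] [IsFractionRing C L] [Algebra K L] [Algebra B L] [IsScalarTower B K L]
  [IsScalarTower B C L]

/-- If `w` lies over `v`, an element integral at `v` is `n / d` with `d ∉ v`, and `d` is a unit at
`w`. So the ring of `v` is contained in the restriction of the ring of `w`, which is not all of `K`
as it omits inverses of nonzero elements of `v`. Discreteness then gives equality. -/
theorem ofHeightOne_liesAbove_iff {w : HeightOneSpectrum C} {v : HeightOneSpectrum B} :
    (ofHeightOne L w).LiesAbove (ofHeightOne K v) ↔ w.asIdeal.LiesOver v.asIdeal := by
  have hmap (b : B) : algebraMap K L (algebraMap B K b) = algebraMap C L (algebraMap B C b) := by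
    rw [← IsScalarTower.algebraMap_apply, ← IsScalarTower.algebraMap_apply]
  constructor
  · intro h
    obtain ⟨e, he0, he⟩ := h.exists_pow
    constructor
    ext b
    rw [Ideal.under_def, Ideal.mem_comap, ← w.valuation_lt_one_iff_mem (K := L)]
    change _ ↔ w.valuation L (algebraMap C L (algebraMap B C b)) < 1
    rw [← hmap, ← val_ofHeightOne, he, ← v.valuation_lt_one_iff_mem (K := K), val_ofHeightOne,
      pow_lt_one_iff he0.ne']
  · intro h
    have hle : (ofHeightOne K v).1 ≤ (ofHeightOne L w).1.comap (algebraMap K L) := by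
      intro x hx
      obtain ⟨n, d, hnd⟩ := v.exists_primeCompl_mul_eq_of_integer x hx
      rw [ValuationSubring.mem_comap, ← val_le_one_iff, val_ofHeightOne]
      have hd : w.valuation L (algebraMap C L (algebraMap B C d)) = 1 := by
        rw [w.valuation_eq_one_iff_notMem]
        intro hd
        exact d.2 ((Ideal.mem_of_liesOver w.asIdeal v.asIdeal _).2 hd)
      have h1 := congrArg (fun y => w.valuation L (algebraMap K L y)) hnd
      simp only [map_mul, hmap, hd, mul_one] at h1
      rw [h1]
      exact w.valuation_le_one _
    have : IsDiscreteValuationRing (ofHeightOne K v).1 := (ofHeightOne K v).2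
    refine (ValuationSubring.eq_of_le_of_ne_top _ hle ?_).symm
    intro htop
    obtain ⟨b, hb, hb0⟩ := Submodule.exists_mem_ne_zero_of_ne_bot v.ne_bot
    have hb' : algebraMap B C b ∈ w.asIdeal := by
      rw [h.over] at hb
      exact hb
    have hK0 : algebraMap B K b ≠ 0 := by
      simpa using (IsFractionRing.injective B K).ne hb0
    have h2 : (algebraMap B K b)⁻¹ ∈ (ofHeightOne L w).1.comap (algebraMap K L) :=
      htop ▸ ValuationSubring.mem_top _
    rw [ValuationSubring.mem_comap, ← val_le_one_iff, val_ofHeightOne, map_inv₀, hmap,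
      map_inv₀] at h2
    rw [← w.valuation_lt_one_iff_mem (K := L)] at hb'
    have hne : w.valuation L (algebraMap C L (algebraMap B C b)) ≠ 0 := by
      rw [← hmap]
      simpa using hK0
    exact absurd h2 (not_le.2 ((one_lt_inv₀ (zero_lt_iff.2 hne)).2 hb'))

theorem ramIdx_ofHeightOne [Module.IsTorsionFree B C] (w : HeightOneSpectrum C)
    (v : HeightOneSpectrum B) [w.asIdeal.LiesOver v.asIdeal] :
    (ofHeightOne L w).ramIdx K = v.asIdeal.ramificationIdx' w.asIdeal := by
  apply ramIdx_eq_of_val (p := ofHeightOne K v)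
  intro x
  rw [val_ofHeightOne, val_ofHeightOne, v.valuation_liesOver L w]

/-- The ring of `P` contains `B` and is integrally closed, hence contains `C`, and `P` is centered
at a maximal ideal of `C`. -/
theorem exists_ofHeightOne_eq_of_liesAbove [Algebra.IsIntegral B C] {P : Place L}
    {v : HeightOneSpectrum B} (hP : P.LiesAbove (ofHeightOne K v)) :
    ∃ w : HeightOneSpectrum C, ofHeightOne L w = P ∧ w.asIdeal.LiesOver v.asIdeal := by
  obtain ⟨w, hw⟩ := exists_ofHeightOne_eq (B := C) L (P := P) (by
    intro c
    obtain ⟨q, hq, hq0⟩ := Algebra.IsIntegral.isIntegral (R := B) c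
    let f : B →+* P.1 := (algebraMap B L).codRestrict P.1.toSubring (by
      intro a
      rw [IsScalarTower.algebraMap_apply B K L]
      exact hP.mem_iff.2 (algebraMap_mem_ofHeightOne K v a))
    have : IsIntegral P.1 (algebraMap C L c) := ⟨q.map f, hq.map f, by
      rw [Polynomial.eval₂_map]
      change Polynomial.eval₂ (algebraMap B L) (algebraMap C L c) q = 0
      rw [IsScalarTower.algebraMap_eq B C L, ← Polynomial.hom_eval₂, hq0, map_zero]⟩
    obtain ⟨y, hy⟩ := IsIntegrallyClosed.isIntegral_iff.1 this
    rw [← hy]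
    exact y.2)
  refine ⟨w, hw, ?_⟩
  rw [← ofHeightOne_liesAbove_iff K L, hw]
  exact hP

set_option linter.deprecated false in
theorem encard_liesOver_heightOne_le [Module.Finite B C] [Module.IsTorsionFree B C]
    (v : HeightOneSpectrum B) :
    {w : HeightOneSpectrum C | w.asIdeal.LiesOver v.asIdeal}.encard ≤ Module.finrank K L := by
  classical
  have hvp : v.asIdeal.IsMaximal := v.isMaximal
  have : NoZeroSMulDivisors B C := ⟨fun h => smul_eq_zero.1 h⟩
  calc {w : HeightOneSpectrum C | w.asIdeal.LiesOver v.asIdeal}.encard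
      ≤ ((IsDedekindDomain.primesOverFinset v.asIdeal C : Finset (Ideal C)) :
          Set (Ideal C)).encard := by
        refine Set.encard_le_encard_of_injOn (f := fun w => w.asIdeal) ?_ ?_
        · intro w hw
          exact (IsDedekindDomain.mem_primesOverFinset_iff v.ne_bot _).2 ⟨w.isPrime, hw⟩
        · intro P hP Q hQ h
          exact HeightOneSpectrum.ext h
    _ ≤ Module.finrank K L := by
        rw [Set.encard_coe_eq_coe_finsetCard]
        exact_mod_cast Ideal.card_primesOverFinset_le_finrank C K L v.ne_bot

end Extension

section Finite

variable {K L : Type*} [Field K] [Field L] [Algebra K L]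

/-- The restriction of a place to a subfield over which the field is algebraic is a place. -/
theorem exists_liesAbove_of_isAlgebraic [Algebra.IsAlgebraic K L] (P : Place L) :
    ∃ p : Place K, P.LiesAbove p := by
  -- If `P` were trivial on `K`, all of `L` would be integral over a subfield of the ring of `P`,
  -- hence contained in that ring.
  have htop : (P.val.comap (algebraMap K L)).valuationSubring ≠ ⊤ := by
    intro htop
    apply P.ne_top
    rw [eq_top_iff]
    intro x _
    have hx : IsIntegral K x := Algebra.IsIntegral.isIntegral x
    have hmem (a : K) : algebraMap K L a ∈ P.1 := by
      rw [← val_le_one_iff]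
      have : a ∈ (P.val.comap (algebraMap K L)).valuationSubring :=
        htop ▸ ValuationSubring.mem_top a
      exact this
    let f : K →+* P.1 := (algebraMap K L).codRestrict P.1.toSubring hmem
    obtain ⟨q, hq, hq0⟩ := hx
    have : IsIntegral P.1 x := ⟨q.map f, hq.map f, by
      rw [Polynomial.eval₂_map]
      exact hq0⟩
    obtain ⟨y, rfl⟩ := IsIntegrallyClosed.isIntegral_iff.1 this
    exact y.2
  refine ⟨⟨_, isDiscreteValuationRing_of_ne_top _ htop⟩, ?_⟩
  ext x
  rw [ValuationSubring.mem_comap, Valuation.mem_valuationSubring_iff, Valuation.comap_apply,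
    val_le_one_iff]

variable (L) in
/-- Places extend to finite separable extensions, in at most `[L : K]` ways. -/
theorem exists_liesAbove_and_encard_le [FiniteDimensional K L] [Algebra.IsSeparable K L]
    (p : Place K) : (∃ P : Place L, P.LiesAbove p) ∧
      {P : Place L | P.LiesAbove p}.encard ≤ Module.finrank K L := by
  -- The places above `p` are the maximal ideals of the integral closure in `L` of the local ring of
  -- `p`.
  let A := p.1
  let C := integralClosure A L
  have : IsDedekindDomain C := integralClosure.isDedekindDomain A K L
  have : IsFractionRing C L := integralClosure.isFractionRing_of_finite_extension K L
  let v : HeightOneSpectrum A := IsDiscreteValuationRing.maximalIdeal A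
  have hv : ofHeightOne K v = p := Subtype.ext p.val_valuationSubring
  have : Module.Finite A C := IsIntegralClosure.finite A K L C
  have : Module.IsTorsionFree A L := by
    have : Module.IsTorsionFree A K := inferInstance
    exact Module.IsTorsionFree.trans_faithfulSMul A K L
  have : Module.IsTorsionFree A C := inferInstance
  obtain ⟨w, hw⟩ := exists_liesOver_heightOne (C := C) v
  have : Nonempty (HeightOneSpectrum C) := ⟨w⟩
  refine ⟨⟨ofHeightOne L w, by
    rw [← hv]
    exact (ofHeightOne_liesAbove_iff K L).2 hw⟩, ?_⟩
  have hcard := encard_liesOver_heightOne_le K L (C := C) v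
  have hex (P : Place L) (hP : P.LiesAbove p) := exists_ofHeightOne_eq_of_liesAbove K L (C := C)
    (v := v) (P := P) (by rwa [hv])
  choose! g hg hg' using hex
  refine le_trans (Set.encard_le_encard_of_injOn (f := g) ?_ ?_) hcard
  · intro P hP
    exact hg' P hP
  · intro P hP Q hQ h
    rw [← hg P hP, ← hg Q hQ, h]

end Finite

end Place

/-! ### The different at tamely ramified primes -/

section Tame

/-- Let `R` be a finite local algebra over a finite field `κ` with residue field `κ'` and length
`e` not divisible by the characteristic. Then the trace of `R / κ` does not vanish. -/
theorem exists_trace_ne_zero {κ R κ' : Type*} [Field κ] [Finite κ] [CommRing R] [Field κ']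
    [Algebra κ R] [Algebra κ κ'] [Finite R] (g : R →ₐ[κ] κ') (hg : Function.Surjective g)
    (hn : IsNilpotent (RingHom.ker g)) {e : ℕ} (he : Nat.card R = Nat.card κ' ^ e)
    (he0 : (e : κ) ≠ 0) : ∃ x : R, Algebra.trace κ R x ≠ 0 := by
  have : Finite κ' := Finite.of_surjective g hg
  have : Algebra.IsSeparable κ κ' := inferInstance
  have : Algebra.FormallySmooth κ κ' := inferInstance
  -- Since `κ' / κ` is separable, the residue map splits. This makes `R` a vector space of dimension
  -- `e` over `κ'`, on which the trace of `R / κ` is `e` times the trace of `κ' / κ`.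
  let s : κ' →ₐ[κ] R := Algebra.FormallySmooth.liftOfSurjective (AlgHom.id κ κ') g hg hn
  let : Algebra κ' R := s.toRingHom.toAlgebra
  have : IsScalarTower κ κ' R := .of_algebraMap_eq fun x => (s.commutes x).symm
  have : Module.Finite κ' R := Module.Finite.of_finite
  have hfr : Module.finrank κ' R = e := by
    have h1 := Module.natCard_eq_pow_finrank (K := κ') (V := R)
    rw [he] at h1
    exact (Nat.pow_right_injective Finite.one_lt_card h1).symm
  obtain ⟨y, hy⟩ : ∃ y, Algebra.trace κ κ' y ≠ 0 := by
    simpa [LinearMap.ext_iff] using Algebra.trace_ne_zero κ κ'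
  refine ⟨algebraMap κ' R y, ?_⟩
  rw [← Algebra.trace_trace (S := κ'), Algebra.trace_algebraMap, hfr, map_nsmul, nsmul_eq_mul]
  exact mul_ne_zero he0 hy

variable {A B : Type*} [CommRing A] [IsDedekindDomain A] [CommRing B] [IsDedekindDomain B]
  [Algebra A B] [Module.Finite A B] [Module.IsTorsionFree A B]

attribute [local instance] FractionRing.liftAlgebra in
/-- At a tamely ramified prime the exponent of the different is at most `e - 1`. -/
theorem not_pow_dvd_differentIdeal_of_tame
    [Algebra.IsSeparable (FractionRing A) (FractionRing B)]
    {p : Ideal A} [p.IsMaximal] [Finite (A ⧸ p)] (hp : p ≠ ⊥) (P : Ideal B) [P.IsMaximal]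
    [P.LiesOver p] (he : (p.ramificationIdx' P : A ⧸ p) ≠ 0) :
    ¬ P ^ (p.ramificationIdx' P) ∣ differentIdeal A B := by
  classical
  set e := p.ramificationIdx' P with hedef
  have hp' : p.map (algebraMap A B) ≠ ⊥ := (Ideal.map_eq_bot_iff_of_injective
    (FaithfulSMul.algebraMap_injective A B)).not.mpr hp
  have hPbot : P ≠ ⊥ := Ideal.ne_bot_of_liesOver_of_ne_bot hp P
  obtain ⟨Q, h₁, h₂⟩ := Ideal.eq_prime_pow_mul_coprime hp' P
  rw [← Ideal.IsDedekindDomain.ramificationIdx'_eq_normalizedFactors_count hp' inferInstance hPbot,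
    ← hedef] at h₂
  have hPQ : IsCoprime (P ^ e) Q := (Ideal.isCoprime_iff_sup_eq.mpr h₁).pow_left
  have he' : e ≠ 0 := by
    rintro h
    simp [h] at he
  let : Field (A ⧸ p) := Ideal.Quotient.field p
  let : Field (B ⧸ P) := Ideal.Quotient.field P
  let : Algebra (A ⧸ p) (B ⧸ Q) := Ideal.Quotient.algebraQuotientOfLEComap (by
      rw [← Ideal.map_le_iff_le_comap, h₂]
      exact Ideal.mul_le_right (I := P ^ e) (J := Q))
  let : Algebra (A ⧸ p) (B ⧸ P ^ e) := Ideal.Quotient.algebraQuotientOfLEComap (by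
      rw [← Ideal.map_le_iff_le_comap, h₂]
      exact Ideal.mul_le_left (I := P ^ e) (J := Q))
  have : IsScalarTower A (A ⧸ p) (B ⧸ Q) := .of_algebraMap_eq' rfl
  have : Module.Finite (A ⧸ p) (B ⧸ Q) :=
    Module.Finite.of_restrictScalars_finite A (A ⧸ p) (B ⧸ Q)
  have : IsScalarTower A (A ⧸ p) (B ⧸ P ^ e) := .of_algebraMap_eq' rfl
  have : Module.Finite (A ⧸ p) (B ⧸ P ^ e) :=
    Module.Finite.of_restrictScalars_finite A (A ⧸ p) (B ⧸ P ^ e)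
  have : Finite (B ⧸ P ^ e) := Module.finite_of_finite (A ⧸ p)
  let f : (B ⧸ p.map (algebraMap A B)) ≃ₐ[A ⧸ p] ((B ⧸ P ^ e) × B ⧸ Q) :=
    { __ := (Ideal.quotEquivOfEq h₂).trans (Ideal.quotientMulEquivQuotientProd (P ^ e) Q hPQ),
      commutes' := Quotient.ind fun _ ↦ rfl }
  let g : (B ⧸ P ^ e) →ₐ[A ⧸ p] (B ⧸ P) :=
    { __ := Ideal.Quotient.factor (Ideal.pow_le_self he')
      commutes' := Quotient.ind fun _ ↦ rfl }
  obtain ⟨x, hx⟩ := exists_trace_ne_zero g (Ideal.Quotient.factor_surjective (Ideal.pow_le_self he')) ⟨e, by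
    have hk : RingHom.ker g ≤ P.map (Ideal.Quotient.mk (P ^ e)) := by
      intro z hz
      obtain ⟨b, rfl⟩ := Ideal.Quotient.mk_surjective z
      exact Ideal.mem_map_of_mem _ (Ideal.Quotient.eq_zero_iff_mem.1 hz)
    rw [Ideal.zero_eq_bot, ← le_bot_iff]
    refine (Ideal.pow_right_mono hk e).trans ?_
    rw [← Ideal.map_pow, Ideal.map_quotient_self]⟩ (e := e) (cardQuot_pow_of_prime hPbot) he
  -- Modulo `p` the ring `B` is `B ⧸ P ^ e × B ⧸ Q`. A lift of `(x, 0)` lies in `Q` and has trace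
  -- outside `p`, which is impossible if `P ^ e` divides the different.
  obtain ⟨y, hy⟩ := Ideal.Quotient.mk_surjective (f.symm (x, 0))
  refine not_dvd_differentIdeal_of_intTrace_not_mem A (P ^ e) Q h₂.symm y ?_ ?_
  · have := congrArg (fun z => (f z).2) hy
    simp at this
    simpa [f, Ideal.Quotient.eq_zero_iff_mem] using this
  · rw [← Ideal.Quotient.eq_zero_iff_mem, ← Algebra.trace_quotient_eq_of_isDedekindDomain,
      hy, Algebra.trace_eq_of_algEquiv, Algebra.trace_prod_apply]
    simpa

end Tame

/-! ### Logarithmic degrees of ideals -/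

/-- What is used of the logarithm to some base `> 1`. -/
structure IsLog (lg : ℝ → ℝ) : Prop where
  map_pow : ∀ (a : ℝ) (n : ℕ), lg (a ^ n) = n * lg a
  two_pos : 0 < lg 2
  two_le : ∀ a : ℝ, 2 ≤ a → lg 2 ≤ lg a

theorem isLog_log : IsLog Real.log where
  map_pow := Real.log_pow
  two_pos := Real.log_pos one_lt_two
  two_le _ h := Real.log_le_log two_pos h

theorem isLog_logb {b : ℝ} (hb : 1 < b) : IsLog (Real.logb b) where
  map_pow a n := Real.logb_pow b a n
  two_pos := Real.logb_pos hb one_lt_two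
  two_le _ h := Real.logb_le_logb_of_le hb two_pos h

section Ord

variable {B : Type*} [CommRing B] [IsDedekindDomain B]

theorem finite_support_multiplicity {I : Ideal B} (hI : I ≠ ⊥) :
    (Function.support fun v : HeightOneSpectrum B => multiplicity v.asIdeal I).Finite := by
  refine (Ideal.finite_factors hI).subset fun v hv => ?_
  by_contra h
  exact hv (multiplicity_eq_zero.2 h)

open Classical in
/-- The exponents in the prime factorization of a nonzero ideal. -/
def ord (I : Ideal B) : HeightOneSpectrum B →₀ ℕ :=
  if hI : I = ⊥ then 0 else Finsupp.ofSupportFinite _ (finite_support_multiplicity hI)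

theorem ord_apply {I : Ideal B} (hI : I ≠ ⊥) (v : HeightOneSpectrum B) :
    ord I v = multiplicity v.asIdeal I := by
  rw [ord, dif_neg hI]
  rfl

theorem le_ord_iff {I : Ideal B} (hI : I ≠ ⊥) {v : HeightOneSpectrum B} {n : ℕ} :
    n ≤ ord I v ↔ v.asIdeal ^ n ∣ I := by
  rw [ord_apply hI]
  exact (FiniteMultiplicity.of_prime_left v.prime hI).pow_dvd_iff_le_multiplicity.symm

theorem ord_mul {I J : Ideal B} (hI : I ≠ ⊥) (hJ : J ≠ ⊥) : ord (I * J) = ord I + ord J := by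
  have hIJ : I * J ≠ ⊥ := mul_ne_zero hI hJ
  ext v
  rw [Finsupp.add_apply, ord_apply hIJ, ord_apply hI, ord_apply hJ]
  exact multiplicity_mul v.prime (FiniteMultiplicity.of_prime_left v.prime hIJ)

theorem ord_top : ord (⊤ : Ideal B) = 0 := by
  ext v
  by_contra h
  have h1 : 1 ≤ ord (⊤ : Ideal B) v := Nat.one_le_iff_ne_zero.2 h
  have htop : (⊤ : Ideal B) ≠ ⊥ := top_ne_bot
  rw [le_ord_iff htop, pow_one, Ideal.dvd_iff_le, top_le_iff] at h1
  exact v.isPrime.ne_top h1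

/-- The logarithm of the norm of an ideal, computed from its prime factorization. -/
def ordDeg (lg : ℝ → ℝ) (I : Ideal B) : ℝ :=
  (ord I).sum fun v m => m * lg (Nat.card (B ⧸ v.asIdeal))

theorem ordDeg_mul (lg : ℝ → ℝ) {I J : Ideal B} (hI : I ≠ ⊥) (hJ : J ≠ ⊥) :
    ordDeg lg (I * J) = ordDeg lg I + ordDeg lg J := by
  rw [ordDeg, ord_mul hI hJ, Finsupp.sum_add_index']
  · rfl
  · intro v
    simp
  · intro v m n
    push_cast
    ring

theorem ordDeg_top (lg : ℝ → ℝ) : ordDeg lg (⊤ : Ideal B) = 0 := by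
  rw [ordDeg, ord_top, Finsupp.sum_zero_index]

theorem ordDeg_eq_sum (lg : ℝ → ℝ) (I : Ideal B) {T : Finset (HeightOneSpectrum B)}
    (hT : (ord I).support ⊆ T) :
    ordDeg lg I = ∑ v ∈ T, (ord I v : ℝ) * lg (Nat.card (B ⧸ v.asIdeal)) :=
  Finsupp.sum_of_support_subset _ hT _ fun v _ => by simp

theorem lg_card_pos {lg : ℝ → ℝ} (hlg : IsLog lg) [Ring.HasFiniteQuotients B]
    (v : HeightOneSpectrum B) : lg 2 ≤ lg (Nat.card (B ⧸ v.asIdeal)) := by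
  have : Finite (B ⧸ v.asIdeal) := Ring.HasFiniteQuotients.finiteQuotient v.ne_bot
  have : Nontrivial (B ⧸ v.asIdeal) := Ideal.Quotient.nontrivial_iff.2 v.isPrime.ne_top
  refine hlg.two_le _ ?_
  exact_mod_cast (Finite.one_lt_card : 1 < Nat.card (B ⧸ v.asIdeal))

theorem lg_card_nonneg {lg : ℝ → ℝ} (hlg : IsLog lg) [Ring.HasFiniteQuotients B]
    (v : HeightOneSpectrum B) : 0 ≤ lg (Nat.card (B ⧸ v.asIdeal)) :=
  hlg.two_pos.le.trans (lg_card_pos hlg v)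

theorem ordDeg_nonneg {lg : ℝ → ℝ} (hlg : IsLog lg) [Ring.HasFiniteQuotients B] (I : Ideal B) :
    0 ≤ ordDeg lg I :=
  Finset.sum_nonneg fun v _ => mul_nonneg (Nat.cast_nonneg _) (lg_card_nonneg hlg v)

end Ord

section Extension

variable {B C : Type*} [CommRing B] [IsDedekindDomain B] [CommRing C] [IsDedekindDomain C]
  [Algebra B C] [Module.Finite B C] [Module.IsTorsionFree B C]
  (K L : Type*) [Field K] [Field L] [Algebra B K] [IsFractionRing B K]
  [Algebra C L] [IsFractionRing C L] [Algebra K L] [Algebra B L] [IsScalarTower B K L]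
  [IsScalarTower B C L]

variable (B) in
/-- The maximal ideal of `B` below a maximal ideal of `C`. -/
def under (w : HeightOneSpectrum C) : HeightOneSpectrum B :=
  ⟨w.asIdeal.under B, inferInstance, fun h => w.ne_bot (Ideal.eq_bot_of_comap_eq_bot h)⟩

instance (w : HeightOneSpectrum C) : w.asIdeal.LiesOver (under B w).asIdeal :=
  Ideal.over_under w.asIdeal

theorem under_eq_iff {w : HeightOneSpectrum C} {v : HeightOneSpectrum B} :
    under B w = v ↔ w.asIdeal.LiesOver v.asIdeal := by
  constructor
  · rintro rfl
    infer_instance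
  · intro h
    exact HeightOneSpectrum.ext h.over.symm

variable (B) in
/-- The ramification index over `B` of a maximal ideal of `C`. -/
abbrev ramI (w : HeightOneSpectrum C) : ℕ := (under B w).asIdeal.ramificationIdx' w.asIdeal

theorem ord_map {I : Ideal B} (hI : I ≠ ⊥) (w : HeightOneSpectrum C) :
    ord (I.map (algebraMap B C)) w = ramI B w * ord I (under B w) := by
  have hI' : I.map (algebraMap B C) ≠ ⊥ := Ideal.map_ne_bot_of_ne_bot hI
  rw [ord_apply hI, ord_apply hI']
  refine multiplicity_eq_of_emultiplicity_eq_some ?_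
  rw [Ideal.IsDedekindDomain.emultiplicity_map_eq_ramificationIdx'_mul hI
    (under B w).irreducible w.irreducible w.ne_bot, Nat.cast_mul,
    (FiniteMultiplicity.of_prime_left (under B w).prime hI).emultiplicity_eq_multiplicity]

attribute [local instance] FractionRing.liftAlgebra in
theorem finite_fiber (v : HeightOneSpectrum B) :
    {w : HeightOneSpectrum C | under B w = v}.Finite := by
  have h := Place.encard_liesOver_heightOne_le (FractionRing B) (FractionRing C) (C := C) v
  simp_rw [under_eq_iff]
  exact Set.finite_of_encard_le_coe h

variable (C) in
/-- The maximal ideals of `C` over a maximal ideal of `B`. -/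
def fiber (v : HeightOneSpectrum B) : Finset (HeightOneSpectrum C) := (finite_fiber v).toFinset

theorem mem_fiber {v : HeightOneSpectrum B} {w : HeightOneSpectrum C} :
    w ∈ fiber C v ↔ under B w = v := by simp [fiber]

theorem lg_card_eq {lg : ℝ → ℝ} (hlg : IsLog lg) [Ring.HasFiniteQuotients B]
    (w : HeightOneSpectrum C) :
    lg (Nat.card (C ⧸ w.asIdeal)) = (under B w).asIdeal.inertiaDeg' w.asIdeal *
      lg (Nat.card (B ⧸ (under B w).asIdeal)) := by
  have : (under B w).asIdeal.IsMaximal := (under B w).isMaximal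
  let : Field (B ⧸ (under B w).asIdeal) := Ideal.Quotient.field _
  have : Finite (B ⧸ (under B w).asIdeal) :=
    Ring.HasFiniteQuotients.finiteQuotient (under B w).ne_bot
  rw [Module.natCard_eq_pow_finrank (K := B ⧸ (under B w).asIdeal), Nat.cast_pow, hlg.map_pow,
    Ideal.inertiaDeg'_algebraMap]

set_option linter.deprecated false in
/-- The fundamental identity `∑ e f = n`, in terms of logarithms of norms. -/
theorem sum_fiber {lg : ℝ → ℝ} (hlg : IsLog lg) [Ring.HasFiniteQuotients B]
    (v : HeightOneSpectrum B) :
    ∑ w ∈ fiber C v, (ramI B w : ℝ) * lg (Nat.card (C ⧸ w.asIdeal)) =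
      Module.finrank K L * lg (Nat.card (B ⧸ v.asIdeal)) := by
  classical
  have : v.asIdeal.IsMaximal := v.isMaximal
  have h := Ideal.sum_ramification_inertia C K L v.ne_bot
  rw [← h, Nat.cast_sum, Finset.sum_mul]
  refine Finset.sum_bij (fun w _ => w.asIdeal) ?_ ?_ ?_ ?_
  · intro w hw
    exact (IsDedekindDomain.mem_primesOverFinset_iff v.ne_bot _).2
      ⟨w.isPrime, under_eq_iff.1 (mem_fiber.1 hw)⟩
  · intro w _ w' _ h
    exact HeightOneSpectrum.ext h
  · intro P hP
    obtain ⟨h1, h2⟩ := (IsDedekindDomain.mem_primesOverFinset_iff v.ne_bot _).1 hP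
    exact ⟨⟨P, h1, Ideal.ne_bot_of_liesOver_of_ne_bot v.ne_bot P⟩,
      mem_fiber.2 (under_eq_iff.2 h2), rfl⟩
  · intro w hw
    obtain rfl := mem_fiber.1 hw
    rw [lg_card_eq (B := B) hlg w]
    push_cast
    ring

theorem sum_biUnion_fiber [DecidableEq (HeightOneSpectrum C)] (S : Finset (HeightOneSpectrum B))
    (F : HeightOneSpectrum C → ℝ) :
    ∑ w ∈ S.biUnion (fiber C), F w = ∑ v ∈ S, ∑ w ∈ fiber C v, F w := by
  refine Finset.sum_biUnion fun v _ v' _ hne => ?_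
  refine Finset.disjoint_left.2 fun w hw hw' => hne ?_
  rw [← mem_fiber.1 hw, mem_fiber.1 hw']

/-- The norm of an extended ideal. -/
theorem ordDeg_map {lg : ℝ → ℝ} (hlg : IsLog lg) [Ring.HasFiniteQuotients B] {I : Ideal B}
    (hI : I ≠ ⊥) :
    ordDeg lg (I.map (algebraMap B C)) = Module.finrank K L * ordDeg lg I := by
  classical
  have hsub : (ord (I.map (algebraMap B C))).support ⊆ (ord I).support.biUnion (fiber C) := by
    intro w hw
    rw [Finsupp.mem_support_iff, ord_map hI] at hw
    exact Finset.mem_biUnion.2 ⟨under B w, Finsupp.mem_support_iff.2 (right_ne_zero_of_mul hw),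
      mem_fiber.2 rfl⟩
  rw [ordDeg_eq_sum lg _ hsub, sum_biUnion_fiber, ordDeg, Finsupp.sum, Finset.mul_sum]
  refine Finset.sum_congr rfl fun v _ => ?_
  rw [mul_left_comm, ← sum_fiber (C := C) K L hlg v, Finset.mul_sum]
  refine Finset.sum_congr rfl fun w hw => ?_
  obtain rfl := mem_fiber.1 hw
  rw [ord_map hI]
  push_cast
  ring

end Extension

/-! ### The degree of the different and the ramified primes -/

section Different

variable (B C : Type*) [CommRing B] [IsDedekindDomain B] [CommRing C] [IsDedekindDomain C]
  [Algebra B C] [Module.Finite B C] [Module.IsTorsionFree B C]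
  (K L : Type*) [Field K] [Field L] [Algebra B K] [IsFractionRing B K]
  [Algebra C L] [IsFractionRing C L] [Algebra K L] [Algebra B L] [IsScalarTower B K L]
  [IsScalarTower B C L]

attribute [local instance] FractionRing.liftAlgebra

/-- The divisibility results for the different are formulated with the canonical fraction fields, to
which separability of `L / K` is carried over here. -/
theorem isSeparable_fractionRing [Algebra.IsSeparable K L] :
    Algebra.IsSeparable (FractionRing B) (FractionRing C) := by
  have H : RingHom.comp (algebraMap (FractionRing B) (FractionRing C))
      ↑(FractionRing.algEquiv B K).symm.toRingEquiv =
        RingHom.comp ↑(FractionRing.algEquiv C L).symm.toRingEquiv (algebraMap K L) := by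
    apply IsLocalization.ringHom_ext (nonZeroDivisors B)
    ext
    simp only [RingHom.coe_comp, RingHom.coe_coe,
      AlgEquiv.coe_ringEquiv, Function.comp_apply, AlgEquiv.commutes,
      ← IsScalarTower.algebraMap_apply]
    rw [IsScalarTower.algebraMap_apply B C L, AlgEquiv.commutes, ← IsScalarTower.algebraMap_apply]
  exact Algebra.IsSeparable.of_equiv_equiv _ _ H

theorem different_ne_bot [Algebra.IsSeparable K L] : differentIdeal B C ≠ ⊥ := by
  have := isSeparable_fractionRing B C K L
  exact differentIdeal_ne_bot

variable {C}

theorem ramI_sub_one_le [Algebra.IsSeparable K L] (w : HeightOneSpectrum C) :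
    ramI B w - 1 ≤ ord (differentIdeal B C) w := by
  have := isSeparable_fractionRing B C K L
  have : (under B w).asIdeal.IsMaximal := (under B w).isMaximal
  rw [le_ord_iff (different_ne_bot B C K L)]
  refine pow_sub_one_dvd_differentIdeal B w.asIdeal _ (under B w).ne_bot ?_
  rw [Ideal.dvd_iff_le]
  exact Ideal.le_pow_ramificationIdx'

theorem ord_different_of_tame [Algebra.IsSeparable K L] [Ring.HasFiniteQuotients B]
    {w : HeightOneSpectrum C} (hw : (ramI B w : B ⧸ (under B w).asIdeal) ≠ 0) :
    ord (differentIdeal B C) w = ramI B w - 1 := by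
  have := isSeparable_fractionRing B C K L
  have : (under B w).asIdeal.IsMaximal := (under B w).isMaximal
  have : w.asIdeal.IsMaximal := w.isMaximal
  have : Finite (B ⧸ (under B w).asIdeal) :=
    Ring.HasFiniteQuotients.finiteQuotient (under B w).ne_bot
  refine le_antisymm ?_ (ramI_sub_one_le B K L w)
  have h := not_pow_dvd_differentIdeal_of_tame (under B w).ne_bot w.asIdeal hw
  rw [← le_ord_iff (different_ne_bot B C K L)] at h
  change ¬ ramI B w ≤ _ at h
  omega

variable (C)

/-- The maximal ideals of `B` that ramify in `C`. -/
def ramSet : Set (HeightOneSpectrum B) :=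
  {v | ∃ w : HeightOneSpectrum C, under B w = v ∧ 1 < ramI B w}

/-- A prime with `e > 1` divides the different, since its exponent there is at least `e - 1`. -/
theorem ramSet_finite [Algebra.IsSeparable K L] : (ramSet B C).Finite := by
  classical
  refine (((ord (differentIdeal B C)).support.image (under B)).finite_toSet).subset ?_
  rintro v ⟨w, rfl, hw⟩
  have := ramI_sub_one_le B K L w
  exact Finset.mem_coe.2 (Finset.mem_image_of_mem _ (Finsupp.mem_support_iff.2 (by omega)))

/-- The Galois group permutes transitively the primes above a given one. -/
theorem ramI_eq_of_isGalois [FiniteDimensional K L] [IsGalois K L] {w w' : HeightOneSpectrum C}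
    (h : under B w = under B w') : ramI B w = ramI B w' := by
  have : IsIntegralClosure C B L := IsIntegralClosure.of_isIntegrallyClosed C B L
  have h1 : w.asIdeal ∈ (under B w).asIdeal.primesOver C := ⟨w.isPrime, inferInstance⟩
  have h2 : w'.asIdeal ∈ (under B w).asIdeal.primesOver C :=
    ⟨w'.isPrime, under_eq_iff.1 h.symm⟩
  obtain ⟨σ, hσ⟩ := Ideal.exists_comap_galRestrict_eq B K L C h1 h2
  rw [ramI, ramI, ← h, ← hσ]
  exact (Ideal.ramificationIdx'_comap_eq _ _ _).symm

/-- The exponents of the different are `e - 1 ≤ e`, and they vanish above unramified primes. Now sum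
with `∑ e f = [L : K]`. -/
theorem ordDeg_different_le_of_tame [Algebra.IsSeparable K L] [Ring.HasFiniteQuotients B]
    [Ring.HasFiniteQuotients C] {lg : ℝ → ℝ} (hlg : IsLog lg)
    (h : ∀ w : HeightOneSpectrum C, (ramI B w : B ⧸ (under B w).asIdeal) ≠ 0)
    {S : Finset (HeightOneSpectrum B)} (hS : ∀ v, v ∈ S ↔ v ∈ ramSet B C) :
    ordDeg lg (differentIdeal B C) ≤
      Module.finrank K L * ∑ v ∈ S, lg (Nat.card (B ⧸ v.asIdeal)) := by
  classical
  have hsub : (ord (differentIdeal B C)).support ⊆ S.biUnion (fiber C) := by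
    intro w hw
    rw [Finsupp.mem_support_iff, ord_different_of_tame B K L (h w)] at hw
    exact Finset.mem_biUnion.2 ⟨under B w, (hS _).2 ⟨w, rfl, by omega⟩, mem_fiber.2 rfl⟩
  rw [ordDeg_eq_sum lg _ hsub, sum_biUnion_fiber, Finset.mul_sum]
  refine Finset.sum_le_sum fun v _ => ?_
  rw [← sum_fiber (C := C) K L hlg v]
  refine Finset.sum_le_sum fun w _ => ?_
  refine mul_le_mul_of_nonneg_right ?_ (lg_card_nonneg hlg w)
  rw [ord_different_of_tame B K L (h w)]
  exact_mod_cast Nat.sub_le _ _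

/-- All primes above a ramified one have the same `e ≥ 2`, hence exponent at least `e - 1 ≥ e / 2`
in the different. This bound holds under wild ramification too. -/
theorem le_ordDeg_different_of_isGalois [FiniteDimensional K L] [IsGalois K L]
    [Ring.HasFiniteQuotients B] [Ring.HasFiniteQuotients C] {lg : ℝ → ℝ} (hlg : IsLog lg)
    {S : Finset (HeightOneSpectrum B)} (hS : ∀ v, v ∈ S ↔ v ∈ ramSet B C) :
    Module.finrank K L * (∑ v ∈ S, lg (Nat.card (B ⧸ v.asIdeal)) / 2) ≤
      ordDeg lg (differentIdeal B C) := by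
  classical
  rw [ordDeg_eq_sum lg _ Finset.subset_union_left
    (T := (ord (differentIdeal B C)).support ∪ S.biUnion (fiber C))]
  refine le_trans ?_ (Finset.sum_le_sum_of_subset_of_nonneg Finset.subset_union_right
    fun w _ _ => mul_nonneg (Nat.cast_nonneg _) (lg_card_nonneg hlg w))
  rw [sum_biUnion_fiber, Finset.mul_sum]
  refine Finset.sum_le_sum fun v hv => ?_
  rw [← mul_div_assoc, ← sum_fiber (C := C) K L hlg v, Finset.sum_div]
  refine Finset.sum_le_sum fun w hw => ?_
  rw [mul_div_right_comm]
  refine mul_le_mul_of_nonneg_right ?_ (lg_card_nonneg hlg w)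
  obtain ⟨w', hw', h1⟩ := (hS v).1 hv
  rw [ramI_eq_of_isGalois B C K L (hw'.trans (mem_fiber.1 hw).symm)] at h1
  have h2 := ramI_sub_one_le B K L w
  have h3 : ramI B w ≤ 2 * ord (differentIdeal B C) w := by omega
  have : (ramI B w : ℝ) ≤ 2 * ord (differentIdeal B C) w := by exact_mod_cast h3
  linarith

/-- The different of `C / A` is the different of `C / B` times the extension to `C` of the different
of `B / A`, and extending an ideal multiplies its degree by `[L : K]`. -/
theorem ordDeg_different_tower (A k : Type*) [CommRing A] [IsDedekindDomain A] [Field k]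
    [Algebra A k] [IsFractionRing A k] [Algebra A B] [Algebra A C] [Algebra A L] [Algebra k L]
    [IsScalarTower A k L] [IsScalarTower A C L] [IsScalarTower A B C] [Module.Finite A B]
    [Module.Finite A C] [Module.IsTorsionFree A B] [Module.IsTorsionFree A C]
    [Algebra k K] [IsScalarTower k K L] [Algebra A K] [IsScalarTower A k K] [IsScalarTower A B K]
    [Algebra.IsSeparable k L]
    [Ring.HasFiniteQuotients B] {lg : ℝ → ℝ} (hlg : IsLog lg) :
    ordDeg lg (differentIdeal A C) =
      Module.finrank K L * ordDeg lg (differentIdeal A B) + ordDeg lg (differentIdeal B C) := by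
  have := isSeparable_fractionRing A C k L
  have : Algebra.IsSeparable k K := Algebra.isSeparable_tower_bot_of_isSeparable k K L
  have : Algebra.IsSeparable K L := Algebra.isSeparable_tower_top_of_isSeparable k K L
  have h1 := different_ne_bot A B k K
  have h2 := different_ne_bot B C K L
  rw [differentIdeal_eq_differentIdeal_mul_differentIdeal A B C,
    ordDeg_mul lg h2 (Ideal.map_ne_bot_of_ne_bot h1), ordDeg_map K L hlg h1, add_comm]

end Different

/-! ### Functoriality of the ramification loci -/

section RamFunctoriality

variable {K E M : Type*} [Field K] [Field E] [Field M] [Algebra K E] [Algebra K M]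

/-- The loci `Ram` and `WildRam` are defined through subfields of `M`. Transporting a place along `E
≃ f.fieldRange` allows abstract finite extensions that embed in `M` to be used instead. -/
theorem exists_intermediateField_place [FiniteDimensional K E] (f : E →ₐ[K] M) (P : Place E) :
    ∃ L : IntermediateField K M, FiniteDimensional K L ∧ ∃ Q : Place L,
      (∀ p : Place K, P.LiesAbove p → Q.LiesAbove p) ∧ Q.ramIdx K = P.ramIdx K := by
  let e : E ≃ₐ[K] f.fieldRange := AlgEquiv.ofInjectiveField f
  let v : Valuation f.fieldRange (WithZero (Multiplicative ℤ)) :=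
    P.val.comap (e.symm : f.fieldRange →+* E)
  have hv (x : f.fieldRange) : v x = P.val (e.symm x) := rfl
  have hsurj : Function.Surjective v := by
    intro y
    obtain ⟨x, hx⟩ := P.val_surjective y
    exact ⟨e x, by rw [hv, e.symm_apply_apply, hx]⟩
  have htop : v.valuationSubring ≠ ⊤ := by
    intro htop
    obtain ⟨x, hx⟩ := hsurj (WithZero.exp 1)
    have hx1 : x ∈ v.valuationSubring := htop ▸ ValuationSubring.mem_top x
    rw [Valuation.mem_valuationSubring_iff, hx, ← WithZero.exp_zero, WithZero.exp_le_exp] at hx1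
    omega
  let Q : Place f.fieldRange := ⟨_, Place.isDiscreteValuationRing_of_ne_top v htop⟩
  have hQ : Q.val = v := (Q.eq_val_of_surjective hsurj rfl).symm
  refine ⟨f.fieldRange, Module.Finite.equiv e.toLinearEquiv, Q, fun p hp => ?_, ?_⟩
  · rw [Place.LiesAbove, ← hp]
    ext x
    rw [ValuationSubring.mem_comap, ValuationSubring.mem_comap, ← Place.val_le_one_iff,
      ← Place.val_le_one_iff, hQ, hv, e.symm.commutes]
  · obtain ⟨p, hp⟩ := P.exists_liesAbove_of_isAlgebraic (K := K)
    refine Place.ramIdx_eq_of_val (p := p) fun x => ?_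
    rw [hQ, hv, e.symm.commutes, hp.val_algebraMap]

theorem mem_ram_of_algHom [FiniteDimensional K E] (f : E →ₐ[K] M) {P : Place E} {p : Place K}
    (hP : P.LiesAbove p) (h : 1 < P.ramIdx K) : p ∈ Ram K M := by
  obtain ⟨L, hL, Q, hQ, hr⟩ := exists_intermediateField_place f P
  exact ⟨L, hL, Q, hQ p hP, hr ▸ h⟩

theorem mem_wildRam_of_algHom [FiniteDimensional K E] (f : E →ₐ[K] M) {P : Place E}
    {p : Place K} (hP : P.LiesAbove p) (h : ringChar p.ResidueField ∣ P.ramIdx K) :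
    p ∈ WildRam K M := by
  obtain ⟨L, hL, Q, hQ, hr⟩ := exists_intermediateField_place f P
  exact ⟨L, hL, Q, hQ p hP, hr ▸ h⟩

theorem ram_mono (f : E →ₐ[K] M) : Ram K E ⊆ Ram K M := by
  rintro p ⟨L, hL, P, hP, h⟩
  exact mem_ram_of_algHom (f.comp L.val) hP h

theorem wildRam_mono (f : E →ₐ[K] M) : WildRam K E ⊆ WildRam K M := by
  rintro p ⟨L, hL, P, hP, h⟩
  exact mem_wildRam_of_algHom (f.comp L.val) hP h

/-- Ramification in a finite separable extension is seen at its own places. -/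
theorem mem_ram_iff_of_finite [FiniteDimensional K E] [Algebra.IsSeparable K E] {p : Place K} :
    p ∈ Ram K E ↔ ∃ P : Place E, P.LiesAbove p ∧ 1 < P.ramIdx K := by
  constructor
  · rintro ⟨L, hL, P, hP, h⟩
    have : FiniteDimensional L E := FiniteDimensional.right K L E
    have : Algebra.IsSeparable L E := Algebra.isSeparable_tower_top_of_isSeparable K L E
    obtain ⟨Q, hQ⟩ := (P.exists_liesAbove_and_encard_le E).1
    refine ⟨Q, hQ.trans hP, ?_⟩
    rw [hQ.ramIdx_mul hP]
    exact Nat.lt_of_lt_of_le h (Nat.le_mul_of_pos_right _ hQ.ramIdx_pos)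
  · rintro ⟨P, hP, h⟩
    exact mem_ram_of_algHom (AlgHom.id K E) hP h

end RamFunctoriality

/-! ### Ramification over one affine chart -/

section Chart

variable (A k K L : Type*) [CommRing A] [IsDedekindDomain A] [Field k] [Algebra A k]
  [IsFractionRing A k] [Field K] [Field L] [Algebra A K] [Algebra k K] [IsScalarTower A k K]
  [Algebra A L] [Algebra k L] [IsScalarTower A k L] [Algebra K L] [IsScalarTower k K L]
  [FiniteDimensional k K] [Algebra.IsSeparable k K]
  [FiniteDimensional k L] [Algebra.IsSeparable k L]

/-- The degree of the different of `K / k` above the maximal ideals of `A`. -/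
def diffDeg (lg : ℝ → ℝ) : ℝ :=
  haveI := integralClosure.isDedekindDomain A k K
  haveI : Module.IsTorsionFree A K := .trans_faithfulSMul A k K
  ordDeg lg (differentIdeal A (integralClosure A K))

variable {K L} in
theorem Place.mem_of_mem_integralClosure {p : Place K}
    (hp : ∀ a : A, algebraMap A K a ∈ p.1) (x : integralClosure A K) : (x : K) ∈ p.1 := by
  obtain ⟨q, hq, hq0⟩ := x.2
  let f : A →+* p.1 := (algebraMap A K).codRestrict p.1.toSubring hp
  have : IsIntegral p.1 (x : K) := ⟨q.map f, hq.map f, by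
    rw [Polynomial.eval₂_map]
    exact hq0⟩
  obtain ⟨y, hy⟩ := IsIntegrallyClosed.isIntegral_iff.1 this
  rw [← hy]
  exact y.2

/-- The places of `K` that ramify in `L` and whose valuation ring contains `A`. -/
def chartRam : Set (Place K) := {p | p ∈ Ram K L ∧ ∀ a : A, algebraMap A K a ∈ p.1}

/-- The places of `K` and `L` in the chart are the maximal ideals of the integral closures `B` and
`C` of `A`, and `d` is the degree of the different of `C / B`. -/
theorem chart_main [Ring.HasFiniteQuotients A] {lg : ℝ → ℝ} (hlg : IsLog lg) :
    (chartRam A K L).Finite ∧ ∃ d : ℝ,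
      diffDeg A k L lg = Module.finrank K L * diffDeg A k K lg + d ∧ 0 ≤ d ∧
      (WildRam K L = ∅ → d ≤ Module.finrank K L * ∑ᶠ p ∈ chartRam A K L, lg p.norm) ∧
      (IsGalois K L → Module.finrank K L * ((∑ᶠ p ∈ chartRam A K L, lg p.norm) / 2) ≤ d) := by
  have : Algebra.IsSeparable K L := Algebra.isSeparable_tower_top_of_isSeparable k K L
  have : FiniteDimensional K L := FiniteDimensional.right k K L
  have : IsScalarTower A K L := .of_algebraMap_eq fun a => by
    rw [IsScalarTower.algebraMap_apply A k L, IsScalarTower.algebraMap_apply k K L,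
      ← IsScalarTower.algebraMap_apply A k K]
  let B := integralClosure A K
  let C := integralClosure A L
  have : Module.IsTorsionFree A K := .trans_faithfulSMul A k K
  have : Module.IsTorsionFree A L := .trans_faithfulSMul A k L
  have : IsDedekindDomain B := integralClosure.isDedekindDomain A k K
  have : IsDedekindDomain C := integralClosure.isDedekindDomain A k L
  have : IsFractionRing B K := integralClosure.isFractionRing_of_finite_extension k K
  have : IsFractionRing C L := integralClosure.isFractionRing_of_finite_extension k L
  have : Module.Finite A B := IsIntegralClosure.finite A k K B
  have : Module.Finite A C := IsIntegralClosure.finite A k L C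
  have : Ring.HasFiniteQuotients B := .of_module_finite A B
  have : Ring.HasFiniteQuotients C := .of_module_finite A C
  let : Algebra B C := ((IsScalarTower.toAlgHom A K L).mapIntegralClosure).toRingHom.toAlgebra
  have : IsScalarTower B C L := .of_algebraMap_eq fun _ => rfl
  have : IsScalarTower A B C := .of_algebraMap_eq fun a =>
    Subtype.ext (IsScalarTower.algebraMap_apply A K L a)
  have : Module.Finite B C := Module.Finite.of_restrictScalars_finite A B C
  have : Module.IsTorsionFree B L := .trans_faithfulSMul B K L
  have : Module.IsTorsionFree B C := by
    have : FaithfulSMul B C := by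
      rw [faithfulSMul_iff_algebraMap_injective]
      intro x y hxy
      have h1 : algebraMap K L x = algebraMap K L y := congrArg Subtype.val hxy
      exact Subtype.ext ((algebraMap K L).injective h1)
    infer_instance
  have hset : chartRam A K L = Place.ofHeightOne K '' ramSet B C := by
    ext p
    rw [chartRam, Set.mem_ofPred_eq, mem_ram_iff_of_finite]
    constructor
    · rintro ⟨⟨P, hP, h⟩, hA⟩
      obtain ⟨v, rfl⟩ := Place.exists_ofHeightOne_eq (B := B) K
        (Place.mem_of_mem_integralClosure A hA)
      obtain ⟨w, rfl, hw⟩ := Place.exists_ofHeightOne_eq_of_liesAbove K L (C := C) hP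
      obtain rfl := under_eq_iff.2 hw
      rw [Place.ramIdx_ofHeightOne K L w (under B w)] at h
      exact ⟨_, ⟨w, rfl, h⟩, rfl⟩
    · rintro ⟨_, ⟨w, rfl, h⟩, rfl⟩
      refine ⟨⟨Place.ofHeightOne L w,
        (Place.ofHeightOne_liesAbove_iff K L).2 inferInstance, ?_⟩, fun a => ?_⟩
      · rw [Place.ramIdx_ofHeightOne K L w (under B w)]
        exact h
      · exact Place.algebraMap_mem_ofHeightOne K (under B w) (algebraMap A B a)
  have hfin := ramSet_finite B C K L
  have hsum : ∑ᶠ p ∈ chartRam A K L, lg p.norm =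
      ∑ v ∈ hfin.toFinset, lg (Nat.card (B ⧸ v.asIdeal)) := by
    rw [hset, finsum_mem_image (Place.ofHeightOne_injective K).injOn,
      ← finsum_mem_coe_finset, Set.Finite.coe_toFinset]
    simp_rw [Place.norm_ofHeightOne]
  have hS (v) : v ∈ hfin.toFinset ↔ v ∈ ramSet B C := Set.Finite.mem_toFinset _
  refine ⟨hset ▸ hfin.image _, ordDeg lg (differentIdeal B C),
    ordDeg_different_tower B C K L A k hlg, ordDeg_nonneg hlg _, ?_, ?_⟩
  · intro hw
    rw [hsum]
    refine ordDeg_different_le_of_tame B C K L hlg (fun w hw0 => ?_) hS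
    -- A ramification index that vanishes in the residue field of `B` means wild ramification, which
    -- is excluded.
    have hmem : Place.ofHeightOne K (under B w) ∈ WildRam K L := by
      refine mem_wildRam_of_algHom (AlgHom.id K L) (P := Place.ofHeightOne L w)
        ((Place.ofHeightOne_liesAbove_iff K L).2 inferInstance) ?_
      obtain ⟨e⟩ := Place.nonempty_residueField_ringEquiv K (under B w)
      rw [Place.ramIdx_ofHeightOne K L w (under B w), ← ringChar.spec]
      have := congrArg e hw0
      rwa [map_natCast, map_zero] at this
    rw [hw] at hmem
    exact hmem
  · intro hG
    rw [hsum, Finset.sum_div]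
    exact le_ordDeg_different_of_isGalois B C K L hlg hS

end Chart

/-! ### Towers and limits along them -/

section Towers

variable {k M : Type*} [Field k] [Field M] [Algebra k M]

theorem Sub.degree_pos (K : Sub k M) : 0 < K.degree := Module.finrank_pos

/-- The compositum of two global fields in `M`. -/
def Sub.sup (K L : Sub k M) : Sub k M := ⟨K.1 ⊔ L.1, inferInstance⟩

/-- The relative degree. -/
abbrev relDegree {K L : Sub k M} (h : K.1 ≤ L.1) : ℕ :=
  Module.finrank K.1 (IntermediateField.extendScalars h)

instance finiteDimensional_extendScalars {K L : Sub k M} (h : K.1 ≤ L.1) :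
    FiniteDimensional K.1 (IntermediateField.extendScalars h) :=
  haveI : FiniteDimensional k (IntermediateField.extendScalars h) := L.2
  FiniteDimensional.right k K.1 (IntermediateField.extendScalars h)

theorem relDegree_pos {K L : Sub k M} (h : K.1 ≤ L.1) : 0 < relDegree h := Module.finrank_pos

theorem Sub.degree_mul {K L : Sub k M} (h : K.1 ≤ L.1) : L.degree = K.degree * relDegree h :=
  haveI : Module.Free K.1 (IntermediateField.extendScalars h) := Module.Free.of_divisionRing _ _
  (Module.finrank_mul_finrank k K.1 (IntermediateField.extendScalars h)).symm

theorem IsTower.monotone {K : ℕ → Sub k M} (hK : IsTower K) : Monotone fun i => (K i).1 :=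
  monotone_nat_of_le_succ fun i => (hK.lt_succ i).le

/-- A basis of `L / k` is finite, and each of its elements appears at some stage. -/
theorem IsTower.exists_le {K : ℕ → Sub k M} (hK : IsTower K) (L : Sub k M) :
    ∃ i, ∀ j, i ≤ j → L.1 ≤ (K j).1 := by
  classical
  let b := Module.finBasis k L.1
  choose f hf using fun i => hK.union (b i : M)
  refine ⟨Finset.univ.sup f, fun j hj x hx => ?_⟩
  have h := b.sum_repr ⟨x, hx⟩
  have hx' : x = ∑ i, b.repr ⟨x, hx⟩ i • (b i : M) := by
    have h' := congrArg L.1.val h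
    simp only [map_sum, map_smul] at h'
    exact h'.symm
  rw [hx']
  refine sum_mem fun i _ => IntermediateField.smul_mem _ ?_
  exact hK.monotone ((Finset.le_sup (Finset.mem_univ i)).trans hj) (hf i)

theorem IsTower.one_lt_degree {K : ℕ → Sub k M} (hK : IsTower K) (i : ℕ) : i < (K i).degree := by
  induction i with
  | zero => exact (K 0).degree_pos
  | succ i ih =>
    have hle := (hK.lt_succ i).le
    rw [Sub.degree_mul hle]
    have h1 : 1 < relDegree hle := by
      by_contra h
      have h1 : relDegree hle = 1 := le_antisymm (not_lt.1 h) (relDegree_pos hle)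
      have hd := Sub.degree_mul hle
      rw [h1, mul_one] at hd
      exact (hK.lt_succ i).ne (IntermediateField.eq_of_le_of_finrank_eq hle hd.symm)
    have := (K i).degree_pos
    nlinarith

theorem IsTower.tendsto_degree {K : ℕ → Sub k M} (hK : IsTower K) :
    Tendsto (fun i => ((K i).degree : ℝ)) atTop atTop :=
  tendsto_natCast_atTop_atTop.comp
    (tendsto_atTop_mono (fun i => (hK.one_lt_degree i).le) tendsto_id)

/-- Infinite global fields have towers. -/
theorem exists_isTower [Countable M] [Algebra.IsAlgebraic k M] (h : ¬ FiniteDimensional k M) :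
    ∃ K : ℕ → Sub k M, IsTower K := by
  obtain ⟨x, hx⟩ := exists_surjective_nat M
  have hy (K : Sub k M) : ∃ y : M, y ∉ K.1 := by
    by_contra hall
    push Not at hall
    apply h
    have htop : K.1 = ⊤ := eq_top_iff.2 fun y _ => hall y
    have h2 : FiniteDimensional k (⊤ : IntermediateField k M) := htop ▸ K.2
    exact Module.Finite.equiv (IntermediateField.topEquiv (F := k) (E := M)).toLinearEquiv
  choose y hy using hy
  have hfin (z : M) : FiniteDimensional k (IntermediateField.adjoin k {z}) :=
    IntermediateField.adjoin.finiteDimensional (Algebra.IsIntegral.isIntegral z)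
  let S (z : M) : Sub k M := ⟨IntermediateField.adjoin k {z}, hfin z⟩
  -- Each stage adjoins the `n`-th element of `M`, so that the union is `M`, and an element outside
  -- the present field, so that the inclusion is strict.
  let K : ℕ → Sub k M := fun n => Nat.rec ⟨⊥, inferInstance⟩
    (fun n K => (K.sup (S (x n))).sup (S (y K))) n
  have hK (n : ℕ) : (K (n + 1)).1 = ((K n).1 ⊔ (S (x n)).1) ⊔ (S (y (K n))).1 := rfl
  refine ⟨K, ⟨fun i => ?_, fun z => ?_⟩⟩
  · refine lt_of_le_of_ne ?_ ?_
    · rw [hK]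
      exact le_sup_left.trans le_sup_left
    · intro heq
      apply hy (K i)
      rw [heq, hK]
      exact (le_sup_right : (S (y (K i))).1 ≤ _)
        (IntermediateField.mem_adjoin_simple_self k _)
  · obtain ⟨n, rfl⟩ := hx z
    refine ⟨n + 1, ?_⟩
    rw [hK]
    exact (le_sup_right.trans le_sup_left : (S (x n)).1 ≤ _)
      (IntermediateField.mem_adjoin_simple_self k _)

/-- A bounded quantity that increases with the field has a limit along towers, independent of
the tower. -/
theorem tendsto_iSup_of_isTower {x : Sub k M → ℝ} (hx : ∀ K L : Sub k M, K.1 ≤ L.1 → x K ≤ x L)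
    (hb : BddAbove (Set.range x)) {K : ℕ → Sub k M} (hK : IsTower K) :
    Tendsto (fun i => x (K i)) atTop (𝓝 (⨆ L, x L)) := by
  have hm : Monotone fun i => x (K i) := fun i j hij => hx _ _ (hK.monotone hij)
  have hb' : BddAbove (Set.range fun i => x (K i)) :=
    hb.mono (Set.range_comp_subset_range K x)
  have h := tendsto_atTop_ciSup hm hb'
  have : Nonempty (Sub k M) := ⟨K 0⟩
  convert h using 2
  refine le_antisymm (ciSup_le fun L => ?_) (ciSup_le fun i => le_ciSup hb (K i))
  obtain ⟨i, hi⟩ := hK.exists_le L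
  exact (hx _ _ (hi i le_rfl)).trans (le_ciSup hb' i)

end Towers

/-! ### The three claims, deduced from properties of the degree of the different -/

section Core

variable {k M : Type*} [Field k] [Field M] [Algebra k M]

/-- What the theorem needs to know about the degree `H K` of the different of `K / k`. -/
structure IsDiffDegree (lg : ℝ → ℝ) (H : Sub k M → ℝ) : Prop where
  nonneg : ∀ K, 0 ≤ H K
  le : ∀ (K L : Sub k M) (h : K.1 ≤ L.1), relDegree h * H K ≤ H L
  le_of_tame : ∀ (K L : Sub k M) (h : K.1 ≤ L.1),
    WildRam K.1 (IntermediateField.extendScalars h) = ∅ →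
    H L ≤ relDegree h *
      (H K + ∑ᶠ p ∈ Ram K.1 (IntermediateField.extendScalars h), lg p.norm)
  le_of_isGalois : ∀ (K L : Sub k M) (h : K.1 ≤ L.1),
    IsGalois K.1 (IntermediateField.extendScalars h) →
    relDegree h *
      (H K + (∑ᶠ p ∈ Ram K.1 (IntermediateField.extendScalars h), lg p.norm) / 2) ≤ H L
  -- Without finiteness the sums above would take the default value `0`.
  ram_finite : ∀ (K L : Sub k M) (h : K.1 ≤ L.1),
    (Ram K.1 (IntermediateField.extendScalars h)).Finite
  ram_base_finite : ∀ K : Sub k M, (Ram k K.1).Finite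
  lg_norm : ∀ (K : Sub k M) (p : Place K.1), lg 2 ≤ lg p.norm
  two_pos : 0 < lg 2

/-- `H K / n_K` is bounded. -/
def DiffBounded (H : Sub k M → ℝ) : Prop := ∃ C : ℝ, ∀ K : Sub k M, H K ≤ C * K.degree

variable {lg : ℝ → ℝ} {H : Sub k M → ℝ}

theorem IsDiffDegree.div_mono (hH : IsDiffDegree lg H) {K L : Sub k M} (h : K.1 ≤ L.1) :
    H K / K.degree ≤ H L / L.degree := by
  have h1 := hH.le K L h
  have hK : (0 : ℝ) < K.degree := by exact_mod_cast K.degree_pos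
  have hr : (0 : ℝ) < relDegree h := by exact_mod_cast relDegree_pos h
  rw [Sub.degree_mul h, Nat.cast_mul, div_le_div_iff₀ hK (by positivity)]
  nlinarith

theorem diffBounded_iff : DiffBounded H ↔ BddAbove (Set.range fun K => H K / K.degree) := by
  have hK (K : Sub k M) : (0 : ℝ) < K.degree := by exact_mod_cast K.degree_pos
  constructor
  · rintro ⟨C, hC⟩
    refine ⟨C, ?_⟩
    rintro _ ⟨K, rfl⟩
    exact (div_le_iff₀ (hK K)).2 (hC K)
  · rintro ⟨C, hC⟩
    exact ⟨C, fun K => (div_le_iff₀ (hK K)).1 (hC ⟨K, rfl⟩)⟩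

/-- Every `L` is contained in a late member of the tower, and `H / n` is monotone. -/
theorem IsDiffDegree.bounded_of_tower (hH : IsDiffDegree lg H) {K : ℕ → Sub k M}
    (hK : IsTower K) {C : ℝ} (h : ∀ᶠ i in atTop, H (K i) / (K i).degree ≤ C) :
    DiffBounded H := by
  rw [diffBounded_iff]
  refine ⟨C, ?_⟩
  rintro _ ⟨L, rfl⟩
  obtain ⟨i, hi⟩ := hK.exists_le L
  obtain ⟨j, hj, hij⟩ := (h.and (eventually_ge_atTop i)).exists
  exact (hH.div_mono (hi j hij)).trans hj

/-- An infimum of extended natural numbers is attained. -/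
theorem EventuallyTame.exists_wildRam_eq_empty (h : EventuallyTame k M) :
    ∃ K : Sub k M, WildRam K.1 M = ∅ := by
  have : Nonempty (Sub k M) := ⟨⟨⊥, inferInstance⟩⟩
  obtain ⟨K, hK⟩ := ENat.exists_eq_iInf fun K' : Sub k M => (WildRam K'.1 M).encard
  exact ⟨K, Set.encard_eq_zero.1 (hK.trans h)⟩

theorem Place.natCast_residueField_eq_zero_iff {K : Type*} [Field K] (P : Place K) (n : ℕ) :
    (n : P.ResidueField) = 0 ↔ P.val n < 1 := by
  have h := (IsDiscreteValuationRing.maximalIdeal P.1).valuation_lt_one_iff_mem (K := K)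
    (n : P.1)
  rw [← map_natCast (IsLocalRing.residue P.1), IsLocalRing.residue_eq_zero_iff]
  exact h.symm

/-- An integer vanishes in a residue field exactly if its valuation is less than `1`, and `P.val`
restricts to a positive power of `p.val`. -/
theorem Place.LiesAbove.ringChar_dvd {K L : Type*} [Field K] [Field L] [Algebra K L]
    {P : Place L} {p : Place K} (h : P.LiesAbove p) {n : ℕ}
    (hn : ringChar P.ResidueField ∣ n) : ringChar p.ResidueField ∣ n := by
  rw [← ringChar.spec, Place.natCast_residueField_eq_zero_iff] at hn ⊢
  rwa [← map_natCast (algebraMap K L), h.val_algebraMap, pow_lt_one_iff h.ramIdx_pos.ne'] at hn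

/-- Tameness is inherited by larger base fields. -/
theorem wildRam_eq_empty_of_le [Algebra.IsSeparable k M] {K L : Sub k M} (h : K.1 ≤ L.1)
    (hK : WildRam K.1 M = ∅) : WildRam L.1 M = ∅ := by
  rw [Set.eq_empty_iff_forall_notMem] at hK ⊢
  rintro p ⟨E, hE, P, hP, hdvd⟩
  let : Algebra K.1 L.1 := (IntermediateField.inclusion h).toRingHom.toAlgebra
  have : IsScalarTower K.1 L.1 M := .of_algebraMap_eq fun x => rfl
  have : IsScalarTower k K.1 L.1 := .of_algebraMap_eq fun x => rfl
  have : FiniteDimensional K.1 L.1 := FiniteDimensional.right k K.1 L.1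
  have : FiniteDimensional K.1 E := Module.Finite.trans L.1 E
  obtain ⟨q, hq⟩ := p.exists_liesAbove_of_isAlgebraic (K := K.1)
  apply hK q
  have : IsScalarTower K.1 E M := .of_algebraMap_eq fun x => rfl
  refine mem_wildRam_of_algHom (IsScalarTower.toAlgHom K.1 E M) (hP.trans hq) ?_
  rw [hP.ramIdx_mul hq]
  exact Dvd.dvd.mul_left (hq.ringChar_dvd hdvd) _

end Core

section Core

variable {k M : Type*} [Field k] [Field M] [Algebra k M] [Algebra.IsSeparable k M]
  {lg : ℝ → ℝ} {H : Sub k M → ℝ}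

/-- If `M / k` ramifies at finitely many places, then so does `M / K`. -/
theorem ram_finite_of_base (h : (Ram k M).Finite) (K : Sub k M) : (Ram K.1 M).Finite := by
  have hfib (p : Place k) : {P : Place K.1 | P.LiesAbove p}.Finite :=
    Set.finite_of_encard_le_coe (p.exists_liesAbove_and_encard_le K.1).2
  refine (h.biUnion fun p _ => hfib p).subset ?_
  rintro p ⟨E, hE, P, hP, hr⟩
  obtain ⟨q, hq⟩ := p.exists_liesAbove_of_isAlgebraic (K := k)
  have : FiniteDimensional k E := Module.Finite.trans K.1 E
  have : IsScalarTower k E M := .of_algebraMap_eq fun x => rfl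
  refine Set.mem_biUnion (x := q) ?_ hq
  refine mem_ram_of_algHom (IsScalarTower.toAlgHom k E M) (hP.trans hq) ?_
  rw [hP.ramIdx_mul hq]
  exact Nat.lt_of_lt_of_le hr (Nat.le_mul_of_pos_left _ hq.ramIdx_pos)

/-- If `M / K` ramifies at finitely many places, then so does `M / k`. -/
theorem ram_base_finite_of_sub (K : Sub k M) (h0 : (Ram k K.1).Finite) (h : (Ram K.1 M).Finite) :
    (Ram k M).Finite := by
  choose r hr using fun p : Place K.1 => p.exists_liesAbove_of_isAlgebraic (K := k)
  refine (h0.union (h.image r)).subset ?_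
  rintro p ⟨E, hE, P, hP, hram⟩
  -- In the compositum choose `Q` above `P`, and let `q` be its restriction to `K`. The index of `Q`
  -- over `k` exceeds `1` and is the product of those of `q / k` and `Q / q`, so `p` ramifies in `K`
  -- or `q` ramifies in `M`.
  let F : IntermediateField k M := E ⊔ K.1
  have : FiniteDimensional k F := inferInstanceAs (FiniteDimensional k (E ⊔ K.1 : IntermediateField k M))
  let : Algebra E F := (IntermediateField.inclusion (le_sup_left : E ≤ F)).toRingHom.toAlgebra
  let : Algebra K.1 F := (IntermediateField.inclusion (le_sup_right : K.1 ≤ F)).toRingHom.toAlgebra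
  have : IsScalarTower k E F := .of_algebraMap_eq fun x => rfl
  have : IsScalarTower k K.1 F := .of_algebraMap_eq fun x => rfl
  have : IsScalarTower K.1 F M := .of_algebraMap_eq fun x => rfl
  have : FiniteDimensional E F := FiniteDimensional.right k E F
  have : FiniteDimensional K.1 F := FiniteDimensional.right k K.1 F
  have : Algebra.IsSeparable E F := Algebra.isSeparable_tower_top_of_isSeparable k E F
  obtain ⟨Q, hQ⟩ := (P.exists_liesAbove_and_encard_le F).1
  obtain ⟨q, hq⟩ := Q.exists_liesAbove_of_isAlgebraic (K := K.1)
  have hQp : Q.LiesAbove p := hQ.trans hP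
  have hqp : q.LiesAbove p := hq.of_trans hQp
  have h1 : 1 < Q.ramIdx k := by
    rw [hQ.ramIdx_mul hP]
    exact Nat.lt_of_lt_of_le hram (Nat.le_mul_of_pos_right _ hQ.ramIdx_pos)
  rw [hq.ramIdx_mul hqp] at h1
  by_cases h2 : 1 < q.ramIdx k
  · exact Or.inl (mem_ram_of_algHom (AlgHom.id k K.1) hqp h2)
  · right
    have h3 : q.ramIdx k = 1 := le_antisymm (not_lt.1 h2) hqp.ramIdx_pos
    rw [h3, one_mul] at h1
    exact ⟨q, mem_ram_of_algHom (IsScalarTower.toAlgHom K.1 F M) hq h1, (hr q).eq hqp⟩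

theorem finsum_mem_le_of_subset {α : Type*} {s t : Set α} (hst : s ⊆ t) (ht : t.Finite)
    {f : α → ℝ} (hf : ∀ x, 0 ≤ f x) : ∑ᶠ x ∈ s, f x ≤ ∑ᶠ x ∈ t, f x := by
  rw [finsum_mem_eq_finite_toFinset_sum f (ht.subset hst), finsum_mem_eq_finite_toFinset_sum f ht]
  exact Finset.sum_le_sum_of_subset_of_nonneg (Set.Finite.toFinset_subset_toFinset.2 hst)
    fun x _ _ => hf x

/-- Tame extensions with finite ramification locus have bounded different. -/
theorem IsDiffDegree.bounded_of_ram_finite (hH : IsDiffDegree lg H) (ht : EventuallyTame k M)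
    (h : (Ram k M).Finite) : DiffBounded H := by
  obtain ⟨K, hK⟩ := ht.exists_wildRam_eq_empty
  have hfin := ram_finite_of_base h K
  rw [diffBounded_iff]
  refine ⟨(H K + ∑ᶠ p ∈ Ram K.1 M, lg p.norm) / K.degree, ?_⟩
  rintro _ ⟨L, rfl⟩
  -- `L` need not contain `K`, but the compositum does; it is tame over `K` and ramified there only
  -- inside the finite set `Ram(M/K)`.
  have hLs : L.1 ≤ (L.sup K).1 := le_sup_left
  have hKs : K.1 ≤ (L.sup K).1 := le_sup_right
  refine (hH.div_mono hLs).trans ?_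
  have h1 := hH.le_of_tame K _ hKs (Set.subset_empty_iff.1
    ((wildRam_mono (IntermediateField.val _)).trans hK.subset))
  have h2 := finsum_mem_le_of_subset (ram_mono (IntermediateField.extendScalars hKs).val) hfin
    (f := fun p => lg p.norm) fun p => hH.two_pos.le.trans (hH.lg_norm K p)
  have hKd : (0 : ℝ) < K.degree := by exact_mod_cast K.degree_pos
  have hr : (0 : ℝ) < relDegree hKs := by exact_mod_cast relDegree_pos hKs
  rw [Sub.degree_mul hKs, Nat.cast_mul, div_le_div_iff₀ (by positivity) hKd]
  have h3 : H (L.sup K) ≤ relDegree hKs * (H K + ∑ᶠ p ∈ Ram K.1 M, lg p.norm) :=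
    h1.trans (mul_le_mul_of_nonneg_left (by linarith) hr.le)
  calc H (L.sup K) * K.degree
      ≤ relDegree hKs * (H K + ∑ᶠ p ∈ Ram K.1 M, lg p.norm) * K.degree :=
        mul_le_mul_of_nonneg_right h3 hKd.le
    _ = _ := by ring

/-- Finitely many ramified places of a Galois extension ramify in some finite Galois
subextension. -/
theorem exists_isGalois_subset_ram (K : Sub k M) [IsGalois K.1 M] (S : Finset (Place K.1))
    (hS : (S : Set (Place K.1)) ⊆ Ram K.1 M) :
    ∃ (L : Sub k M) (h : K.1 ≤ L.1), IsGalois K.1 (IntermediateField.extendScalars h) ∧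
      (S : Set (Place K.1)) ⊆ Ram K.1 (IntermediateField.extendScalars h) := by
  classical
  have hS' : ∀ p ∈ S, ∃ E : IntermediateField K.1 M, FiniteDimensional K.1 E ∧
      ∃ P : Place E, P.LiesAbove p ∧ 1 < P.ramIdx K.1 := fun p hp => hS hp
  choose! E hE hP using hS'
  let E' : IntermediateField K.1 M := ⨆ p ∈ S, E p
  have hE' : FiniteDimensional K.1 E' :=
    IntermediateField.finiteDimensional_iSup_of_finset' hE
  let N : IntermediateField K.1 M := IntermediateField.normalClosure K.1 E' M
  have hN : FiniteDimensional K.1 N := normalClosure.is_finiteDimensional K.1 E' M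
  have hEN : E' ≤ N := E'.le_normalClosure
  have : FiniteDimensional k N := Module.Finite.trans K.1 N
  let L : Sub k M := ⟨N.restrictScalars k, this⟩
  have hKL : K.1 ≤ L.1 := fun x hx => N.algebraMap_mem ⟨x, hx⟩
  have hext : IntermediateField.extendScalars hKL = N := rfl
  refine ⟨L, hKL, ?_, ?_⟩
  · rw [hext]
    have : Normal K.1 N := normalClosure.normal K.1 E' M
    exact ⟨⟩
  · rw [hext]
    intro p hp
    have := hE p hp
    obtain ⟨P, hPp, hr⟩ := hP p hp
    have hle : E p ≤ N := (le_iSup₂_of_le p hp le_rfl : E p ≤ E').trans hEN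
    exact mem_ram_of_algHom (IntermediateField.inclusion hle) hPp hr

/-- If `m` places of `K` ramify in a finite Galois subextension `L`, then `H L ≥ [L : K] * m * (lg
2) / 2`, whereas boundedness gives `H L ≤ [L : K] * C * n_K`. This limits `m`. -/
theorem IsDiffDegree.ram_finite_of_isGalois (hH : IsDiffDegree lg H) (hb : DiffBounded H)
    (K : Sub k M) [IsGalois K.1 M] : (Ram k M).Finite := by
  refine ram_base_finite_of_sub K (hH.ram_base_finite K) ?_
  obtain ⟨C, hC⟩ := hb
  by_contra hinf
  obtain ⟨m, hm⟩ := exists_nat_gt (2 * (C * K.degree) / lg 2)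
  obtain ⟨S, hS, hcard⟩ := Set.Infinite.exists_subset_card_eq hinf m
  obtain ⟨L, h, hG, hsub⟩ := exists_isGalois_subset_ram K S hS
  have h1 := hH.le_of_isGalois K L h hG
  have h2 := hC L
  have h3 := finsum_mem_le_of_subset hsub (hH.ram_finite K L h)
    (f := fun p => lg p.norm) fun p => hH.two_pos.le.trans (hH.lg_norm K p)
  have h4 : m * lg 2 ≤ ∑ᶠ p ∈ (S : Set (Place K.1)), lg p.norm := by
    rw [finsum_mem_coe_finset, ← hcard, ← nsmul_eq_mul]
    exact Finset.card_nsmul_le_sum _ _ _ fun p _ => hH.lg_norm K p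
  have hr : (0 : ℝ) < relDegree h := by exact_mod_cast relDegree_pos h
  rw [Sub.degree_mul h, Nat.cast_mul] at h2
  rw [div_lt_iff₀ hH.two_pos] at hm
  have h5 : (relDegree h : ℝ) * (m * lg 2 / 2) ≤ relDegree h * (C * K.degree) := by
    have h6 : (relDegree h : ℝ) * (m * lg 2 / 2) ≤ relDegree h * (H K +
      (∑ᶠ p ∈ Ram K.1 (IntermediateField.extendScalars h), lg p.norm) / 2) :=
      mul_le_mul_of_nonneg_left (by linarith [hH.nonneg K]) hr.le
    linarith
  have := le_of_mul_le_mul_left h5 hr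
  linarith

variable {K : ℕ → Sub k M}

/-- The `i`-th term of the series over the ramification loci of a tower. -/
def IsTower.term (hK : IsTower K) (lg : ℝ → ℝ) (i : ℕ) : ℝ :=
  (∑ᶠ p ∈ Ram (K i).1 (hK.step i), lg p.norm) / (K i).degree

theorem IsDiffDegree.term_nonneg (hH : IsDiffDegree lg H) (hK : IsTower K) (i : ℕ) :
    0 ≤ hK.term lg i :=
  div_nonneg (finsum_nonneg fun p => finsum_nonneg fun _ => hH.two_pos.le.trans (hH.lg_norm _ p))
    (Nat.cast_nonneg _)

theorem IsDiffDegree.ramSeries_eq (hH : IsDiffDegree lg H) (hK : IsTower K) :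
    hK.ramSeries lg = ∑' i, ENNReal.ofReal (hK.term lg i) := by
  refine tsum_congr fun i => ?_
  have hfin : (Ram (K i).1 (hK.step i)).Finite := hH.ram_finite _ _ (hK.lt_succ i).le
  have : Finite (Ram (K i).1 (hK.step i)) := hfin
  have : Fintype (Ram (K i).1 (hK.step i)) := Fintype.ofFinite _
  have hd : (0 : ℝ) < (K i).degree := by exact_mod_cast (K i).degree_pos
  rw [IsTower.term, div_eq_inv_mul, ENNReal.ofReal_mul (by positivity),
    ENNReal.ofReal_inv_of_pos hd, ENNReal.ofReal_natCast, tsum_fintype,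
    ← finsum_set_coe_eq_finsum_mem, finsum_eq_sum_of_fintype, ENNReal.ofReal_sum_of_nonneg]
  exact fun p _ => hH.two_pos.le.trans (hH.lg_norm _ p.1)

theorem IsDiffDegree.ramSeries_lt_top_iff (hH : IsDiffDegree lg H) (hK : IsTower K) :
    hK.ramSeries lg < ⊤ ↔ Summable (hK.term lg) := by
  rw [hH.ramSeries_eq, lt_top_iff_ne_top]
  constructor
  · intro h
    have h1 := ENNReal.tsum_coe_ne_top_iff_summable_coe.1 h
    refine h1.congr fun i => ?_
    exact Real.coe_toNNReal _ (hH.term_nonneg hK i)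
  · exact fun h => h.tsum_ofReal_ne_top

/-- Let `x i = H (K i) / n_i` and let `t i` be the terms of the series. Being Galois gives `x (i +
1) ≥ x i + t i / 2`. Once the tower contains a field over which `M` is tame, also `x (i + 1) ≤ x i +
t i`. Telescoping, the `x i` are bounded exactly when the `t i` are summable. -/
theorem IsDiffDegree.bounded_iff_of_isGaloisTower (hH : IsDiffDegree lg H)
    (ht : EventuallyTame k M) (hK : IsTower K) (hG : hK.IsGaloisTower) :
    DiffBounded H ↔ hK.ramSeries lg < ⊤ := by
  rw [hH.ramSeries_lt_top_iff]
  have hd (i : ℕ) : (0 : ℝ) < (K i).degree := by exact_mod_cast (K i).degree_pos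
  have hr (i : ℕ) : (0 : ℝ) < relDegree (hK.lt_succ i).le := by
    exact_mod_cast relDegree_pos (hK.lt_succ i).le
  have hdeg (i : ℕ) : ((K (i + 1)).degree : ℝ) = (K i).degree * relDegree (hK.lt_succ i).le := by
    exact_mod_cast Sub.degree_mul (hK.lt_succ i).le
  have hlow (i : ℕ) : H (K i) / (K i).degree + hK.term lg i / 2 ≤
      H (K (i + 1)) / (K (i + 1)).degree := by
    have h1 := hH.le_of_isGalois _ _ (hK.lt_succ i).le (hG i)
    rw [hdeg, le_div_iff₀ (mul_pos (hd i) (hr i)), IsTower.term]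
    refine le_trans (le_of_eq ?_) h1
    have := (hd i).ne'
    rw [IsTower.step]
    field_simp
  obtain ⟨K', hK'⟩ := ht.exists_wildRam_eq_empty
  obtain ⟨i₀, hi₀⟩ := hK.exists_le K'
  have hup (i : ℕ) (hi : i₀ ≤ i) : H (K (i + 1)) / (K (i + 1)).degree ≤
      H (K i) / (K i).degree + hK.term lg i := by
    have hw := wildRam_eq_empty_of_le (hi₀ i hi) hK'
    have h1 := hH.le_of_tame _ _ (hK.lt_succ i).le (Set.subset_empty_iff.1
      ((wildRam_mono (IntermediateField.val _)).trans hw.subset))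
    rw [hdeg, div_le_iff₀ (mul_pos (hd i) (hr i)), IsTower.term]
    refine h1.trans (le_of_eq ?_)
    have := (hd i).ne'
    rw [IsTower.step]
    field_simp
  constructor
  · intro hb
    obtain ⟨C, hC⟩ := diffBounded_iff.1 hb
    have hsum (n : ℕ) : ∑ i ∈ Finset.range n, hK.term lg i ≤
        2 * (H (K n) / (K n).degree) := by
      induction n with
      | zero => simpa using div_nonneg (hH.nonneg (K 0)) (hd 0).le
      | succ n ih =>
        rw [Finset.sum_range_succ]
        linarith [hlow n]
    refine summable_of_sum_range_le (c := 2 * C) (hH.term_nonneg hK) fun n => ?_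
    refine (hsum n).trans ?_
    have := hC ⟨K n, rfl⟩
    simp only at this
    linarith
  · intro hs
    refine hH.bounded_of_tower hK (C := H (K i₀) / (K i₀).degree + ∑' i, hK.term lg i) ?_
    filter_upwards [eventually_ge_atTop i₀] with i hi
    have hsum : H (K i) / (K i).degree ≤
        H (K i₀) / (K i₀).degree + ∑ j ∈ Finset.Ico i₀ i, hK.term lg j := by
      induction i, hi using Nat.le_induction with
      | base => simp
      | succ i hi ih =>
        rw [Finset.sum_Ico_succ_top hi]
        linarith [hup i hi]
    have := hs.sum_le_tsum (Finset.Ico i₀ i) fun j _ => hH.term_nonneg hK j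
    linarith

end Core

/-! ### Verification of `IsDiffDegree` from one or two charts -/

section ChartSub

variable (A : Type*) {k M : Type*} [CommRing A] [IsDedekindDomain A] [Ring.HasFiniteQuotients A]
  [Field k] [Algebra A k] [IsFractionRing A k] [Field M] [Algebra k M] [Algebra A M]
  [IsScalarTower A k M] [Algebra.IsSeparable k M] {lg : ℝ → ℝ}

theorem chart_sub (hlg : IsLog lg) {K L : Sub k M} (h : K.1 ≤ L.1) :
    (chartRam A K.1 (IntermediateField.extendScalars h)).Finite ∧ ∃ d : ℝ,
      diffDeg A k L.1 lg = relDegree h * diffDeg A k K.1 lg + d ∧ 0 ≤ d ∧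
      (WildRam K.1 (IntermediateField.extendScalars h) = ∅ →
        d ≤ relDegree h *
          ∑ᶠ p ∈ chartRam A K.1 (IntermediateField.extendScalars h), lg p.norm) ∧
      (IsGalois K.1 (IntermediateField.extendScalars h) → relDegree h *
        ((∑ᶠ p ∈ chartRam A K.1 (IntermediateField.extendScalars h), lg p.norm) / 2) ≤ d) := by
  let N := IntermediateField.extendScalars h
  have : FiniteDimensional k N := L.2
  have : IsScalarTower k N M := .of_algebraMap_eq fun _ => rfl
  have : Algebra.IsSeparable k N := Algebra.isSeparable_tower_bot_of_isSeparable k N M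
  have : IsScalarTower A K.1 M := .of_algebraMap_eq fun _ => rfl
  have : IsScalarTower A k N := .of_algebraMap_eq fun a =>
    Subtype.ext (IsScalarTower.algebraMap_apply A k M a)
  exact chart_main A k K.1 N hlg

theorem chart_base (hlg : IsLog lg) (K : Sub k M) : (chartRam A k K.1).Finite :=
  (chart_main A k k K.1 hlg).1

theorem two_le_lg_norm_of_chart (hlg : IsLog lg) (K : Sub k M) {p : Place K.1}
    (hp : ∀ a : A, algebraMap A K.1 a ∈ p.1) : lg 2 ≤ lg p.norm := by
  have : IsDedekindDomain (integralClosure A K.1) := integralClosure.isDedekindDomain A k K.1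
  have : IsFractionRing (integralClosure A K.1) K.1 :=
    integralClosure.isFractionRing_of_finite_extension k K.1
  have : Module.Finite A (integralClosure A K.1) :=
    IsIntegralClosure.finite A k K.1 (integralClosure A K.1)
  have : Ring.HasFiniteQuotients (integralClosure A K.1) := .of_module_finite A _
  obtain ⟨v, rfl⟩ := Place.exists_ofHeightOne_eq (B := integralClosure A K.1) K.1
    (Place.mem_of_mem_integralClosure A hp)
  rw [Place.norm_ofHeightOne]
  exact lg_card_pos hlg v

theorem diffDeg_nonneg (hlg : IsLog lg) (K : Sub k M) : 0 ≤ diffDeg A k K.1 lg := by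
  have : IsDedekindDomain (integralClosure A K.1) := integralClosure.isDedekindDomain A k K.1
  have : Module.Finite A (integralClosure A K.1) :=
    IsIntegralClosure.finite A k K.1 (integralClosure A K.1)
  have : Ring.HasFiniteQuotients (integralClosure A K.1) := .of_module_finite A _
  exact ordDeg_nonneg hlg _

/-- The case of a ground field all of whose places contain `A`. -/
theorem isDiffDegree_of_chart (hlg : IsLog lg)
    (hA : ∀ (K : Sub k M) (p : Place K.1) (a : A), algebraMap A K.1 a ∈ p.1)
    (hA' : ∀ (p : Place k) (a : A), algebraMap A k a ∈ p.1) :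
    IsDiffDegree lg fun K : Sub k M => diffDeg A k K.1 lg := by
  have hR (K L : Sub k M) (h : K.1 ≤ L.1) :
      chartRam A K.1 (IntermediateField.extendScalars h) =
        Ram K.1 (IntermediateField.extendScalars h) :=
    Set.ext fun p => and_iff_left (hA K p)
  refine ⟨diffDeg_nonneg A hlg, fun K L h => ?_, fun K L h hw => ?_, fun K L h hG => ?_,
    fun K L h => ?_, fun K => ?_, fun K p => two_le_lg_norm_of_chart A hlg K (hA K p),
    hlg.two_pos⟩
  · obtain ⟨-, d, hd, h0, -, -⟩ := chart_sub A hlg h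
    linarith
  · obtain ⟨-, d, hd, h0, h1, -⟩ := chart_sub A hlg h
    rw [← hR]
    linarith [h1 hw]
  · obtain ⟨-, d, hd, h0, -, h1⟩ := chart_sub A hlg h
    rw [← hR]
    linarith [h1 hG]
  · rw [← hR]
    exact (chart_sub A hlg h).1
  · exact (chart_base A hlg K).subset fun p hp => ⟨hp, hA' p⟩

/-- The case of two affine charts `A`, `A'` which together cover the places. -/
theorem isDiffDegree_of_two_charts (A' : Type*) [CommRing A'] [IsDedekindDomain A']
    [Ring.HasFiniteQuotients A'] [Algebra A' k] [IsFractionRing A' k] [Algebra A' M]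
    [IsScalarTower A' k M] (hlg : IsLog lg)
    (hA : ∀ p : Place k, (∀ a : A, algebraMap A k a ∈ p.1) ∨ ∀ a : A', algebraMap A' k a ∈ p.1)
    (hA' : ∀ p : Place k,
      ¬ ((∀ a : A, algebraMap A k a ∈ p.1) ∧ ∀ a : A', algebraMap A' k a ∈ p.1)) :
    IsDiffDegree lg fun K : Sub k M => diffDeg A k K.1 lg + diffDeg A' k K.1 lg := by
  -- The chart of a place is determined by its restriction to `k`, so covering and disjointness need
  -- only be known over `k`.
  have hmem (K : Sub k M) (p : Place K.1) (q : Place k) (hq : p.LiesAbove q) :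
      ((∀ a : A, algebraMap A K.1 a ∈ p.1) ↔ ∀ a : A, algebraMap A k a ∈ q.1) ∧
      ((∀ a : A', algebraMap A' K.1 a ∈ p.1) ↔ ∀ a : A', algebraMap A' k a ∈ q.1) := by
    constructor <;>
    · refine forall_congr' fun a => ?_
      rw [IsScalarTower.algebraMap_apply _ k K.1, hq.mem_iff]
  have hc (K : Sub k M) (p : Place K.1) :
      ((∀ a : A, algebraMap A K.1 a ∈ p.1) ∨ ∀ a : A', algebraMap A' K.1 a ∈ p.1) ∧
      ¬ ((∀ a : A, algebraMap A K.1 a ∈ p.1) ∧ ∀ a : A', algebraMap A' K.1 a ∈ p.1) := by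
    obtain ⟨q, hq⟩ := p.exists_liesAbove_of_isAlgebraic (K := k)
    rw [(hmem K p q hq).1, (hmem K p q hq).2]
    exact ⟨hA q, hA' q⟩
  have hR (K L : Sub k M) (h : K.1 ≤ L.1) :
      Ram K.1 (IntermediateField.extendScalars h) =
      chartRam A K.1 (IntermediateField.extendScalars h) ∪
        chartRam A' K.1 (IntermediateField.extendScalars h) := by
    ext p
    rw [chartRam, chartRam, Set.mem_union, Set.mem_ofPred_eq, Set.mem_ofPred_eq, ← and_or_left]
    exact (and_iff_left (hc K p).1).symm
  have hS (K L : Sub k M) (h : K.1 ≤ L.1) :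
      ∑ᶠ p ∈ Ram K.1 (IntermediateField.extendScalars h), lg p.norm =
      ∑ᶠ p ∈ chartRam A K.1 (IntermediateField.extendScalars h), lg p.norm +
      ∑ᶠ p ∈ chartRam A' K.1 (IntermediateField.extendScalars h), lg p.norm := by
    rw [hR]
    refine finsum_mem_union ?_ (chart_sub A hlg h).1 (chart_sub A' hlg h).1
    exact Set.disjoint_left.2 fun p hp hp' => (hc K p).2 ⟨hp.2, hp'.2⟩
  refine ⟨fun K => add_nonneg (diffDeg_nonneg A hlg K) (diffDeg_nonneg A' hlg K),
    fun K L h => ?_, fun K L h hw => ?_, fun K L h hG => ?_,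
    fun K L h => ?_, fun K => ?_, fun K p => ?_, hlg.two_pos⟩
  · obtain ⟨-, d, hd, h0, -, -⟩ := chart_sub A hlg h
    obtain ⟨-, d', hd', h0', -, -⟩ := chart_sub A' hlg h
    linarith
  · obtain ⟨-, d, hd, h0, h1, -⟩ := chart_sub A hlg h
    obtain ⟨-, d', hd', h0', h1', -⟩ := chart_sub A' hlg h
    rw [hS]
    linarith [h1 hw, h1' hw]
  · obtain ⟨-, d, hd, h0, -, h1⟩ := chart_sub A hlg h
    obtain ⟨-, d', hd', h0', -, h1'⟩ := chart_sub A' hlg h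
    rw [hS]
    linarith [h1 hG, h1' hG]
  · rw [hR]
    exact (chart_sub A hlg h).1.union (chart_sub A' hlg h).1
  · refine ((chart_base A hlg K).union (chart_base A' hlg K)).subset fun p hp => ?_
    exact (hA p).imp (fun h => ⟨hp, h⟩) fun h => ⟨hp, h⟩
  · rcases (hc K p).1 with h | h
    · exact two_le_lg_norm_of_chart A hlg K h
    · exact two_le_lg_norm_of_chart A' hlg K h

end ChartSub

/-! ### From limits of quotients to boundedness and back -/

section Invariants

variable {k M : Type*} [Field k] [Field M] [Algebra k M]

theorem countable_of_isAlgebraic [Countable k] [Algebra.IsAlgebraic k M] : Countable M := by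
  have h := Algebraic.countable k M
  rw [Set.eq_univ_of_forall (s := {x : M | IsAlgebraic k x}) Algebra.IsAlgebraic.isAlgebraic] at h
  exact Set.countable_univ_iff.1 h

/-- If `0 < δ < φ`, then eventually `δ * g ≤ a ≤ n`, so `H ≤ 2 * g + 2 * C * n` is bounded by a
multiple of `n`. Working with `δ` rather than `φ` covers the case `φ = ∞`. -/
theorem IsDiffDegree.bounded_of_hasInvariant {lg : ℝ → ℝ} {H : Sub k M → ℝ}
    (hH : IsDiffDegree lg H) {a : Sub k M → ℕ} {g : Sub k M → ℝ} {C : ℝ}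
    (ha : ∀ K, a K ≤ K.degree) (hg : ∀ K, H K / 2 - C * K.degree ≤ g K)
    {K : ℕ → Sub k M} (hK : IsTower K) {φ : ℝ≥0∞} (hφ : HasInvariant a g φ) (h0 : 0 < φ) :
    DiffBounded H := by
  obtain ⟨δ, hδ0, hδ⟩ := exists_between h0
  have hδt : δ ≠ ⊤ := hδ.ne_top
  have hδr : 0 < δ.toReal := ENNReal.toReal_pos hδ0.ne' hδt
  refine hH.bounded_of_tower hK (C := 2 * (1 / δ.toReal + C)) ?_
  filter_upwards [(hφ K hK).eventually (lt_mem_nhds hδ)] with i hi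
  have hn : (0 : ℝ) < (K i).degree := by exact_mod_cast (K i).degree_pos
  have h1 : δ * ENNReal.ofReal (g (K i)) ≤ ((K i).degree : ℝ≥0∞) :=
    (ENNReal.mul_le_of_le_div hi.le).trans (by exact_mod_cast ha (K i))
  have h2 : δ.toReal * g (K i) ≤ (K i).degree := by
    have h3 := ENNReal.toReal_mono (ENNReal.natCast_ne_top _) h1
    rw [ENNReal.toReal_mul, ENNReal.toReal_natCast, ENNReal.toReal_ofReal'] at h3
    exact (mul_le_mul_of_nonneg_left (le_max_left _ _) hδr.le).trans h3
  have h3 : g (K i) ≤ (K i).degree / δ.toReal := by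
    rw [le_div_iff₀ hδr]
    linarith
  rw [div_le_iff₀ hn]
  have h4 := hg (K i)
  have h5 : 2 * (1 / δ.toReal + C) * (K i).degree =
    2 * ((K i).degree / δ.toReal + C * (K i).degree) := by ring
  linarith

/-- Division in `[0, ∞]` is continuous here because `α > 0` excludes `0 / 0`. The limit is `∞` if `γ
= 0`. -/
theorem hasInvariant_of_tendsto {a : Sub k M → ℕ} {g : Sub k M → ℝ} {α γ : ℝ} (hα : 0 < α)
    (ha : ∀ K : ℕ → Sub k M, IsTower K →
      Tendsto (fun i => (a (K i) : ℝ) / (K i).degree) atTop (𝓝 α))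
    (hg : ∀ K : ℕ → Sub k M, IsTower K →
      Tendsto (fun i => g (K i) / (K i).degree) atTop (𝓝 γ)) :
    ∃ φ : ℝ≥0∞, HasInvariant a g φ ∧ 0 < φ := by
  refine ⟨ENNReal.ofReal α / ENNReal.ofReal γ, fun K hK => ?_,
    ENNReal.div_pos (ENNReal.ofReal_pos.2 hα).ne' ENNReal.ofReal_ne_top⟩
  have h := ENNReal.Tendsto.div (ENNReal.tendsto_ofReal (ha K hK))
    (.inl (ENNReal.ofReal_pos.2 hα).ne') (ENNReal.tendsto_ofReal (hg K hK))
    (.inl ENNReal.ofReal_ne_top)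
  refine h.congr fun i => ?_
  have hn : (0 : ℝ) < (K i).degree := by exact_mod_cast (K i).degree_pos
  rw [ENNReal.ofReal_div_of_pos hn, ENNReal.ofReal_div_of_pos hn, ENNReal.ofReal_natCast,
    ENNReal.ofReal_natCast]
  have hn' : ((K i).degree : ℝ≥0∞) ≠ 0 := by exact_mod_cast (K i).degree_pos.ne'
  rw [div_eq_mul_inv, div_eq_mul_inv _ ((K i).degree : ℝ≥0∞),
    div_eq_mul_inv _ ((K i).degree : ℝ≥0∞), ← div_eq_mul_inv]
  exact ENNReal.mul_div_mul_right _ _ (ENNReal.inv_ne_zero.2 (ENNReal.natCast_ne_top _))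
    (ENNReal.inv_ne_top.2 hn')

end Invariants

/-! ### Number fields -/

section Norm

variable {B : Type*} [CommRing B] [IsDedekindDomain B]

theorem ord_asIdeal (v : HeightOneSpectrum B) : ord v.asIdeal = Finsupp.single v 1 := by
  classical
  ext w
  rw [Finsupp.single_apply]
  split_ifs with h
  · subst h
    rw [ord_apply v.ne_bot, multiplicity_self]
  · by_contra h0
    have h1 : w.asIdeal ∣ v.asIdeal := by
      rw [← pow_one w.asIdeal, ← le_ord_iff v.ne_bot]
      exact Nat.one_le_iff_ne_zero.2 h0
    exact h (HeightOneSpectrum.ext (v.isMaximal.eq_of_le w.isPrime.ne_top (Ideal.le_of_dvd h1)))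

theorem ordDeg_asIdeal (lg : ℝ → ℝ) (v : HeightOneSpectrum B) :
    ordDeg lg v.asIdeal = lg (Nat.card (B ⧸ v.asIdeal)) := by
  rw [ordDeg, ord_asIdeal, Finsupp.sum_single_index] <;> simp

theorem ordDeg_log_eq_log_absNorm [Module.Free ℤ B] [Module.Finite ℤ B] {I : Ideal B} (hI : I ≠ ⊥) :
    ordDeg Real.log I = Real.log I.absNorm := by
  induction I using UniqueFactorizationMonoid.induction_on_prime with
  | h₁ => exact absurd rfl hI
  | h₂ J hJ =>
    rw [Ideal.isUnit_iff.1 hJ, ordDeg_top, Ideal.absNorm_top]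
    simp
  | h₃ J p hJ hp ih =>
    let v : HeightOneSpectrum B := ⟨p, Ideal.isPrime_of_prime hp, hp.ne_zero⟩
    have h := ordDeg_asIdeal Real.log v
    rw [ordDeg_mul _ hp.ne_zero hJ, ih hJ, map_mul, Nat.cast_mul, Real.log_mul, h]
    · congr 2
    · exact Nat.cast_ne_zero.2 (Ideal.absNorm_eq_zero_iff.not.2 hp.ne_zero)
    · exact Nat.cast_ne_zero.2 (Ideal.absNorm_eq_zero_iff.not.2 hJ)

end Norm

section NumberField

/-- Real embeddings of `L` restrict to real embeddings of `K`, and an embedding of `K` has at most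
`[L : K]` extensions to `L`. -/
theorem nrRealPlaces_le (K L : Type*) [Field K] [Field L] [NumberField K] [NumberField L]
    [Algebra K L] : NumberField.InfinitePlace.nrRealPlaces L ≤
      Module.finrank K L * NumberField.InfinitePlace.nrRealPlaces K := by
  classical
  rw [← NumberField.InfinitePlace.card_real_embeddings,
    ← NumberField.InfinitePlace.card_real_embeddings]
  let f (φ : {φ : L →+* ℂ // NumberField.ComplexEmbedding.IsReal φ}) :
      {φ : K →+* ℂ // NumberField.ComplexEmbedding.IsReal φ} :=
    ⟨φ.1.comp (algebraMap K L), φ.2.comp _⟩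
  refine Finset.card_le_mul_card_image_of_maps_to (f := f) (fun _ _ => Finset.mem_univ _) _
    fun ψ _ => ?_
  let : Algebra K ℂ := ψ.1.toAlgebra
  refine le_trans ?_ (card_algHom_le_finrank K L ℂ)
  rw [← Nat.card_eq_finsetCard]
  refine Nat.card_le_card_of_injective (fun φ => (⟨φ.1.1, fun x =>
    congrArg (fun θ => θ.1 x) (Finset.mem_filter.1 φ.2).2⟩ : L →ₐ[K] ℂ)) fun φ φ' h => ?_
  exact Subtype.ext (Subtype.ext (congrArg AlgHom.toRingHom h))

variable {M : Type*} [Field M] [CharZero M]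

/-- The places of `ℚ` are the maximal ideals of `ℤ`, and one that contains a power of a prime `l` is
`(l)`. -/
theorem Place.eq_of_natCast_lt_one {q : ℕ} (hq : IsPrimePow q) {p p' : Place ℚ}
    (h : p.val (q : ℚ) < 1) (h' : p'.val (q : ℚ) < 1) : p = p' := by
  obtain ⟨v, rfl⟩ := exists_ofHeightOne_eq (B := ℤ) ℚ (P := p) fun b => intCast_mem _ b
  obtain ⟨w, rfl⟩ := exists_ofHeightOne_eq (B := ℤ) ℚ (P := p') fun b => intCast_mem _ b
  obtain ⟨l, j, hl, -, rfl⟩ := (isPrimePow_nat_iff _).1 hq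
  have hmem (u : HeightOneSpectrum ℤ) (hu : (ofHeightOne ℚ u).val ((l ^ j : ℕ) : ℚ) < 1) :
      u.asIdeal = Ideal.span {(l : ℤ)} := by
    rw [val_ofHeightOne] at hu
    have h1 : ((l : ℤ) ^ j) ∈ u.asIdeal := by
      rw [← u.valuation_lt_one_iff_mem (K := ℚ)]
      simpa using hu
    have h2 := u.isPrime.mem_of_pow_mem _ h1
    have hm : (Ideal.span {(l : ℤ)}).IsMaximal :=
      PrincipalIdealRing.isMaximal_of_irreducible (Nat.prime_iff_prime_int.1 hl).irreducible
    exact (hm.eq_of_le u.isPrime.ne_top ((Ideal.span_singleton_le_iff_mem _).2 h2)).symm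
  congr 1
  exact HeightOneSpectrum.ext ((hmem v h).trans (hmem w h').symm)

/-- At the archimedean places this is `r₁ + 2 r₂ = n`. The integer `q` vanishes in the residue field
of any place of norm `q`, so these places all lie above one prime of `ℚ`, and at most `n` places do.
-/
theorem nfPhi_le_degree (q : Param) (K : Sub ℚ M) : nfPhi q K ≤ K.degree := by
  have h := NumberField.InfinitePlace.card_add_two_mul_card_eq_rank K.1
  match q with
  | .real => exact le_of_le_of_eq (Nat.le_add_right _ _) h
  | .complex =>
    refine le_of_le_of_eq ?_ h
    change NumberField.InfinitePlace.nrComplexPlaces K.1 ≤ _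
    omega
  | .primePow q hq =>
    change Nat.card {P : Place K.1 // P.norm = q} ≤ Module.finrank ℚ K.1
    rcases isEmpty_or_nonempty {P : Place K.1 // P.norm = q} with he | ⟨⟨P₀⟩⟩
    · simp
    obtain ⟨p₀, hp₀⟩ := P₀.1.exists_liesAbove_of_isAlgebraic (K := ℚ)
    have hval (P : Place K.1) (hP : P.norm = q) (p : Place ℚ) (hp : P.LiesAbove p) :
        p.val (q : ℚ) < 1 := by
      have h1 : ((q : ℕ) : P.ResidueField) = 0 := by
        have : Finite P.ResidueField := Nat.finite_of_card_ne_zero (by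
          change P.norm ≠ 0
          rw [hP]
          exact hq.ne_zero)
        have : Fintype P.ResidueField := Fintype.ofFinite _
        rw [← hP, Place.norm, Nat.card_eq_fintype_card]
        exact Nat.cast_card_eq_zero _
      rw [P.natCast_residueField_eq_zero_iff, ← map_natCast (algebraMap ℚ K.1),
        hp.val_algebraMap] at h1
      by_contra h2
      exact absurd h1 (not_lt.2 (one_le_pow₀ (not_lt.1 h2)))
    have hsub : {P : Place K.1 | P.norm = q} ⊆ {P | P.LiesAbove p₀} := by
      intro P hP
      obtain ⟨p, hp⟩ := P.exists_liesAbove_of_isAlgebraic (K := ℚ)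
      rwa [Set.mem_ofPred_eq, Place.eq_of_natCast_lt_one hq (hval _ P₀.2 _ hp₀) (hval P hP p hp)]
    have h2 := (Set.encard_le_encard hsub).trans (p₀.exists_liesAbove_and_encard_le K.1).2
    have h3 : (Set.ncard {P : Place K.1 | P.norm = q}) ≤ Module.finrank ℚ K.1 := by
      rw [Set.ncard_def]
      exact ENat.toNat_le_of_le_natCast h2
    exact h3

/-- The absolute norm of the different is the absolute value of the discriminant. -/
theorem diffDeg_eq_two_mul_nfGenus [Algebra.IsAlgebraic ℚ M] (K : Sub ℚ M) :
    diffDeg ℤ ℚ K.1 Real.log = 2 * nfGenus K := by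
  have : IsDedekindDomain (integralClosure ℤ K.1) := integralClosure.isDedekindDomain ℤ ℚ K.1
  have : IsFractionRing (integralClosure ℤ K.1) K.1 :=
    integralClosure.isFractionRing_of_finite_extension ℚ K.1
  have : Module.Finite ℤ (integralClosure ℤ K.1) :=
    IsIntegralClosure.finite ℤ ℚ K.1 (integralClosure ℤ K.1)
  have h := NumberField.absNorm_differentIdeal K.1 (integralClosure ℤ K.1)
  have h0 : (NumberField.discr K.1).natAbs ≠ 0 :=
    Int.natAbs_ne_zero.2 (NumberField.discr_ne_zero K.1)
  have hb : differentIdeal ℤ (integralClosure ℤ K.1) ≠ ⊥ := by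
    intro hb
    rw [hb, Ideal.absNorm_bot] at h
    exact h0 h.symm
  have h2 := ordDeg_log_eq_log_absNorm hb
  rw [h] at h2
  rw [diffDeg, h2, nfGenus, Nat.cast_natAbs]
  push_cast
  ring

theorem isDiffDegree_nf [Algebra.IsAlgebraic ℚ M] :
    IsDiffDegree Real.log fun K : Sub ℚ M => 2 * nfGenus K := by
  have h := isDiffDegree_of_chart (M := M) (k := ℚ) ℤ isLog_log
    (fun K p a => intCast_mem _ a) fun p a => intCast_mem _ a
  convert! h using 2 with K
  exact (diffDeg_eq_two_mul_nfGenus K).symm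

theorem asymptoticallyGood_iff [Algebra.IsAlgebraic ℚ M] (hM : ¬ FiniteDimensional ℚ M) :
    AsymptoticallyGood M ↔ DiffBounded fun K : Sub ℚ M => 2 * nfGenus K := by
  constructor
  · rintro ⟨q, φ, hφ, h0⟩
    have := countable_of_isAlgebraic (k := ℚ) (M := M)
    obtain ⟨K, hK⟩ := exists_isTower hM
    exact isDiffDegree_nf.bounded_of_hasInvariant (C := 0) (nfPhi_le_degree q)
      (fun K => by simp) hK hφ h0
  intro hb
  rw [diffBounded_iff] at hb
  have hg (K : ℕ → Sub ℚ M) (hK : IsTower K) := (tendsto_iSup_of_isTower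
    (fun K L h => isDiffDegree_nf.div_mono h) hb hK).div_const 2
  -- The sign turns the decreasing proportion of real places into an increasing quantity.
  let x (K : Sub ℚ M) : ℝ := - (nfPhi .real K / K.degree)
  have hx (K L : Sub ℚ M) (h : K.1 ≤ L.1) : x K ≤ x L := by
    have : NumberField (IntermediateField.extendScalars h) :=
      inferInstanceAs (NumberField L.1)
    have h1 : nfPhi .real L ≤ relDegree h * nfPhi .real K :=
      nrRealPlaces_le K.1 (IntermediateField.extendScalars h)
    have h2 : (nfPhi .real L : ℝ) ≤ relDegree h * nfPhi .real K := by exact_mod_cast h1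
    have hK : (0 : ℝ) < K.degree := by exact_mod_cast K.degree_pos
    have hr : (0 : ℝ) < relDegree h := by exact_mod_cast relDegree_pos h
    refine neg_le_neg ?_
    rw [Sub.degree_mul h, Nat.cast_mul, div_le_div_iff₀ (by positivity) hK]
    nlinarith
  have hxb : BddAbove (Set.range x) := by
    refine ⟨0, ?_⟩
    rintro _ ⟨K, rfl⟩
    exact neg_nonpos.2 (by positivity)
  have hxl (K : ℕ → Sub ℚ M) (hK : IsTower K) := tendsto_iSup_of_isTower hx hxb hK
  have hg' (K : ℕ → Sub ℚ M) (hK : IsTower K) :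
      Tendsto (fun i => nfGenus (K i) / (K i).degree) atTop _ :=
    (hg K hK).congr fun i => by ring
  -- Either `r₁ / n` has a positive limit, or it tends to `0` and `r₂ / n` tends to `1 / 2`.
  by_cases hpos : ⨆ K, x K < 0
  · refine ⟨.real, hasInvariant_of_tendsto (neg_pos.2 hpos) (fun K hK => ?_) hg'⟩
    exact (hxl K hK).neg.congr fun i => neg_neg _
  · have h0 : ⨆ K, x K = 0 := le_antisymm (Real.iSup_nonpos fun K =>
      neg_nonpos.2 (by positivity)) (not_lt.1 hpos)
    refine ⟨.complex, hasInvariant_of_tendsto (α := 1 / 2) (by norm_num) (fun K hK => ?_) hg'⟩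
    have h1 := ((hxl K hK).const_add 1).div_const 2
    rw [h0, add_zero] at h1
    refine h1.congr fun i => ?_
    have h2 := NumberField.InfinitePlace.card_add_two_mul_card_eq_rank (K i).1
    have h3 : (nfPhi .real (K i) : ℝ) + 2 * nfPhi .complex (K i) = (K i).degree := by
      exact_mod_cast h2
    have hn : (0 : ℝ) < (K i).degree := by exact_mod_cast (K i).degree_pos
    simp only [x]
    rw [← h3] at hn ⊢
    field_simp
    ring

end NumberField

/-! ### The field of rational functions and its two charts -/

open Polynomial

section Polynomials

variable (F : Type*) [Field F] [Finite F]

theorem one_lt_natCard : (1 : ℝ) < (Nat.card F : ℝ) := by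
  exact_mod_cast (Finite.one_lt_card : 1 < Nat.card F)

theorem logb_natCard_eq_finrank (V : Type*) [AddCommGroup V] [Module F V]
    [FiniteDimensional F V] : Real.logb (Nat.card F) (Nat.card V) = Module.finrank F V := by
  rw [Module.natCard_eq_pow_finrank (K := F) (V := V), Nat.cast_pow, Real.logb_pow,
    Real.logb_self_eq_one, mul_one]
  exact one_lt_natCard F

instance : Ring.HasFiniteQuotients F[X] where
  finiteQuotient {I} hI := by
    obtain ⟨p, rfl⟩ := (IsPrincipalIdealRing.principal I).principal
    have hp : p ≠ 0 := by
      rintro rfl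
      simp at hI
    have : Module.Finite F (AdjoinRoot p) := (AdjoinRoot.powerBasis hp).finite
    exact (Module.finite_of_finite F : Finite (AdjoinRoot p))

variable {F} in
theorem ordDeg_span_polynomial {p : F[X]} (hp : p ≠ 0) :
    ordDeg (Real.logb (Nat.card F)) (Ideal.span {p}) = p.natDegree := by
  induction p using UniqueFactorizationMonoid.induction_on_prime with
  | h₁ => exact absurd rfl hp
  | h₂ p hu => rw [Ideal.span_singleton_eq_top.2 hu, ordDeg_top, natDegree_eq_zero_of_isUnit hu,
      Nat.cast_zero]
  | h₃ p l hp' hl ih =>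
    let v : HeightOneSpectrum F[X] := ⟨Ideal.span {l}, (Ideal.span_singleton_prime hl.ne_zero).2 hl,
      by simpa using hl.ne_zero⟩
    have h := ordDeg_asIdeal (Real.logb (Nat.card F)) v
    have : Module.Finite F (AdjoinRoot l) := (AdjoinRoot.powerBasis hl.ne_zero).finite
    have h2 := logb_natCard_eq_finrank F (AdjoinRoot l)
    rw [(AdjoinRoot.powerBasis hl.ne_zero).finrank, AdjoinRoot.powerBasis_dim] at h2
    rw [← Ideal.span_singleton_mul_span_singleton, ordDeg_mul, ih hp', natDegree_mul hl.ne_zero hp',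
      Nat.cast_add, ← h2]
    · exact congrArg (· + _) h
    · simpa using hl.ne_zero
    · simpa using hp'

end Polynomials

section Infinity

variable (F : Type*) [Field F]

open Classical in
/-- The valuation ring of the place at infinity of the field of rational functions. -/
def inftyRing : ValuationSubring (RatFunc F) := (RatFunc.inftyValuation F).valuationSubring

variable {F}

theorem mem_inftyRing {x : RatFunc F} : x ∈ inftyRing F ↔ x.intDegree ≤ 0 := by
  classical
  rw [inftyRing, Valuation.mem_valuationSubring_iff, RatFunc.inftyValuation_apply]
  rcases eq_or_ne x 0 with rfl | hx
  · simp [RatFunc.inftyValuationDef]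
  · rw [RatFunc.inftyValuation_of_nonzero F hx, ← WithZero.exp_zero, WithZero.exp_le_exp]

theorem intDegree_X_zpow (m : ℤ) : (RatFunc.X ^ m : RatFunc F).intDegree = m := by
  classical
  have h := RatFunc.inftyValuation.X_zpow F m
  rw [RatFunc.inftyValuation_apply,
    RatFunc.inftyValuation_of_nonzero F (zpow_ne_zero _ RatFunc.X_ne_zero)] at h
  exact WithZero.exp_injective h

theorem mul_X_zpow_mem_iff {x : RatFunc F} (hx : x ≠ 0) {m : ℤ} :
    x * RatFunc.X ^ m ∈ inftyRing F ↔ x.intDegree + m ≤ 0 := by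
  rw [mem_inftyRing, RatFunc.intDegree_mul hx (zpow_ne_zero _ RatFunc.X_ne_zero),
    intDegree_X_zpow]

theorem X_zpow_mem_iff {m : ℤ} : (RatFunc.X ^ m : RatFunc F) ∈ inftyRing F ↔ m ≤ 0 := by
  rw [mem_inftyRing, intDegree_X_zpow]

theorem algebraMap_mul_X_zpow_mem_iff {p : F[X]} {m : ℕ} {e : ℤ} (he : e = -m) :
    algebraMap F[X] (RatFunc F) p * RatFunc.X ^ e ∈ inftyRing F ↔ p.natDegree ≤ m := by
  subst he
  rcases eq_or_ne p 0 with rfl | hp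
  · simp
  · rw [mul_X_zpow_mem_iff (by simpa using hp), RatFunc.intDegree_polynomial]
    omega

theorem C_mem_inftyRing (c : F) : RatFunc.C c ∈ inftyRing F := by
  rw [mem_inftyRing, RatFunc.intDegree_C]

theorem eq_zero_of_C_mul_X_mem {c : F} (h : RatFunc.C c * RatFunc.X ∈ inftyRing F) : c = 0 := by
  by_contra hc
  rw [mem_inftyRing, RatFunc.intDegree_mul (by simpa using hc) RatFunc.X_ne_zero,
    RatFunc.intDegree_C, RatFunc.intDegree_X] at h
  omega

/-- The residue field at infinity is `F`. As the denominator is monic, the value of `x` at infinity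
is the coefficient of the numerator in the degree of the denominator. -/
theorem exists_sub_C_mul_X_mem {x : RatFunc F} (hx : x ∈ inftyRing F) :
    ∃ c : F, (x - RatFunc.C c) * RatFunc.X ∈ inftyRing F := by
  have hd := x.denom_ne_zero
  have hd' : algebraMap F[X] (RatFunc F) x.denom ≠ 0 := by simpa using hd
  rw [mem_inftyRing, RatFunc.intDegree] at hx
  refine ⟨x.num.coeff x.denom.natDegree, ?_⟩
  set c := x.num.coeff x.denom.natDegree
  have hsub : x - RatFunc.C c =
      algebraMap F[X] (RatFunc F) (x.num - C c * x.denom) / algebraMap F[X] (RatFunc F) x.denom := by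
    rw [eq_div_iff hd', sub_mul, map_sub, map_mul, RatFunc.algebraMap_C]
    congr 1
    exact (div_eq_iff hd').1 (RatFunc.num_div_denom x) |>.symm
  rcases eq_or_ne (x.num - C c * x.denom) 0 with h0 | h0
  · rw [hsub, h0]
    simp
  · have h0' : algebraMap F[X] (RatFunc F) (x.num - C c * x.denom) ≠ 0 := by
      rwa [ne_eq, FaithfulSMul.algebraMap_eq_zero_iff]
    have hlt : (x.num - C c * x.denom).natDegree < x.denom.natDegree := by
      have hle : (x.num - C c * x.denom).natDegree ≤ x.denom.natDegree := by
        refine (natDegree_sub_le _ _).trans (max_le (by omega) (natDegree_C_mul_le _ _))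
      refine lt_of_le_of_ne hle fun he => ?_
      have hc : (x.num - C c * x.denom).coeff x.denom.natDegree = 0 := by
        rw [coeff_sub, coeff_C_mul, coeff_natDegree, (x.monic_denom).leadingCoeff, mul_one, sub_self]
      rw [← he, coeff_natDegree, leadingCoeff_eq_zero] at hc
      exact h0 hc
    rw [mem_inftyRing, RatFunc.intDegree_mul _ RatFunc.X_ne_zero, RatFunc.intDegree_X, hsub,
      RatFunc.intDegree_div h0' hd', RatFunc.intDegree_polynomial,
      RatFunc.intDegree_polynomial]
    · omega
    · rw [hsub]
      exact div_ne_zero h0' hd'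

instance : IsDiscreteValuationRing (inftyRing F) := by
  refine Place.isDiscreteValuationRing_of_ne_top _ fun h => ?_
  have h1 : (RatFunc.X : RatFunc F) ∈ inftyRing F := by
    rw [inftyRing, h]
    trivial
  rw [mem_inftyRing, RatFunc.intDegree_X] at h1
  omega

variable (F) in
/-- The uniformizer `1 / X` at infinity. -/
def inftyUnif : inftyRing F := ⟨RatFunc.X ^ (-1 : ℤ), X_zpow_mem_iff.2 (by norm_num)⟩

theorem inftyUnif_ne_zero : inftyUnif F ≠ 0 := fun h =>
  have h' : (RatFunc.X ^ (-1 : ℤ) : RatFunc F) = 0 := congrArg Subtype.val h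
  zpow_ne_zero _ RatFunc.X_ne_zero h'

theorem mem_span_inftyUnif {x : inftyRing F} :
    x ∈ Ideal.span {inftyUnif F} ↔ (x : RatFunc F) * RatFunc.X ∈ inftyRing F := by
  rw [Ideal.mem_span_singleton]
  constructor
  · rintro ⟨y, rfl⟩
    have hX : (RatFunc.X : RatFunc F) ≠ 0 := RatFunc.X_ne_zero
    have : ((inftyUnif F * y : inftyRing F) : RatFunc F) * (RatFunc.X : RatFunc F) = y := by
      change (RatFunc.X : RatFunc F) ^ (-1 : ℤ) * (y : RatFunc F) * (RatFunc.X : RatFunc F) = y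
      rw [zpow_neg_one]
      field_simp
    rw [this]
    exact y.2
  · intro h
    have hX : (RatFunc.X : RatFunc F) ≠ 0 := RatFunc.X_ne_zero
    refine ⟨⟨_, h⟩, Subtype.ext ?_⟩
    change (x : RatFunc F) = RatFunc.X ^ (-1 : ℤ) * ((x : RatFunc F) * RatFunc.X)
    rw [zpow_neg_one]
    field_simp

theorem bijective_residue_infty : Function.Bijective
    ((Ideal.Quotient.mk (Ideal.span {inftyUnif F})).comp
      ((RatFunc.C (K := F)).codRestrict (inftyRing F).toSubring C_mem_inftyRing)) := by
  constructor
  · rw [injective_iff_map_eq_zero]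
    intro c hc
    rw [RingHom.comp_apply, Ideal.Quotient.eq_zero_iff_mem, mem_span_inftyUnif] at hc
    exact eq_zero_of_C_mul_X_mem hc
  · intro y
    obtain ⟨x, rfl⟩ := Ideal.Quotient.mk_surjective y
    obtain ⟨c, hc⟩ := exists_sub_C_mul_X_mem x.2
    refine ⟨c, (Ideal.Quotient.eq.2 ?_).symm⟩
    rw [mem_span_inftyUnif]
    exact hc

theorem isMaximal_span_inftyUnif : (Ideal.span {inftyUnif F}).IsMaximal :=
  Ideal.Quotient.maximal_of_isField _
    ((RingEquiv.ofBijective _ (bijective_residue_infty (F := F))).symm.toMulEquiv.isField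
      (Field.toIsField F))

theorem natCard_quotient_inftyUnif :
    Nat.card (inftyRing F ⧸ Ideal.span {inftyUnif F}) = Nat.card F :=
  (Nat.card_congr (Equiv.ofBijective _ (bijective_residue_infty (F := F)))).symm

instance [Finite F] : Ring.HasFiniteQuotients (inftyRing F) where
  finiteQuotient {I} hI := by
    have hm : Ideal.span {inftyUnif F} = IsLocalRing.maximalIdeal (inftyRing F) :=
      IsLocalRing.eq_maximalIdeal isMaximal_span_inftyUnif
    have hirr : Irreducible (inftyUnif F) :=
      (IsDiscreteValuationRing.irreducible_iff_uniformizer _).2 hm.symm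
    obtain ⟨j, rfl⟩ := IsDiscreteValuationRing.ideal_eq_span_pow_irreducible hI hirr
    have : Finite (inftyRing F ⧸ Ideal.span {inftyUnif F}) :=
      Finite.of_equiv F (Equiv.ofBijective _ (bijective_residue_infty (F := F)))
    rw [← Ideal.span_singleton_pow]
    exact Ideal.finite_quotient_pow (Submodule.fg_span_singleton _) j

theorem ordDeg_span_inftyUnif [Finite F] :
    ordDeg (Real.logb (Nat.card F)) (Ideal.span {inftyUnif F}) = 1 := by
  let v : HeightOneSpectrum (inftyRing F) := ⟨Ideal.span {inftyUnif F},
    isMaximal_span_inftyUnif.isPrime, by simpa using inftyUnif_ne_zero⟩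
  refine (ordDeg_asIdeal (Real.logb (Nat.card F)) v).trans ?_
  change Real.logb _ (Nat.card (inftyRing F ⧸ Ideal.span {inftyUnif F})) = 1
  rw [natCard_quotient_inftyUnif, Real.logb_self_eq_one (one_lt_natCard F)]

variable [Finite F]

/-- If `X` is not integral at `P`, the valuation of a nonzero function is that of `X` to the power
of its degree, so `P` is the place at infinity. -/
theorem Place.chart_or (P : Place (RatFunc F)) :
    (∀ a : F[X], algebraMap F[X] (RatFunc F) a ∈ P.1) ∨
      ∀ a : inftyRing F, algebraMap (inftyRing F) (RatFunc F) a ∈ P.1 := by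
  by_cases hX : RatFunc.X ∈ P.1
  · left
    intro a
    induction a using Polynomial.induction_on' with
    | add p q hp hq =>
      rw [map_add]
      exact add_mem hp hq
    | monomial n c =>
      rw [← C_mul_X_pow_eq_monomial, map_mul, map_pow, RatFunc.algebraMap_X, RatFunc.algebraMap_C]
      exact mul_mem (P.algebraMap_mem c) (pow_mem hX n)
  · right
    intro a
    have ht : P.val.IsTrivialOn F := ⟨fun c hc => by
      have h1 := P.val_le_one_iff.2 (P.algebraMap_mem c)
      have h2 := P.val_le_one_iff.2 (P.algebraMap_mem c⁻¹)
      rw [map_inv₀, map_inv₀] at h2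
      refine le_antisymm h1 ?_
      exact (inv_le_one₀ (by simpa [zero_lt_iff] using hc)).1 h2⟩
    rw [← P.val_le_one_iff, not_le] at hX
    rw [← P.val_le_one_iff]
    change P.val (a : RatFunc F) ≤ 1
    rcases eq_or_ne (a : RatFunc F) 0 with h0 | h0
    · rw [h0, map_zero]
      exact zero_le
    · rw [RatFunc.valuation_eq_valuation_X_zpow_intDegree_of_one_lt_valuation_X hX h0]
      exact zpow_le_one_of_nonpos₀ hX.le (mem_inftyRing.1 a.2)

/-- Every rational function is a power of `X` times a function regular at infinity, so no proper
subring contains both rings. -/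
theorem Place.not_chart_and (P : Place (RatFunc F)) :
    ¬ ((∀ a : F[X], algebraMap F[X] (RatFunc F) a ∈ P.1) ∧
      ∀ a : inftyRing F, algebraMap (inftyRing F) (RatFunc F) a ∈ P.1) := by
  rintro ⟨h1, h2⟩
  have hX : RatFunc.X ∈ P.1 := RatFunc.algebraMap_X (K := F) ▸ h1 X
  apply P.ne_top
  rw [eq_top_iff]
  intro x _
  rcases eq_or_ne x 0 with rfl | h0
  · exact zero_mem _
  have h3 : x = x * RatFunc.X ^ (-(x.intDegree.toNat : ℤ)) * RatFunc.X ^ x.intDegree.toNat := by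
    rw [zpow_neg, zpow_natCast, mul_assoc, inv_mul_cancel₀ (pow_ne_zero _ RatFunc.X_ne_zero),
      mul_one]
  rw [h3]
  refine mul_mem (h2 ⟨_, (mul_X_zpow_mem_iff h0).2 ?_⟩) (pow_mem hX _)
  have := Int.self_le_toNat x.intDegree
  omega

end Infinity

/-! ### Bases adapted to the finite and the infinite places -/

section ReducedBasis

variable {F K : Type*} [Field F] [Field K] [Algebra (RatFunc F) K] [Algebra F[X] K]
  [IsScalarTower F[X] (RatFunc F) K] [FiniteDimensional (RatFunc F) K]

/-- A function regular at the finite places and vanishing at those above infinity is zero. Otherwise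
its norm to `F(X)` would be a nonzero polynomial of degree at most `-[K : F(X)]`. -/
theorem eq_zero_of_isIntegral_X_smul {x : K} (hx : IsIntegral F[X] x)
    (hx' : IsIntegral (inftyRing F) ((RatFunc.X : RatFunc F) • x)) : x = 0 := by
  have h1 := Algebra.isIntegral_norm (RatFunc F) hx
  have h2 := Algebra.isIntegral_norm (RatFunc F) hx'
  rw [Algebra.smul_def, map_mul, Algebra.norm_algebraMap] at h2
  obtain ⟨p, hp⟩ := IsIntegrallyClosed.isIntegral_iff.1 h1
  obtain ⟨y, hy⟩ := IsIntegrallyClosed.isIntegral_iff.1 h2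
  by_contra h0
  have hN : Algebra.norm (RatFunc F) x ≠ 0 := Algebra.norm_ne_zero_iff.2 h0
  have h3 : Algebra.norm (RatFunc F) x * RatFunc.X ^ (Module.finrank (RatFunc F) K : ℤ)
      ∈ inftyRing F := by
    rw [zpow_natCast, mul_comm, ← hy]
    exact y.2
  rw [mul_X_zpow_mem_iff hN, ← hp, RatFunc.intDegree_polynomial] at h3
  have : 0 < Module.finrank (RatFunc F) K := Module.finrank_pos
  omega

theorem IsIntegral.smul_of_mem {x : K} (hx : IsIntegral (inftyRing F) x) {r : RatFunc F}
    (hr : r ∈ inftyRing F) : IsIntegral (inftyRing F) (r • x) :=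
  hx.smul (⟨r, hr⟩ : inftyRing F)

theorem exists_isIntegral_X_zpow_smul (x : K) :
    ∃ m : ℕ, IsIntegral (inftyRing F) ((RatFunc.X : RatFunc F) ^ (-m : ℤ) • x) := by
  have : Algebra.IsAlgebraic (inftyRing F) K :=
    (IsFractionRing.comap_isAlgebraic_iff (A := inftyRing F) (K := RatFunc F) (C := K)).2
      inferInstance
  obtain ⟨y, hy0, hy⟩ :=
    (Algebra.IsAlgebraic.isAlgebraic (R := inftyRing F) x).exists_integral_multiple
  have hy0' : (y : RatFunc F) ≠ 0 := fun h => hy0 (Subtype.ext h)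
  refine ⟨(-(y : RatFunc F).intDegree).toNat, ?_⟩
  have h := IsIntegral.smul_of_mem hy (r := (y : RatFunc F)⁻¹ *
    RatFunc.X ^ (-((-(y : RatFunc F).intDegree).toNat : ℤ))) (by
      rw [mul_X_zpow_mem_iff (inv_ne_zero hy0'), RatFunc.intDegree_inv]
      have := Int.self_le_toNat (-(y : RatFunc F).intDegree)
      omega)
  convert h using 1
  change _ = _ • (y : RatFunc F) • x
  rw [smul_smul]
  congr 1
  field_simp

variable [Algebra.IsSeparable (RatFunc F) K]

-- This is lattice reduction: among the integral bases with `X ^ (-a i) • b i` integral at infinity,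
-- take one with `∑ a i` minimal. The last property says that these elements are linearly
-- independent over `F` modulo `1 / X`. A relation between them would allow some `a j` to be
-- lowered.
open Module in
theorem exists_reduced_integral_basis : ∃ (ι : Type) (_ : Fintype ι)
    (b : Basis ι F[X] (integralClosure F[X] K)) (a : ι → ℕ),
    (∀ i, IsIntegral (inftyRing F) ((RatFunc.X : RatFunc F) ^ (-a i : ℤ) • (b i : K))) ∧
    ∀ c : ι → F, IsIntegral (inftyRing F) ((RatFunc.X : RatFunc F) •
      ∑ i, (RatFunc.C (c i) * RatFunc.X ^ (-a i : ℤ)) • (b i : K)) → c = 0 := by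
  classical
  have : Module.Finite F[X] (integralClosure F[X] K) :=
    IsIntegralClosure.finite F[X] (RatFunc F) K (integralClosure F[X] K)
  have : Module.IsTorsionFree F[X] K := .trans_faithfulSMul F[X] (RatFunc F) K
  let ι := Fin (finrank F[X] (integralClosure F[X] K))
  let T := {t : Basis ι F[X] (integralClosure F[X] K) × (ι → ℕ) //
    ∀ i, IsIntegral (inftyRing F) ((RatFunc.X : RatFunc F) ^ (-t.2 i : ℤ) • (t.1 i : K))}
  have hT : Nonempty T := by
    let b := finBasis F[X] (integralClosure F[X] K)
    choose a ha using fun i => exists_isIntegral_X_zpow_smul (F := F) (b i : K)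
    exact ⟨⟨(b, a), ha⟩⟩
  let size (t : T) : ℕ := ∑ i, t.1.2 i
  obtain ⟨⟨⟨b, a⟩, hba⟩, hmin⟩ : ∃ t : T, ∀ t', size t ≤ size t' :=
    ⟨Function.argmin size, fun t' => Function.argmin_le size t'⟩
  refine ⟨ι, inferInstance, b, a, hba, fun c hc => ?_⟩
  by_contra hne
  obtain ⟨i₀, hi₀⟩ := Function.ne_iff.1 hne
  -- With `a j` maximal among the indices in the relation, multiplying the relation by `X ^ a j / c
  -- j` makes all coefficients `d i` polynomials.
  obtain ⟨j, hj, hjmax⟩ := Finset.exists_max_image (Finset.univ.filter fun i => c i ≠ 0) a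
    ⟨i₀, by simpa using hi₀⟩
  have hcj : c j ≠ 0 := by simpa using hj
  let d (i : ι) : F[X] := C ((c j)⁻¹ * c i) * X ^ (a j - a i)
  have hd (i : ι) : algebraMap F[X] (RatFunc F) (d i) =
      RatFunc.C (c j)⁻¹ * RatFunc.X ^ (a j : ℤ) * (RatFunc.C (c i) * RatFunc.X ^ (-a i : ℤ)) := by
    by_cases hci : c i = 0
    · simp [d, hci]
    · have hle : a i ≤ a j := hjmax i (by simpa using hci)
      have hX : (RatFunc.X : RatFunc F) ^ (a j - a i) =
          RatFunc.X ^ (a j : ℤ) * RatFunc.X ^ (-a i : ℤ) := by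
        rw [← zpow_add₀ RatFunc.X_ne_zero, ← zpow_natCast]
        congr 1
        omega
      simp only [d, map_mul, map_pow, RatFunc.algebraMap_X, RatFunc.algebraMap_C, hX]
      ring
  have hdj : d j = 1 := by
    simp only [d, inv_mul_cancel₀ hcj, Nat.sub_self, pow_zero, map_one, mul_one]
  -- As `d j = 1`, replacing `b j` by `∑ d i • b i` is a transvection and gives a basis again.
  let u : integralClosure F[X] K := ∑ i, d i • b i - b j
  have hu : b.coord j u = 0 := by
    simp only [u, Basis.coord_apply, map_sub, map_sum, map_smul, Basis.repr_self,
      Finsupp.single_apply, smul_eq_mul, mul_ite,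
      mul_one, mul_zero, if_true]
    rw [Finset.sum_ite_eq' Finset.univ j d, if_pos (Finset.mem_univ j), hdj, sub_self]
  let b' := b.map (LinearEquiv.transvection hu)
  have hb' (i : ι) : b' i = b i + b.coord j (b i) • u := rfl
  have hb'j : b' j = ∑ i, d i • b i := by
    rw [hb']
    simp [u]
  have hb'i (i : ι) (hi : i ≠ j) : b' i = b i := by
    rw [hb']
    simp [hi]
  have hKj : (b' j : K) = ((RatFunc.C (c j)⁻¹ : RatFunc F) * RatFunc.X ^ (a j : ℤ)) •
      ∑ i, (RatFunc.C (c i) * RatFunc.X ^ (-a i : ℤ)) • (b i : K) := by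
    rw [hb'j, Finset.smul_sum, AddSubmonoidClass.coe_finsetSum]
    refine Finset.sum_congr rfl fun i _ => ?_
    rw [smul_smul, ← hd, algebraMap_smul]
    rfl
  have hinf : IsIntegral (inftyRing F)
      ((RatFunc.X : RatFunc F) ^ (1 - a j : ℤ) • (b' j : K)) := by
    have h := IsIntegral.smul_of_mem hc (C_mem_inftyRing (c j)⁻¹)
    convert h using 1
    rw [hKj, smul_smul, smul_smul]
    congr 1
    rw [mul_left_comm, ← zpow_add₀ RatFunc.X_ne_zero, sub_add_cancel, zpow_one]
  -- If `a j = 0` the exponent cannot be lowered in `ℕ`, but then the new basis vector would vanish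
  -- at infinity and so be zero.
  rcases Nat.eq_zero_or_pos (a j) with h0 | hpos
  · rw [h0, Nat.cast_zero, sub_zero, zpow_one] at hinf
    have h1 := eq_zero_of_isIntegral_X_smul (b' j).2 hinf
    exact b'.ne_zero j (Subtype.ext h1)
  · let a' := Function.update a j (a j - 1)
    have ha' (i : ι) : IsIntegral (inftyRing F)
        ((RatFunc.X : RatFunc F) ^ (-a' i : ℤ) • (b' i : K)) := by
      by_cases hi : i = j
      · subst hi
        convert hinf using 3
        simp only [a', Function.update_self]
        omega
      · rw [hb'i i hi]
        simp only [a', Function.update_of_ne hi]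
        exact hba i
    have hle := hmin ⟨(b', a'), ha'⟩
    refine absurd hle (not_le.2 (Finset.sum_lt_sum (fun i _ => ?_) ⟨j, Finset.mem_univ j, ?_⟩))
    · change a' i ≤ a i
      by_cases hi : i = j
      · subst hi
        simp [a']
      · simp [a', hi]
    · change a' j < a j
      simp only [a', Function.update_self]
      omega

open Module in
/-- The existence of bases that are integral bases over the polynomials and, up to powers of `X`,
over the valuation ring at infinity. -/
theorem exists_reduced_basis : ∃ (ι : Type) (_ : Fintype ι) (b : Basis ι (RatFunc F) K)
    (a : ι → ℕ),
    (∀ x, IsIntegral F[X] x ↔ ∀ i, b.repr x i ∈ (algebraMap F[X] (RatFunc F)).range) ∧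
    ∀ x, IsIntegral (inftyRing F) x ↔ ∀ i, b.repr x i * RatFunc.X ^ (a i : ℤ) ∈ inftyRing F := by
  obtain ⟨ι, _, β, a, ha, hred⟩ := exists_reduced_integral_basis (F := F) (K := K)
  have : IsLocalization (Algebra.algebraMapSubmonoid (integralClosure F[X] K)
      (nonZeroDivisors F[X])) K :=
    IsIntegralClosure.isLocalization_of_isSeparable F[X] (RatFunc F) K (integralClosure F[X] K)
  let b := β.localizationLocalization (RatFunc F) (nonZeroDivisors F[X]) K
  have hb (i : ι) : b i = (β i : K) := β.localizationLocalization_apply _ _ _ i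
  have hX : (RatFunc.X : RatFunc F) ≠ 0 := RatFunc.X_ne_zero
  refine ⟨ι, ‹_›, b, a, fun x => ⟨fun hx i => ?_, fun hx => ?_⟩, fun x => ⟨fun hx => ?_,
    fun hx => ?_⟩⟩
  · exact ⟨β.repr ⟨x, hx⟩ i,
      (β.localizationLocalization_repr_algebraMap (RatFunc F) (nonZeroDivisors F[X]) K ⟨x, hx⟩
        i).symm⟩
  · rw [← b.sum_repr x]
    refine IsIntegral.sum _ fun i _ => ?_
    obtain ⟨p, hp⟩ := hx i
    rw [← hp, hb, algebraMap_smul]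
    exact (β i).2.smul p
  -- If the maximal degree `m` of the `f i` were positive, `X ^ (1 - m) • x` would still be integral
  -- at infinity. The values `c i` of `f i * X ^ (-m)` at infinity would then form a relation
  -- excluded by reducedness, with `c j ≠ 0`.
  · let f (i : ι) : RatFunc F := b.repr x i * RatFunc.X ^ (a i : ℤ)
    by_contra hne
    push Not at hne
    obtain ⟨i₀, hi₀⟩ := hne
    obtain ⟨j, -, hj⟩ := Finset.exists_max_image Finset.univ (fun i => (f i).intDegree)
      ⟨i₀, Finset.mem_univ _⟩
    set m := (f j).intDegree with hm
    have hpos : 0 < m := by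
      rw [mem_inftyRing, not_le] at hi₀
      exact hi₀.trans_le (hj i₀ (Finset.mem_univ _))
    have hmem (i : ι) : f i * RatFunc.X ^ (-m) ∈ inftyRing F := by
      rcases eq_or_ne (f i) 0 with h | h
      · rw [h, zero_mul]
        exact zero_mem _
      · rw [mul_X_zpow_mem_iff h]
        have := hj i (Finset.mem_univ _)
        omega
    choose c hc using fun i => exists_sub_C_mul_X_mem (hmem i)
    have hsum : (RatFunc.X : RatFunc F) •
        ∑ i, (RatFunc.C (c i) * RatFunc.X ^ (-a i : ℤ)) • (β i : K) =
        (RatFunc.X : RatFunc F) ^ (1 - m) • x - ∑ i, ((f i * RatFunc.X ^ (-m) - RatFunc.C (c i)) *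
          RatFunc.X) • (RatFunc.X : RatFunc F) ^ (-a i : ℤ) • (β i : K) := by
      rw [eq_sub_iff_add_eq]
      conv_rhs => rw [← b.sum_repr x]
      rw [Finset.smul_sum, Finset.smul_sum, ← Finset.sum_add_distrib]
      refine Finset.sum_congr rfl fun i _ => ?_
      rw [hb, smul_smul, smul_smul, smul_smul, ← add_smul]
      congr 1
      have h1 : (RatFunc.X : RatFunc F) ^ (1 - m) = RatFunc.X * RatFunc.X ^ (-m) := by
        rw [sub_eq_add_neg, zpow_add₀ hX, zpow_one]
      have h2 : (RatFunc.X : RatFunc F) ^ (a i : ℤ) * RatFunc.X ^ (-a i : ℤ) = 1 := by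
        rw [← zpow_add₀ hX, add_neg_cancel, zpow_zero]
      rw [h1]
      simp only [f]
      linear_combination (b.repr x i * RatFunc.X * RatFunc.X ^ (-m)) * h2
    have h0 := hred c (by
      rw [hsum]
      refine (IsIntegral.smul_of_mem hx (X_zpow_mem_iff.2 (by omega))).sub
        (IsIntegral.sum _ fun i _ => IsIntegral.smul_of_mem (ha i) (hc i)))
    have h1 := hc j
    have hfj : f j ≠ 0 := by
      intro h
      rw [h, RatFunc.intDegree_zero] at hm
      omega
    rw [h0, Pi.zero_apply, map_zero, sub_zero, mul_assoc, ← zpow_add_one₀ hX,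
      mul_X_zpow_mem_iff hfj] at h1
    omega
  · rw [← b.sum_repr x]
    refine IsIntegral.sum _ fun i _ => ?_
    have h := IsIntegral.smul_of_mem (ha i) (hx i)
    rwa [smul_smul, mul_assoc, ← zpow_add₀ hX, add_neg_cancel, zpow_zero, mul_one, ← hb] at h

end ReducedBasis

theorem exp_le_of_exp_sub_one_lt {y : WithZero (Multiplicative ℤ)} {m : ℤ}
    (h : WithZero.exp (m - 1) < y) : WithZero.exp m ≤ y := by
  have hy : y ≠ 0 := (zero_le.trans_lt h).ne'
  rw [← WithZero.exp_log hy] at h ⊢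
  rw [WithZero.exp_lt_exp] at h
  rw [WithZero.exp_le_exp]
  omega

theorem le_exp_of_lt_exp_add_one {y : WithZero (Multiplicative ℤ)} {m : ℤ}
    (h : y < WithZero.exp (m + 1)) : y ≤ WithZero.exp m := by
  by_contra hlt
  have := exp_le_of_exp_sub_one_lt (m := m + 1) (y := y) (by simpa using hlt)
  exact absurd h (not_lt.2 this)

/-! ### Divisors of ideals and Riemann-Roch spaces -/

section IdealDivisors

variable {B : Type*} [CommRing B] [IsDedekindDomain B] (K : Type*) [Field K] [Algebra B K]
  [IsFractionRing B K]

/-- The condition at the primes of `B` in the definition of the space `L(D)`. -/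
theorem forall_valuation_le_iff {I : Ideal B} (hI : I ≠ ⊥) {x : K} :
    (∀ v : HeightOneSpectrum B, v.valuation K x ≤ WithZero.exp (ord I v : ℤ)) ↔
      ∀ a ∈ I, algebraMap B K a * x ∈ (algebraMap B K).range := by
  constructor
  · intro h a ha
    refine HeightOneSpectrum.mem_integers_of_valuation_le_one K _ fun v => ?_
    have h1 : v.intValuation a ≤ WithZero.exp (-(ord I v : ℤ)) := by
      rw [v.intValuation_le_pow_iff_mem]
      exact Ideal.le_of_dvd ((le_ord_iff hI).1 le_rfl) ha
    rw [map_mul, v.valuation_of_algebraMap]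
    refine (mul_le_mul' h1 (h v)).trans ?_
    rw [← WithZero.exp_add, neg_add_cancel, WithZero.exp_zero]
  · intro h v
    -- This yields an element of `I` whose order at `v` is exactly that of `I`.
    have hlt : ¬ v.asIdeal ^ (ord I v + 1) ∣ I := by
      rw [← le_ord_iff hI]
      omega
    rw [Ideal.dvd_iff_le, SetLike.le_def] at hlt
    push Not at hlt
    obtain ⟨a, ha, hav⟩ := hlt
    rw [← v.intValuation_le_pow_iff_mem, not_le] at hav
    have h1 : WithZero.exp (-(ord I v : ℤ)) ≤ v.valuation K (algebraMap B K a) := by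
      rw [v.valuation_of_algebraMap]
      refine exp_le_of_exp_sub_one_lt ?_
      convert hav using 2
      push_cast
      ring
    obtain ⟨b, hb⟩ := h a ha
    have h2 : v.valuation K (algebraMap B K a) * v.valuation K x ≤ 1 := by
      rw [← map_mul, ← hb]
      exact v.valuation_le_one b
    have h3 := (mul_le_mul_left h1 (v.valuation K x)).trans h2
    have h4 := mul_le_mul_right h3 (WithZero.exp (ord I v : ℤ))
    rwa [← mul_assoc, ← WithZero.exp_add, add_neg_cancel, WithZero.exp_zero, one_mul, mul_one]
      at h4

/-- The divisor of a nonzero ideal. -/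
def idealDiv (I : Ideal B) : Place K →₀ ℤ :=
  ((ord I).mapRange (fun n : ℕ => (n : ℤ)) Nat.cast_zero).embDomain
    ⟨Place.ofHeightOne K, Place.ofHeightOne_injective K⟩

theorem idealDiv_ofHeightOne (I : Ideal B) (v : HeightOneSpectrum B) :
    idealDiv K I (Place.ofHeightOne K v) = ord I v :=
  Finsupp.embDomain_apply_self _ _ v

theorem idealDiv_of_forall_ne (I : Ideal B) {P : Place K}
    (h : ∀ v : HeightOneSpectrum B, Place.ofHeightOne K v ≠ P) : idealDiv K I P = 0 :=
  Finsupp.embDomain_of_notMem_range _ _ _ (by rintro ⟨v, hv⟩; exact h v hv)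

theorem idealDiv_mul {I J : Ideal B} (hI : I ≠ ⊥) (hJ : J ≠ ⊥) :
    idealDiv K (I * J) = idealDiv K I + idealDiv K J := by
  ext P
  by_cases h : ∃ v : HeightOneSpectrum B, Place.ofHeightOne K v = P
  · obtain ⟨v, rfl⟩ := h
    rw [Finsupp.add_apply]
    simp only [idealDiv_ofHeightOne, ord_mul hI hJ, Finsupp.add_apply, Nat.cast_add]
  · push Not at h
    simp [idealDiv_of_forall_ne K _ h]

theorem idealDiv_nonneg (I : Ideal B) : 0 ≤ idealDiv K I := by
  intro P
  by_cases h : ∃ v : HeightOneSpectrum B, Place.ofHeightOne K v = P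
  · obtain ⟨v, rfl⟩ := h
    rw [idealDiv_ofHeightOne]
    exact Nat.cast_nonneg _
  · push Not at h
    rw [idealDiv_of_forall_ne K _ h]
    rfl

variable (F : Type*) [Field F] [Finite F] [Algebra F K]

theorem Place.logb_norm (P : Place K) [Finite P.ResidueField] :
    Real.logb (Nat.card F) P.norm = P.deg F := by
  let := P.constAlgebra F
  have : FiniteDimensional F P.ResidueField := Module.Finite.of_finite
  exact logb_natCard_eq_finrank F P.ResidueField

theorem finite_residueField_ofHeightOne [Ring.HasFiniteQuotients B] (v : HeightOneSpectrum B) :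
    Finite (Place.ofHeightOne K v).ResidueField :=
  have : Finite (B ⧸ v.asIdeal) := Ring.HasFiniteQuotients.finiteQuotient v.ne_bot
  Finite.of_equiv _ (Place.nonempty_residueField_ringEquiv K v).some.toEquiv

theorem divDeg_idealDiv [Ring.HasFiniteQuotients B] (I : Ideal B) :
    (divDeg F (idealDiv K I) : ℝ) = ordDeg (Real.logb (Nat.card F)) I := by
  rw [divDeg, idealDiv, Finsupp.sum_embDomain, Finsupp.sum_mapRange_index (fun _ => zero_mul _),
    ordDeg, Finsupp.sum, Finsupp.sum, Int.cast_sum]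
  refine Finset.sum_congr rfl fun v _ => ?_
  have := finite_residueField_ofHeightOne K v
  push_cast
  rw [← Place.norm_ofHeightOne K v, Place.logb_norm K F]
  rfl

end IdealDivisors

section RiemannRoch

variable (F : Type*) {K : Type*} [Field F] [Finite F] [Field K] [Algebra F K]

theorem divDeg_add (D E : Place K →₀ ℤ) : divDeg F (D + E) = divDeg F D + divDeg F E :=
  Finsupp.sum_add_index' (fun _ => zero_mul _) fun _ _ _ => add_mul _ _ _

theorem divDeg_single (P : Place K) (m : ℤ) : divDeg F (Finsupp.single P m) = m * P.deg F :=
  Finsupp.sum_single_index (zero_mul _)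

variable {F} in
theorem mem_rrSpace {D : Place K →₀ ℤ} {x : K} :
    x ∈ rrSpace F D ↔ ∀ P : Place K, P.val x ≤ WithZero.exp (D P) := Iff.rfl

theorem rrSpace_mono {D E : Place K →₀ ℤ} (h : D ≤ E) : rrSpace F D ≤ rrSpace F E :=
  fun _ hx P => (hx P).trans (WithZero.exp_le_exp.2 (h P))

/-- Multiply by an element `y` of order `D P + 1` at `P` and reduce modulo `P`. This linear map to
the residue field has kernel `L(D)`. -/
theorem finrank_rrSpace_add_single_le (D : Place K →₀ ℤ) (P : Place K) [Finite P.ResidueField]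
    [FiniteDimensional F (rrSpace F (D + Finsupp.single P 1))] :
    Module.finrank F (rrSpace F (D + Finsupp.single P 1)) ≤
      Module.finrank F (rrSpace F D) + P.deg F := by
  classical
  let := P.constAlgebra F
  have : FiniteDimensional F P.ResidueField := Module.Finite.of_finite
  obtain ⟨y, hy⟩ := P.val_surjective (WithZero.exp (-(D P + 1)))
  have hle : D ≤ D + Finsupp.single P 1 :=
    le_add_of_nonneg_right (Finsupp.single_nonneg.2 zero_le_one)
  have hxy (x : rrSpace F (D + Finsupp.single P 1)) : (x : K) * y ∈ P.1 := by
    rw [← P.val_le_one_iff, map_mul, hy]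
    refine (mul_le_mul_left (x.2 P) _).trans ?_
    rw [Finsupp.add_apply, Finsupp.single_eq_same, ← WithZero.exp_add, add_neg_cancel,
      WithZero.exp_zero]
  let φ : rrSpace F (D + Finsupp.single P 1) →ₗ[F] P.ResidueField :=
    { toFun x := IsLocalRing.residue P.1 ⟨x * y, hxy x⟩
      map_add' x x' := by
        rw [← map_add]
        exact congrArg _ (Subtype.ext (add_mul _ _ _))
      map_smul' c x := by
        rw [RingHom.id_apply, Algebra.smul_def,
          IsScalarTower.algebraMap_apply F P.1 P.ResidueField]
        refine Eq.trans ?_ (map_mul (IsLocalRing.residue P.1) (algebraMap F P.1 c) _)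
        refine congrArg _ (Subtype.ext ?_)
        change (c • (x : K)) * y = algebraMap F K c * (x * y)
        rw [Algebra.smul_def, mul_assoc] }
  have hker : LinearMap.ker φ =
      (rrSpace F D).comap (rrSpace F (D + Finsupp.single P 1)).subtype := by
    ext x
    have hval : φ x = 0 ↔ P.val (x * y) < 1 := by
      change IsLocalRing.residue P.1 _ = 0 ↔ _
      rw [IsLocalRing.residue_eq_zero_iff]
      exact ((IsDiscreteValuationRing.maximalIdeal P.1).valuation_lt_one_iff_mem (K := K)
        ⟨_, hxy x⟩).symm
    rw [LinearMap.mem_ker, hval, Submodule.mem_comap, Submodule.coe_subtype, mem_rrSpace, map_mul,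
      hy]
    have hP : P.val (x : K) * WithZero.exp (-(D P + 1)) < 1 ↔ P.val (x : K) ≤ WithZero.exp (D P) := by
      constructor
      · intro h
        refine le_exp_of_lt_exp_add_one ?_
        have h2 := mul_lt_mul_of_pos_right h (WithZero.exp_pos (a := D P + 1))
        rwa [mul_assoc, ← WithZero.exp_add, neg_add_cancel, WithZero.exp_zero, mul_one, one_mul]
          at h2
      · intro h
        refine (mul_le_mul_left h _).trans_lt ?_
        rw [← WithZero.exp_add, ← WithZero.exp_zero, WithZero.exp_lt_exp]
        omega
    rw [hP]
    refine ⟨fun h Q => ?_, fun h => h P⟩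
    rcases eq_or_ne Q P with rfl | hQ
    · exact h
    · have h3 := x.2 Q
      rwa [Finsupp.add_apply, Finsupp.single_eq_of_ne hQ, add_zero] at h3
  have h1 := φ.finrank_range_add_finrank_ker
  rw [hker, (Submodule.comapSubtypeEquivOfLe (rrSpace_mono F hle)).finrank_eq] at h1
  have h2 : Module.finrank F (LinearMap.range φ) ≤ P.deg F := Submodule.finrank_le _
  omega

/-- Adding a place `P` raises the degree by `deg P` and the dimension by at most as much. So the
supremum in the genus can be computed on any cofinal family of divisors. -/
theorem divDeg_sub_finrank_mono (hres : ∀ P : Place K, Finite P.ResidueField)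
    (hfin : ∀ D : Place K →₀ ℤ, FiniteDimensional F (rrSpace F D)) {D E : Place K →₀ ℤ} (h : D ≤ E) :
    divDeg F D - Module.finrank F (rrSpace F D) ≤ divDeg F E - Module.finrank F (rrSpace F E) := by
  have key (N : Place K →₀ ℕ) : ∀ D : Place K →₀ ℤ,
      divDeg F D - Module.finrank F (rrSpace F D) ≤
        divDeg F (D + N.mapRange (fun n : ℕ => (n : ℤ)) Nat.cast_zero) -
          Module.finrank F (rrSpace F (D + N.mapRange (fun n : ℕ => (n : ℤ)) Nat.cast_zero)) := by
    induction N using Finsupp.induction_linear with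
    | zero =>
      intro D
      rw [Finsupp.mapRange_zero, add_zero]
    | add M N hM hN =>
      intro D
      rw [Finsupp.mapRange_add (fun _ _ => Nat.cast_add _ _), ← add_assoc]
      exact (hM D).trans (hN _)
    | single P n =>
      induction n with
      | zero =>
        intro D
        rw [Finsupp.single_zero, Finsupp.mapRange_zero, add_zero]
      | succ n ih =>
        intro D
        refine (ih D).trans ?_
        rw [Finsupp.mapRange_single, Finsupp.mapRange_single, Nat.cast_succ, Finsupp.single_add,
          ← add_assoc]
        set E := D + Finsupp.single P (n : ℤ)
        have := hres P
        have := hfin (E + Finsupp.single P 1)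
        have h1 := finrank_rrSpace_add_single_le F E P
        rw [divDeg_add F E, divDeg_single]
        omega
  have hE : D + ((E - D).mapRange Int.toNat Int.toNat_zero).mapRange (fun n : ℕ => (n : ℤ))
      Nat.cast_zero = E := by
    ext P
    have := h P
    simp only [Finsupp.add_apply, Finsupp.mapRange_apply, Finsupp.sub_apply]
    omega
  have h1 := key ((E - D).mapRange Int.toNat Int.toNat_zero) D
  rwa [hE] at h1

end RiemannRoch

section Count

variable {F K ι : Type*} [Field F] [Field K] [Algebra (RatFunc F) K] [Algebra F K]
  [IsScalarTower F (RatFunc F) K] [Fintype ι]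

theorem finrank_of_coordinates (b : Module.Basis ι (RatFunc F) K) (e : ι → ℕ)
    (W : Submodule F K) (hW : ∀ x, x ∈ W ↔ ∀ i, ∃ p : F[X], p.natDegree ≤ e i ∧
      algebraMap F[X] (RatFunc F) p = b.repr x i) :
    FiniteDimensional F W ∧ Module.finrank F W = ∑ i, (e i + 1) := by
  let φ : (∀ i, degreeLT F (e i + 1)) →ₗ[F] K :=
    { toFun f := ∑ i, algebraMap F[X] (RatFunc F) (f i) • b i
      map_add' f g := by
        simp only [Pi.add_apply, Submodule.coe_add, map_add, add_smul, Finset.sum_add_distrib]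
      map_smul' c f := by
        rw [RingHom.id_apply, Finset.smul_sum]
        refine Finset.sum_congr rfl fun i _ => ?_
        rw [Pi.smul_apply, Submodule.coe_smul, ← smul_assoc]
        congr 1
        rw [Polynomial.smul_eq_C_mul, map_mul, RatFunc.algebraMap_C, Algebra.smul_def]
        rfl }
  have hrepr (f) (i) : b.repr (φ f) i = algebraMap F[X] (RatFunc F) (f i) :=
    congrFun (b.repr_sum_self fun i => algebraMap F[X] (RatFunc F) (f i)) i
  have hinj : Function.Injective φ := by
    intro f g h
    funext i
    have h1 := hrepr f i
    rw [h, hrepr] at h1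
    exact Subtype.ext (RatFunc.algebraMap_injective F h1.symm)
  have hrange : LinearMap.range φ = W := by
    ext x
    rw [hW]
    constructor
    · rintro ⟨f, rfl⟩ i
      refine ⟨f i, ?_, (hrepr f i).symm⟩
      have := mem_degreeLT.1 (f i).2
      exact natDegree_le_iff_degree_le.2 (Order.le_of_lt_succ (by exact_mod_cast this))
    · intro h
      choose p hp hpx using h
      refine ⟨fun i => ⟨p i, mem_degreeLT.2 ?_⟩, ?_⟩
      · refine (natDegree_le_iff_degree_le.1 (hp i)).trans_lt ?_
        exact_mod_cast Nat.lt_succ_self _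
      · refine b.ext_elem fun i => ?_
        rw [hrepr, hpx]
  have hfd (i) : FiniteDimensional F (degreeLT F (e i + 1)) :=
    Module.Finite.equiv (degreeLTEquiv F (e i + 1)).symm
  subst hrange
  refine ⟨inferInstance, ?_⟩
  rw [LinearMap.finrank_range_of_inj hinj, Module.finrank_pi_fintype]
  refine Finset.sum_congr rfl fun i _ => ?_
  rw [(degreeLTEquiv F (e i + 1)).finrank_eq, Module.finrank_fin_fun]

end Count

section Dual

variable (A k K : Type*) [CommRing A] [IsDedekindDomain A] [Field k] [Algebra A k]
  [IsFractionRing A k] [Field K] [Algebra A K] [Algebra k K] [IsScalarTower A k K]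
  [FiniteDimensional k K] [Algebra.IsSeparable k K] [IsDedekindDomain (integralClosure A K)]
  [Module.IsTorsionFree A (integralClosure A K)]

/-- Both conditions say that `x` lies in the trace dual of the integral closure, which is the
inverse of the different. -/
theorem forall_mem_differentIdeal_iff {x : K} :
    (∀ a ∈ differentIdeal A (integralClosure A K), IsIntegral A ((a : K) * x)) ↔
      ∀ y : K, IsIntegral A y → Algebra.trace k K (x * y) ∈ (algebraMap A k).range := by
  have : IsFractionRing (integralClosure A K) K :=
    integralClosure.isFractionRing_of_finite_extension k K
  let D : FractionalIdeal (nonZeroDivisors (integralClosure A K)) K :=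
    FractionalIdeal.dual A k (1 : FractionalIdeal (nonZeroDivisors (integralClosure A K)) K)
  have hD : D ≠ 0 := by
    simp [D]
  have hcoe : (↑(differentIdeal A (integralClosure A K)) :
      FractionalIdeal (nonZeroDivisors (integralClosure A K)) K) = D⁻¹ :=
    coeIdeal_differentIdeal A k K (integralClosure A K)
  have h1 : x ∈ D ↔ ∀ a ∈ differentIdeal A (integralClosure A K), IsIntegral A ((a : K) * x) := by
    rw [← inv_inv D, FractionalIdeal.mem_inv_iff (inv_ne_zero hD), ← hcoe]
    constructor
    · intro h a ha
      obtain ⟨b, hb⟩ := FractionalIdeal.mem_one_iff _ |>.1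
        (h _ (FractionalIdeal.mem_coeIdeal_of_mem _ ha))
      have h2 : (a : K) * x = (b : K) := (mul_comm _ _).trans hb.symm
      rw [h2]
      exact b.2
    · intro h y hy
      obtain ⟨a, ha, rfl⟩ := (FractionalIdeal.mem_coeIdeal _).1 hy
      refine (FractionalIdeal.mem_one_iff _).2 ⟨⟨_, h a ha⟩, mul_comm _ _⟩
  refine h1.symm.trans ((FractionalIdeal.mem_dual
    (I := (1 : FractionalIdeal (nonZeroDivisors (integralClosure A K)) K)) one_ne_zero).trans ?_)
  constructor
  · intro h y hy
    exact h y ((FractionalIdeal.mem_one_iff _).2 ⟨⟨y, hy⟩, rfl⟩)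
  · intro h y hy
    obtain ⟨b, rfl⟩ := (FractionalIdeal.mem_one_iff _).1 hy
    exact h _ b.2

end Dual

/-! ### Divisors from the two charts of a function field -/

section Genus

variable {F K : Type*} [Field F] [Finite F] [Field K] [Algebra (RatFunc F) K] [Algebra F[X] K]
  [IsScalarTower F[X] (RatFunc F) K] [FiniteDimensional (RatFunc F) K]
  [Algebra.IsSeparable (RatFunc F) K]

instance : IsDedekindDomain (integralClosure F[X] K) :=
  integralClosure.isDedekindDomain F[X] (RatFunc F) K

instance : IsDedekindDomain (integralClosure (inftyRing F) K) :=
  integralClosure.isDedekindDomain (inftyRing F) (RatFunc F) K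

instance : IsFractionRing (integralClosure F[X] K) K :=
  integralClosure.isFractionRing_of_finite_extension (RatFunc F) K

instance : IsFractionRing (integralClosure (inftyRing F) K) K :=
  integralClosure.isFractionRing_of_finite_extension (RatFunc F) K

instance : Module.IsTorsionFree F[X] K := .trans_faithfulSMul F[X] (RatFunc F) K

instance : Module.IsTorsionFree (inftyRing F) K := .trans_faithfulSMul (inftyRing F) (RatFunc F) K

instance : Module.Finite F[X] (integralClosure F[X] K) :=
  IsIntegralClosure.finite F[X] (RatFunc F) K (integralClosure F[X] K)

instance : Module.Finite (inftyRing F) (integralClosure (inftyRing F) K) :=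
  IsIntegralClosure.finite (inftyRing F) (RatFunc F) K (integralClosure (inftyRing F) K)

instance : Ring.HasFiniteQuotients (integralClosure F[X] K) := .of_module_finite F[X] _

instance : Ring.HasFiniteQuotients (integralClosure (inftyRing F) K) :=
  .of_module_finite (inftyRing F) _

theorem Place.ofHeightOne_ne_infty (v : HeightOneSpectrum (integralClosure F[X] K))
    (w : HeightOneSpectrum (integralClosure (inftyRing F) K)) :
    ofHeightOne K v ≠ ofHeightOne K w := by
  intro h
  obtain ⟨p, hp⟩ := (ofHeightOne K v).exists_liesAbove_of_isAlgebraic (K := RatFunc F)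
  refine p.not_chart_and ⟨fun a => ?_, fun a => ?_⟩
  · rw [← hp.mem_iff, ← IsScalarTower.algebraMap_apply]
    exact algebraMap_mem_ofHeightOne K v (algebraMap F[X] (integralClosure F[X] K) a)
  · rw [← hp.mem_iff, ← IsScalarTower.algebraMap_apply, h]
    exact algebraMap_mem_ofHeightOne K w
      (algebraMap (inftyRing F) (integralClosure (inftyRing F) K) a)

variable (F) in
theorem Place.exists_ofHeightOne_or (P : Place K) :
    (∃ v : HeightOneSpectrum (integralClosure F[X] K), ofHeightOne K v = P) ∨
      ∃ w : HeightOneSpectrum (integralClosure (inftyRing F) K), ofHeightOne K w = P := by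
  obtain ⟨p, hp⟩ := P.exists_liesAbove_of_isAlgebraic (K := RatFunc F)
  refine p.chart_or.imp (fun h => ?_) fun h => ?_
  · refine exists_ofHeightOne_eq K (mem_of_mem_integralClosure F[X] fun a => ?_)
    rw [IsScalarTower.algebraMap_apply F[X] (RatFunc F) K, hp.mem_iff]
    exact h a
  · refine exists_ofHeightOne_eq K (mem_of_mem_integralClosure (inftyRing F) fun a => ?_)
    rw [IsScalarTower.algebraMap_apply (inftyRing F) (RatFunc F) K, hp.mem_iff]
    exact h a

theorem Place.finite_residueField (F : Type*) {K : Type*} [Field F] [Finite F] [Field K]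
    [Algebra (RatFunc F) K] [FiniteDimensional (RatFunc F) K] [Algebra.IsSeparable (RatFunc F) K]
    (P : Place K) : Finite P.ResidueField := by
  let : Algebra F[X] K := ((algebraMap (RatFunc F) K).comp (algebraMap F[X] (RatFunc F))).toAlgebra
  have : IsScalarTower F[X] (RatFunc F) K := .of_algebraMap_eq fun _ => rfl
  rcases P.exists_ofHeightOne_or F with ⟨v, rfl⟩ | ⟨v, rfl⟩ <;>
  exact finite_residueField_ofHeightOne K v

variable [Algebra F K]

theorem mem_rrSpace_idealDiv_add {I : Ideal (integralClosure F[X] K)}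
    {J : Ideal (integralClosure (inftyRing F) K)} (hI : I ≠ ⊥) (hJ : J ≠ ⊥) {x : K} :
    x ∈ rrSpace F (idealDiv K I + idealDiv K J) ↔
      (∀ a ∈ I, IsIntegral F[X] ((a : K) * x)) ∧
        ∀ a ∈ J, IsIntegral (inftyRing F) ((a : K) * x) := by
  have h1 := forall_valuation_le_iff K hI (x := x)
  have h2 := forall_valuation_le_iff K hJ (x := x)
  have hr (y : K) : y ∈ (algebraMap (integralClosure F[X] K) K).range ↔ IsIntegral F[X] y :=
    ⟨by rintro ⟨a, rfl⟩; exact a.2, fun h => ⟨⟨y, h⟩, rfl⟩⟩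
  have hr' (y : K) : y ∈ (algebraMap (integralClosure (inftyRing F) K) K).range ↔
      IsIntegral (inftyRing F) y :=
    ⟨by rintro ⟨a, rfl⟩; exact a.2, fun h => ⟨⟨y, h⟩, rfl⟩⟩
  simp only [hr] at h1
  simp only [hr'] at h2
  refine Iff.trans ?_ (and_congr h1 h2)
  rw [mem_rrSpace]
  constructor
  · intro h
    constructor
    · intro v
      have h3 := h (Place.ofHeightOne K v)
      rwa [Place.val_ofHeightOne, Finsupp.add_apply, idealDiv_ofHeightOne,
        idealDiv_of_forall_ne K J fun w => (Place.ofHeightOne_ne_infty v w).symm, add_zero] at h3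
    · intro w
      have h3 := h (Place.ofHeightOne K w)
      rwa [Place.val_ofHeightOne, Finsupp.add_apply, idealDiv_ofHeightOne,
        idealDiv_of_forall_ne K I fun v => Place.ofHeightOne_ne_infty v w, zero_add] at h3
  · rintro ⟨h, h'⟩ P
    rcases P.exists_ofHeightOne_or F with ⟨v, rfl⟩ | ⟨w, rfl⟩
    · rw [Place.val_ofHeightOne, Finsupp.add_apply, idealDiv_ofHeightOne,
        idealDiv_of_forall_ne K J fun w => (Place.ofHeightOne_ne_infty v w).symm, add_zero]
      exact h v
    · rw [Place.val_ofHeightOne, Finsupp.add_apply, idealDiv_ofHeightOne,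
        idealDiv_of_forall_ne K I fun v => Place.ofHeightOne_ne_infty v w, zero_add]
      exact h' w

variable (F K) in
/-- The divisor `m ∞`. -/
def inftyDiv (m : ℕ) : Place K →₀ ℤ :=
  idealDiv K ((Ideal.span {inftyUnif F ^ m}).map
    (algebraMap (inftyRing F) (integralClosure (inftyRing F) K)))

variable (K) in
/-- The divisor of zeros of a polynomial. -/
def polyDiv (f : F[X]) : Place K →₀ ℤ :=
  idealDiv K ((Ideal.span {f}).map (algebraMap F[X] (integralClosure F[X] K)))

theorem span_pow_inftyUnif_ne_bot (m : ℕ) : (Ideal.span {inftyUnif F ^ m}) ≠ ⊥ := by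
  rw [ne_eq, Ideal.span_singleton_eq_bot]
  exact pow_ne_zero m inftyUnif_ne_zero

theorem inftyDiv_add (m m' : ℕ) : inftyDiv F K (m + m') = inftyDiv F K m + inftyDiv F K m' := by
  rw [inftyDiv, pow_add, ← Ideal.span_singleton_mul_span_singleton, Ideal.map_mul, idealDiv_mul]
  · rfl
  all_goals exact Ideal.map_ne_bot_of_ne_bot (span_pow_inftyUnif_ne_bot _)

theorem polyDiv_mul {f g : F[X]} (hf : f ≠ 0) (hg : g ≠ 0) :
    polyDiv K (f * g) = polyDiv K f + polyDiv K g := by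
  rw [polyDiv, ← Ideal.span_singleton_mul_span_singleton, Ideal.map_mul, idealDiv_mul]
  · rfl
  all_goals exact Ideal.map_ne_bot_of_ne_bot (by simpa using ‹_›)

theorem divDeg_inftyDiv (m : ℕ) :
    divDeg F (inftyDiv F K m) = m * Module.finrank (RatFunc F) K := by
  have h : (divDeg F (inftyDiv F K m) : ℝ) = m * Module.finrank (RatFunc F) K := by
    induction m with
    | zero =>
      rw [inftyDiv, divDeg_idealDiv, pow_zero, Ideal.span_singleton_one, Ideal.map_top, ordDeg_top]
      simp
    | succ m ih =>
      have h1 : (divDeg F (inftyDiv F K 1) : ℝ) = Module.finrank (RatFunc F) K := by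
        rw [inftyDiv, divDeg_idealDiv, ordDeg_map (RatFunc F) K (isLog_logb (one_lt_natCard F))
          (span_pow_inftyUnif_ne_bot 1), pow_one, ordDeg_span_inftyUnif, mul_one]
      rw [inftyDiv_add, divDeg_add, Int.cast_add, ih, h1]
      push_cast
      ring
  exact_mod_cast h

theorem divDeg_polyDiv {f : F[X]} (hf : f ≠ 0) :
    divDeg F (polyDiv K f) = Module.finrank (RatFunc F) K * f.natDegree := by
  have h : (divDeg F (polyDiv K f) : ℝ) = Module.finrank (RatFunc F) K * f.natDegree := by
    rw [polyDiv, divDeg_idealDiv, ordDeg_map (RatFunc F) K (isLog_logb (one_lt_natCard F))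
      (by simpa using hf), ordDeg_span_polynomial hf]
  exact_mod_cast h

/-- These divisors are cofinal: a multiple of a finite place is dominated by the zeros of a power of
a polynomial in the prime below it, and a multiple of an infinite place by a power of `1 / X`. -/
theorem exists_le_polyDiv_add_inftyDiv (D : Place K →₀ ℤ) :
    ∃ (f : F[X]) (m : ℕ), f ≠ 0 ∧ D ≤ polyDiv K f + inftyDiv F K m := by
  classical
  induction D using Finsupp.induction_linear with
  | zero => exact ⟨1, 0, one_ne_zero, add_nonneg (idealDiv_nonneg K _) (idealDiv_nonneg K _)⟩
  | add D D' h h' =>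
    obtain ⟨f, m, hf, hD⟩ := h
    obtain ⟨f', m', hf', hD'⟩ := h'
    refine ⟨f * f', m + m', mul_ne_zero hf hf', (add_le_add hD hD').trans (le_of_eq ?_)⟩
    rw [polyDiv_mul hf hf', inftyDiv_add]
    abel
  | single P z =>
    have hle (E : Place K →₀ ℤ) (hE : 0 ≤ E) (h : (z.toNat : ℤ) ≤ E P) :
        Finsupp.single P z ≤ E := by
      intro Q
      rw [Finsupp.single_apply]
      split_ifs with hQ
      · subst hQ
        have := Int.self_le_toNat z
        omega
      · exact hE Q
    have hpow {B C : Type _} [CommRing B] [CommRing C] [IsDedekindDomain C] [Algebra B C]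
        (w : HeightOneSpectrum C) (y : B) (hy : y ∈ w.asIdeal.comap (algebraMap B C)) (n : ℕ)
        (h0 : (Ideal.span {y ^ n}).map (algebraMap B C) ≠ ⊥) :
        n ≤ ord ((Ideal.span {y ^ n}).map (algebraMap B C)) w := by
      rw [le_ord_iff h0, Ideal.dvd_iff_le, Ideal.map_span, Set.image_singleton, map_pow,
        Ideal.span_singleton_le_iff_mem]
      exact Ideal.pow_mem_pow (Ideal.mem_comap.1 hy) n
    rcases P.exists_ofHeightOne_or F with ⟨v, rfl⟩ | ⟨w, rfl⟩
    · obtain ⟨f, hf, hf0⟩ := Submodule.exists_mem_ne_zero_of_ne_bot (under F[X] v).ne_bot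
      refine ⟨f ^ z.toNat, 0, pow_ne_zero _ hf0, hle _
        (add_nonneg (idealDiv_nonneg K _) (idealDiv_nonneg K _)) ?_⟩
      refine le_add_of_le_of_nonneg ?_ (idealDiv_nonneg K _ _)
      rw [polyDiv, idealDiv_ofHeightOne]
      exact_mod_cast hpow v f hf _ (Ideal.map_ne_bot_of_ne_bot (by
        rw [ne_eq, Ideal.span_singleton_eq_bot]
        exact pow_ne_zero _ hf0))
    · refine ⟨1, z.toNat, one_ne_zero, hle _
        (add_nonneg (idealDiv_nonneg K _) (idealDiv_nonneg K _)) ?_⟩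
      refine le_add_of_nonneg_of_le (idealDiv_nonneg K _ _) ?_
      rw [inftyDiv, idealDiv_ofHeightOne]
      have hmax : (under (inftyRing F) w).asIdeal = Ideal.span {inftyUnif F} :=
        (IsLocalRing.eq_maximalIdeal (under (inftyRing F) w).isMaximal).trans
          (IsLocalRing.eq_maximalIdeal isMaximal_span_inftyUnif).symm
      have hy : inftyUnif F ∈ (under (inftyRing F) w).asIdeal := by
        rw [hmax]
        exact Ideal.mem_span_singleton_self _
      exact_mod_cast hpow w _ hy _ (Ideal.map_ne_bot_of_ne_bot (span_pow_inftyUnif_ne_bot _))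

end Genus

/-! ### The genus and the degree of the different -/

section GenusFormula

variable {F K : Type*} [Field F] [Finite F] [Field K] [Algebra (RatFunc F) K] [Algebra F[X] K]
  [IsScalarTower F[X] (RatFunc F) K] [FiniteDimensional (RatFunc F) K]
  [Algebra.IsSeparable (RatFunc F) K] [Algebra F K]

theorem forall_mem_map_span_iff {B C : Type*} [CommRing B] [CommRing C] [Algebra B C] {p : C → Prop}
    (hp : ∀ c d, p d → p (c * d)) (y : B) :
    (∀ c ∈ (Ideal.span {y}).map (algebraMap B C), p c) ↔ p (algebraMap B C y) := by
  rw [Ideal.map_span, Set.image_singleton]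
  refine ⟨fun h => h _ (Ideal.mem_span_singleton_self _), fun h c hc => ?_⟩
  obtain ⟨d, rfl⟩ := Ideal.mem_span_singleton'.1 hc
  exact hp _ _ h

theorem algebraMap_inftyUnif_pow (m : ℕ) (x : K) :
    ((algebraMap (inftyRing F) (integralClosure (inftyRing F) K) (inftyUnif F ^ m) :
      integralClosure (inftyRing F) K) : K) * x = (RatFunc.X : RatFunc F) ^ (-m : ℤ) • x := by
  rw [Algebra.smul_def, zpow_neg, zpow_natCast, ← inv_pow, ← zpow_neg_one]
  rfl

theorem mem_rrSpace_polyDiv_add_inftyDiv {f : F[X]} (hf : f ≠ 0) (m : ℕ) {x : K} :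
    x ∈ rrSpace F (polyDiv K f + inftyDiv F K m) ↔
      IsIntegral F[X] (algebraMap F[X] (RatFunc F) f • x) ∧
        IsIntegral (inftyRing F) ((RatFunc.X : RatFunc F) ^ (-m : ℤ) • x) := by
  rw [polyDiv, inftyDiv, mem_rrSpace_idealDiv_add
    (Ideal.map_ne_bot_of_ne_bot (by simpa using hf))
    (Ideal.map_ne_bot_of_ne_bot (span_pow_inftyUnif_ne_bot m))]
  refine and_congr ?_ ?_
  · rw [forall_mem_map_span_iff
      (p := fun c : integralClosure F[X] K => IsIntegral F[X] ((c : K) * x))]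
    · rw [algebraMap_smul, Algebra.smul_def]
      rfl
    · intro c d hd
      change IsIntegral F[X] ((c : K) * d * x)
      rw [mul_assoc]
      exact IsIntegral.mul c.2 hd
  · rw [forall_mem_map_span_iff
      (p := fun c : integralClosure (inftyRing F) K => IsIntegral (inftyRing F) ((c : K) * x)),
      algebraMap_inftyUnif_pow]
    intro c d hd
    change IsIntegral (inftyRing F) ((c : K) * d * x)
    rw [mul_assoc]
    exact IsIntegral.mul c.2 hd

variable (F K) in
/-- The divisor of the different, increased by `m ∞`. -/
def differentDiv (m : ℕ) : Place K →₀ ℤ :=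
  idealDiv K (differentIdeal F[X] (integralClosure F[X] K)) +
    idealDiv K (differentIdeal (inftyRing F) (integralClosure (inftyRing F) K) *
      (Ideal.span {inftyUnif F ^ m}).map
        (algebraMap (inftyRing F) (integralClosure (inftyRing F) K)))

variable (F K) in
theorem different_polynomial_ne_bot : differentIdeal F[X] (integralClosure F[X] K) ≠ ⊥ :=
  different_ne_bot F[X] (integralClosure F[X] K) (RatFunc F) K

variable (F K) in
theorem different_inftyRing_ne_bot :
    differentIdeal (inftyRing F) (integralClosure (inftyRing F) K) ≠ ⊥ :=
  different_ne_bot (inftyRing F) (integralClosure (inftyRing F) K) (RatFunc F) K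

theorem mem_rrSpace_differentDiv (m : ℕ) {x : K} :
    x ∈ rrSpace F (differentDiv F K m) ↔
      (∀ y : K, IsIntegral F[X] y →
        Algebra.trace (RatFunc F) K (x * y) ∈ (algebraMap F[X] (RatFunc F)).range) ∧
      ∀ y : K, IsIntegral (inftyRing F) y →
        RatFunc.X ^ (-m : ℤ) * Algebra.trace (RatFunc F) K (x * y) ∈ inftyRing F := by
  rw [differentDiv, mem_rrSpace_idealDiv_add (different_polynomial_ne_bot F K)
    (mul_ne_zero (different_inftyRing_ne_bot F K)
      (Ideal.map_ne_bot_of_ne_bot (span_pow_inftyUnif_ne_bot m))),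
    forall_mem_differentIdeal_iff F[X] (RatFunc F) K]
  refine and_congr Iff.rfl ?_
  have h := forall_mem_differentIdeal_iff (inftyRing F) (RatFunc F) K
    (x := (RatFunc.X : RatFunc F) ^ (-m : ℤ) • x)
  simp only [smul_mul_assoc, map_smul, smul_eq_mul] at h
  refine Iff.trans ?_ (h.trans ?_)
  · rw [Ideal.map_span, Set.image_singleton]
    constructor
    · intro h a ha
      have h1 := h _ (Ideal.mul_mem_mul ha (Ideal.mem_span_singleton_self _))
      rw [MulMemClass.coe_mul, mul_assoc, algebraMap_inftyUnif_pow] at h1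
      exact h1
    · intro h a ha
      obtain ⟨d, hd, rfl⟩ := Ideal.mem_mul_span_singleton.1 ha
      rw [MulMemClass.coe_mul, mul_assoc, algebraMap_inftyUnif_pow]
      exact h d hd
  · refine forall₂_congr fun y _ => ⟨?_, fun hy => ⟨⟨_, hy⟩, rfl⟩⟩
    rintro ⟨a, ha⟩
    rw [← ha]
    exact a.2

open Module

variable {ι : Type*} [Fintype ι] (b : Basis ι (RatFunc F) K) (a : ι → ℕ)
  [IsScalarTower F (RatFunc F) K]

/-- In the basis `f⁻¹ • b` the space consists of the vectors of polynomials of degree at most `m +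
deg f - a i`. The bound `a i ≤ m` keeps the natural subtraction from truncating. -/
theorem finrank_rrSpace_polyDiv_add_inftyDiv
    (hO : ∀ x, IsIntegral F[X] x ↔ ∀ i, b.repr x i ∈ (algebraMap F[X] (RatFunc F)).range)
    (hS : ∀ x, IsIntegral (inftyRing F) x ↔
      ∀ i, b.repr x i * RatFunc.X ^ (a i : ℤ) ∈ inftyRing F)
    {f : F[X]} (hf : f ≠ 0) {m : ℕ} (hm : ∀ i, a i ≤ m) :
    FiniteDimensional F (rrSpace F (polyDiv K f + inftyDiv F K m)) ∧
    finrank F (rrSpace F (polyDiv K f + inftyDiv F K m)) =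
      ∑ i, (m + f.natDegree - a i + 1) := by
  have hf0 : algebraMap F[X] (RatFunc F) f ≠ 0 := by simpa using hf
  have hX : (RatFunc.X : RatFunc F) ≠ 0 := RatFunc.X_ne_zero
  let b' := b.map (LinearEquiv.smulOfNeZero (RatFunc F) K _ hf0).symm
  have hb' (x : K) (i : ι) : b'.repr x i = algebraMap F[X] (RatFunc F) f * b.repr x i := by
    change b.repr (algebraMap F[X] (RatFunc F) f • x) i = _
    rw [map_smul, Finsupp.smul_apply, smul_eq_mul]
  refine finrank_of_coordinates b' _ _ fun x => ?_
  rw [mem_rrSpace_polyDiv_add_inftyDiv hf, hO, hS, ← forall_and]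
  refine forall_congr' fun i => ?_
  rw [hb', map_smul, map_smul, Finsupp.smul_apply, Finsupp.smul_apply, smul_eq_mul, smul_eq_mul]
  have key (p : F[X]) (hp : algebraMap F[X] (RatFunc F) p =
      algebraMap F[X] (RatFunc F) f * b.repr x i) :
      RatFunc.X ^ (-m : ℤ) * b.repr x i * RatFunc.X ^ (a i : ℤ) ∈ inftyRing F ↔
        p.natDegree ≤ m + f.natDegree - a i := by
    rcases eq_or_ne (b.repr x i) 0 with h0 | h0
    · rw [h0, mul_zero] at hp
      have hp0 : p = 0 := by simpa using hp
      simp [h0, hp0]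
    · have hdeg := congrArg RatFunc.intDegree hp
      rw [RatFunc.intDegree_mul hf0 h0, RatFunc.intDegree_polynomial,
        RatFunc.intDegree_polynomial] at hdeg
      rw [mul_comm _ (b.repr x i), mul_assoc, ← zpow_add₀ hX, mul_X_zpow_mem_iff h0]
      have := hm i
      omega
  constructor
  · rintro ⟨⟨p, hp⟩, h⟩
    exact ⟨p, (key p hp).1 h, hp⟩
  · rintro ⟨p, h, hp⟩
    exact ⟨⟨p, hp⟩, (key p hp).2 h⟩

/-- Membership is a condition on traces, hence diagonal in the trace dual of `b`. Duality changes
the sign of the exponents `a i`, so the coordinates are polynomials of degree at most `m + a i`. -/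
theorem finrank_rrSpace_differentDiv
    (hO : ∀ x, IsIntegral F[X] x ↔ ∀ i, b.repr x i ∈ (algebraMap F[X] (RatFunc F)).range)
    (hS : ∀ x, IsIntegral (inftyRing F) x ↔
      ∀ i, b.repr x i * RatFunc.X ^ (a i : ℤ) ∈ inftyRing F) (m : ℕ) :
    finrank F (rrSpace F (differentDiv F K m)) = ∑ i, (m + a i + 1) := by
  classical
  have hX : (RatFunc.X : RatFunc F) ≠ 0 := RatFunc.X_ne_zero
  let b' := (Algebra.traceForm (RatFunc F) K).dualBasis (traceForm_nondegenerate (RatFunc F) K) b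
  have hb' (x : K) (i : ι) : b'.repr x i = Algebra.trace (RatFunc F) K (x * b i) :=
    LinearMap.BilinForm.dualBasis_repr_apply _ _ _ _
  refine (finrank_of_coordinates b' _ _ fun x => ?_).2
  have htr (y : K) : Algebra.trace (RatFunc F) K (x * y) = ∑ i, b.repr y i * b'.repr x i := by
    conv_lhs => rw [← b.sum_repr y]
    rw [Finset.mul_sum, map_sum]
    refine Finset.sum_congr rfl fun i _ => ?_
    rw [mul_smul_comm, map_smul, hb', smul_eq_mul]
  have h1 : (∀ y : K, IsIntegral F[X] y →
      Algebra.trace (RatFunc F) K (x * y) ∈ (algebraMap F[X] (RatFunc F)).range) ↔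
      ∀ i, b'.repr x i ∈ (algebraMap F[X] (RatFunc F)).range := by
    constructor
    · intro h i
      rw [hb']
      refine h _ ((hO _).2 fun j => ?_)
      rw [b.repr_self, Finsupp.single_apply]
      split_ifs
      · exact one_mem _
      · exact zero_mem _
    · intro h y hy
      rw [htr]
      exact sum_mem fun i _ => mul_mem ((hO y).1 hy i) (h i)
  have h2 : (∀ y : K, IsIntegral (inftyRing F) y →
      RatFunc.X ^ (-m : ℤ) * Algebra.trace (RatFunc F) K (x * y) ∈ inftyRing F) ↔
      ∀ i, b'.repr x i * RatFunc.X ^ (-(m + a i : ℕ) : ℤ) ∈ inftyRing F := by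
    have hsplit (i : ι) : (RatFunc.X : RatFunc F) ^ (-(m + a i : ℕ) : ℤ) =
        RatFunc.X ^ (-m : ℤ) * RatFunc.X ^ (-a i : ℤ) := by
      rw [← zpow_add₀ hX]
      congr 1
      push_cast
      ring
    have hcancel (i : ι) : (RatFunc.X : RatFunc F) ^ (a i : ℤ) * RatFunc.X ^ (-a i : ℤ) = 1 := by
      rw [← zpow_add₀ hX, add_neg_cancel, zpow_zero]
    constructor
    · intro h i
      have h3 := h ((RatFunc.X : RatFunc F) ^ (-a i : ℤ) • b i) ((hS _).2 fun j => by
        rw [map_smul, b.repr_self, Finsupp.smul_apply, Finsupp.single_apply]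
        split_ifs with hij
        · subst hij
          rw [smul_eq_mul, mul_one, mul_comm, hcancel]
          exact one_mem _
        · rw [smul_zero, zero_mul]
          exact zero_mem _)
      rw [mul_smul_comm, map_smul, ← hb', smul_eq_mul] at h3
      convert h3 using 1
      rw [hsplit]
      ring
    · intro h y hy
      rw [htr, Finset.mul_sum]
      refine sum_mem fun i _ => ?_
      convert mul_mem ((hS y).1 hy i) (h i) using 1
      rw [hsplit]
      linear_combination (-(b.repr y i * b'.repr x i * RatFunc.X ^ (-m : ℤ))) * hcancel i
  rw [mem_rrSpace_differentDiv, h1, h2, ← forall_and]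
  refine forall_congr' fun i => ?_
  constructor
  · rintro ⟨⟨p, hp⟩, h⟩
    rw [← hp] at h
    exact ⟨p, (algebraMap_mul_X_zpow_mem_iff rfl).1 h, hp⟩
  · rintro ⟨p, h, hp⟩
    rw [← hp]
    exact ⟨⟨p, rfl⟩, (algebraMap_mul_X_zpow_mem_iff rfl).2 h⟩

variable (F K) in
/-- The genus formula of Riemann and Hurwitz, over the field of rational functions. -/
theorem two_mul_ffGenus :
    2 * (ffGenus F K : ℝ) - 2 + 2 * finrank (RatFunc F) K =
      diffDeg F[X] (RatFunc F) K (Real.logb (Nat.card F)) +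
        diffDeg (inftyRing F) (RatFunc F) K (Real.logb (Nat.card F)) := by
  obtain ⟨ι, _, b, a, hO, hS⟩ := exists_reduced_basis (F := F) (K := K)
  have hn : finrank (RatFunc F) K = Fintype.card ι := finrank_eq_card_basis b
  have hres := Place.finite_residueField F (K := K)
  set s : ℕ := ∑ i, a i with hs
  have ham (i : ι) : a i ≤ s := Finset.single_le_sum (fun _ _ => Nat.zero_le _) (Finset.mem_univ i)
  have hmono (m m' : ℕ) (h : m ≤ m') : inftyDiv F K m ≤ inftyDiv F K m' := by
    obtain ⟨d, rfl⟩ := Nat.exists_eq_add_of_le h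
    rw [inftyDiv_add]
    exact le_add_of_nonneg_right (idealDiv_nonneg K _)
  have hbound (D : Place K →₀ ℤ) : ∃ (f : F[X]) (m : ℕ), f ≠ 0 ∧ (∀ i, a i ≤ m) ∧
      D ≤ polyDiv K f + inftyDiv F K m := by
    obtain ⟨f, m, hf, hD⟩ := exists_le_polyDiv_add_inftyDiv (F := F) D
    exact ⟨f, m + s, hf, fun i => (ham i).trans (Nat.le_add_left _ _),
      hD.trans (add_le_add_right (hmono _ _ (Nat.le_add_right _ _)) _)⟩
  have hfin (D : Place K →₀ ℤ) : FiniteDimensional F (rrSpace F D) := by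
    obtain ⟨f, m, hf, hm, hD⟩ := hbound D
    have := (finrank_rrSpace_polyDiv_add_inftyDiv b a hO hS hf hm).1
    exact Submodule.finiteDimensional_of_le (rrSpace_mono F hD)
  -- On a cofinal family `deg D - dim L(D)` is constantly `s - n`, so the genus is `s - n + 1`.
  have hval (f : F[X]) (hf : f ≠ 0) (m : ℕ) (hm : ∀ i, a i ≤ m) :
      divDeg F (polyDiv K f + inftyDiv F K m) -
        finrank F (rrSpace F (polyDiv K f + inftyDiv F K m)) = s - (Fintype.card ι : ℤ) := by
    rw [(finrank_rrSpace_polyDiv_add_inftyDiv b a hO hS hf hm).2, divDeg_add, divDeg_inftyDiv,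
      divDeg_polyDiv hf, hn, hs]
    push_cast
    have h1 (i : ι) : ((m + f.natDegree - a i : ℕ) : ℤ) = m + f.natDegree - a i := by
      have := hm i
      omega
    simp only [h1, Finset.sum_add_distrib, Finset.sum_sub_distrib, Finset.sum_const,
      Finset.card_univ, nsmul_eq_mul]
    ring
  have hle (D : Place K →₀ ℤ) :
      divDeg F D - finrank F (rrSpace F D) ≤ s - (Fintype.card ι : ℤ) := by
    obtain ⟨f, m, hf, hm, hD⟩ := hbound D
    exact (divDeg_sub_finrank_mono F hres hfin hD).trans (hval f hf m hm).le
  have hg : ffGenus F K = s - (Fintype.card ι : ℤ) + 1 := by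
    refine le_antisymm (ciSup_le fun D => add_le_add_left (hle D) 1) ?_
    rw [← hval 1 one_ne_zero s ham]
    refine le_ciSup (f := fun D : Place K →₀ ℤ =>
      divDeg F D - (finrank F (rrSpace F D) : ℤ) + 1) ⟨s - (Fintype.card ι : ℤ) + 1, ?_⟩ _
    rintro _ ⟨D, rfl⟩
    exact add_le_add_left (hle D) 1
  -- This divisor dominates `s ∞`, where the maximum is already attained.
  have hdiff : divDeg F (differentDiv F K s) - finrank F (rrSpace F (differentDiv F K s)) =
      s - (Fintype.card ι : ℤ) := by
    refine le_antisymm (hle _) ?_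
    rw [← hval 1 one_ne_zero s ham]
    refine divDeg_sub_finrank_mono F hres hfin ?_
    have h1 : polyDiv K (1 : F[X]) = 0 := by
      rw [polyDiv, Ideal.span_singleton_one, Ideal.map_top, idealDiv, ord_top]
      simp
    rw [h1, zero_add, differentDiv, idealDiv_mul K (different_inftyRing_ne_bot F K)
      (Ideal.map_ne_bot_of_ne_bot (span_pow_inftyUnif_ne_bot s)), ← add_assoc]
    exact le_add_of_nonneg_left (add_nonneg (idealDiv_nonneg K _) (idealDiv_nonneg K _))
  have hdeg : (divDeg F (differentDiv F K s) : ℝ) =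
      diffDeg F[X] (RatFunc F) K (Real.logb (Nat.card F)) +
        diffDeg (inftyRing F) (RatFunc F) K (Real.logb (Nat.card F)) + s * Fintype.card ι := by
    have h1 := divDeg_inftyDiv (F := F) (K := K) s
    rw [hn] at h1
    rw [differentDiv, idealDiv_mul K (different_inftyRing_ne_bot F K)
      (Ideal.map_ne_bot_of_ne_bot (span_pow_inftyUnif_ne_bot s)), ← inftyDiv, divDeg_add,
      divDeg_add, h1]
    push_cast
    rw [divDeg_idealDiv, divDeg_idealDiv, ← add_assoc]
    rfl
  have hdiff' : (divDeg F (differentDiv F K s) : ℝ) -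
      finrank F (rrSpace F (differentDiv F K s)) = s - (Fintype.card ι : ℝ) := by
    exact_mod_cast hdiff
  have hsum : (finrank F (rrSpace F (differentDiv F K s)) : ℝ) =
      s * Fintype.card ι + s + Fintype.card ι := by
    rw [finrank_rrSpace_differentDiv b a hO hS s]
    push_cast
    simp only [Finset.sum_add_distrib, Finset.sum_const, Finset.card_univ, nsmul_eq_mul, mul_one]
    rw [hs]
    push_cast
    ring
  -- With `δ` the degree of the different, `δ + s n - (s n + s + n) = s - n`. Hence `δ = 2 s = 2 g -
  -- 2 + 2 n`.
  rw [hg, hn]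
  push_cast
  linarith

end GenusFormula

/-! ### Function fields -/

section FunctionField

variable {F M : Type*} [Field F] [Finite F] [Field M] [Algebra (RatFunc F) M] [Algebra F M]
  [IsScalarTower F (RatFunc F) M] [Algebra.IsSeparable (RatFunc F) M]

theorem isDiffDegree_ff : IsDiffDegree (Real.logb (Nat.card F)) fun K : Sub (RatFunc F) M =>
    2 * (ffGenus F K.1 : ℝ) - 2 + 2 * K.degree := by
  let : Algebra F[X] M := ((algebraMap (RatFunc F) M).comp (algebraMap F[X] (RatFunc F))).toAlgebra
  have : IsScalarTower F[X] (RatFunc F) M := .of_algebraMap_eq fun _ => rfl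
  have h := isDiffDegree_of_two_charts (M := M) (k := RatFunc F) F[X] (inftyRing F)
    (isLog_logb (one_lt_natCard F)) Place.chart_or Place.not_chart_and
  convert! h using 2 with K
  exact two_mul_ffGenus F K.1

theorem countable_ratFunc : Countable (RatFunc F) := by
  have : Countable F[X] := by
    rw [← Cardinal.mk_le_aleph0_iff]
    exact Polynomial.cardinalMk_le_max.trans (max_le Cardinal.mk_le_aleph0 le_rfl)
  refine Function.Injective.countable (f := fun x : RatFunc F => (x.num, x.denom)) fun x y h => ?_
  obtain ⟨h1, h2⟩ := Prod.mk.inj h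
  rw [← x.num_div_denom, ← y.num_div_denom, h1, h2]

theorem phiInftyPos_iff (hM : ¬ FiniteDimensional (RatFunc F) M) :
    PhiInftyPos F M ↔ DiffBounded fun K : Sub (RatFunc F) M =>
      2 * (ffGenus F K.1 : ℝ) - 2 + 2 * K.degree := by
  constructor
  · rintro ⟨φ, hφ, h0⟩
    have := countable_ratFunc (F := F)
    have := countable_of_isAlgebraic (k := RatFunc F) (M := M)
    obtain ⟨K, hK⟩ := exists_isTower hM
    exact isDiffDegree_ff.bounded_of_hasInvariant (C := 1) (fun _ => le_rfl)
      (fun K => by linarith) hK hφ h0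
  intro hb
  rw [diffBounded_iff] at hb
  -- This is the limit of `g / n = (H / n) / 2 - 1 + 1 / n`, since the degrees tend to infinity.
  refine hasInvariant_of_tendsto (γ := (⨆ L : Sub (RatFunc F) M,
    (2 * (ffGenus F L.1 : ℝ) - 2 + 2 * L.degree) / L.degree) / 2 - 1 + 0) one_pos
    (fun K hK => ?_) fun K hK => ?_
  · refine tendsto_const_nhds.congr fun i => ?_
    have := (K i).degree_pos
    exact (div_self (by positivity)).symm
  · have h1 := tendsto_iSup_of_isTower (fun K L h => isDiffDegree_ff.div_mono h) hb hK
    have h2 : Tendsto (fun i => ((K i).degree : ℝ)⁻¹) atTop (𝓝 0) :=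
      tendsto_inv_atTop_zero.comp hK.tendsto_degree
    refine (((h1.div_const 2).sub_const 1).add h2).congr fun i => ?_
    have hn : (0 : ℝ) < (K i).degree := by exact_mod_cast (K i).degree_pos
    field_simp
    ring

end FunctionField

end InfGlobal

end

theorem mainTheorem12 :
    -- number fields
    (∀ (M : Type*) [Field M] [CharZero M] [Algebra.IsAlgebraic ℚ M],
      ¬ FiniteDimensional ℚ M → InfGlobal.EventuallyTame ℚ M →
        ((InfGlobal.Ram ℚ M).Finite → InfGlobal.AsymptoticallyGood M) ∧
        ((∃ K : InfGlobal.Sub ℚ M, IsGalois K.1 M) →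
          InfGlobal.AsymptoticallyGood M → (InfGlobal.Ram ℚ M).Finite) ∧
        (∀ (K : ℕ → InfGlobal.Sub ℚ M) (hK : InfGlobal.IsTower K), hK.IsGaloisTower →
          (InfGlobal.AsymptoticallyGood M ↔ hK.ramSeries Real.log < ⊤))) ∧
    -- function fields with field of constants `F`
    (∀ (F M : Type*) [Field F] [Finite F] [Field M] [Algebra (RatFunc F) M]
      [Algebra F M] [IsScalarTower F (RatFunc F) M] [Algebra.IsSeparable (RatFunc F) M],
      ¬ FiniteDimensional (RatFunc F) M → algebraicClosure F M = ⊥ →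
      InfGlobal.EventuallyTame (RatFunc F) M →
        ((InfGlobal.Ram (RatFunc F) M).Finite → InfGlobal.PhiInftyPos F M) ∧
        ((∃ K : InfGlobal.Sub (RatFunc F) M, IsGalois K.1 M) →
          InfGlobal.PhiInftyPos F M → (InfGlobal.Ram (RatFunc F) M).Finite) ∧
        (∀ (K : ℕ → InfGlobal.Sub (RatFunc F) M) (hK : InfGlobal.IsTower K), hK.IsGaloisTower →
          (InfGlobal.PhiInftyPos F M ↔ hK.ramSeries (Real.logb (Nat.card F)) < ⊤))) := by
  refine ⟨fun M _ _ _ hM ht => ?_, fun F M _ _ _ _ _ _ _ hM _ ht => ?_⟩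
  · rw [InfGlobal.asymptoticallyGood_iff hM]
    exact ⟨InfGlobal.isDiffDegree_nf.bounded_of_ram_finite ht,
      fun ⟨K, _⟩ hb => InfGlobal.isDiffDegree_nf.ram_finite_of_isGalois hb K,
      fun K hK hG => InfGlobal.isDiffDegree_nf.bounded_iff_of_isGaloisTower ht hK hG⟩
  · rw [InfGlobal.phiInftyPos_iff hM]
    exact ⟨InfGlobal.isDiffDegree_ff.bounded_of_ram_finite ht,
      fun ⟨K, _⟩ hb => InfGlobal.isDiffDegree_ff.ram_finite_of_isGalois hb K,
      fun K hK hG => InfGlobal.isDiffDegree_ff.bounded_iff_of_isGaloisTower ht hK hG⟩
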